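/- Let $q$ be a real number with $q\neq 0$ and $q^2\neq 1$. Let $B(R)$ be the unital complex $*$-algebra generated by $a,b,c,d$ with relations $$ba=q^2ab,\quad ac=q^2ca,\quad ad=da,\quad bc=cb+(1-q^{-2})a(d-a),$$ $$db=bd+(1-q^{-2})ab,\quad cd=dc+(1-q^{-2})ca,\quad ad-q^2cb=1,$$ and $a^*=a,\ b^*=c,\ c^*=b,\ d^*=d$. Put $p=q^{-2}a+d$, which is central. On $B(R)\otimes B(R)$ let $(x\otimes y)^*=y^*\otimes x^*$. A *braided Hopf $*$-algebra structure* on $B(R)$ consists of linear maps $\Delta:B\to B\otimes B$, $\epsilon:B\to\mathbb C$, $S:B\to B$, $\psi:B\otimes B\to B\otimes B$ such that, with $m$ the product and $\eta$ the unit: $(\mathrm{id}\otimes\Delta)\Delta=(\Delta\otimes\mathrm{id})\Delta$; $(\epsilon\otimes\mathrm{id})\Delta=(\mathrm{id}\otimes\epsilon)\Delta=\mathrm{id}$; $m(\mathrm{id}\otimes S)\Delta=m(S\otimes\mathrm{id})\Delta=\eta\epsilon$; $\psi(1\otimes x)=x\otimes1$, $\psi(x\otimes 1)=1\otimes x$;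 $\psi(m\otimes\mathrm{id})=(\mathrm{id}\otimes m)(\psi\otimes\mathrm{id})(\mathrm{id}\otimes\psi)$; $\psi(\mathrm{id}\otimes m)=(m\otimes\mathrm{id})(\mathrm{id}\otimes\psi)(\psi\otimes\mathrm{id})$; $(\mathrm{id}\otimes\Delta)\psi=(\psi\otimes\mathrm{id})(\mathrm{id}\otimes\psi)(\Delta\otimes\mathrm{id})$; $(\Delta\otimes\mathrm{id})\psi=(\mathrm{id}\otimes\psi)(\psi\otimes\mathrm{id})(\mathrm{id}\otimes\Delta)$; $\Delta m=(m\otimes m)(\mathrm{id}\otimes\psi\otimes\mathrm{id})(\Delta\otimes\Delta)$, $\Delta(1)=1\otimes 1$; $Sm=m\psi(S\otimes S)$; $\Delta S=(S\otimes S)\psi\Delta$; $\epsilon(xy)=\epsilon(x)\epsilon(y)$, $\epsilon(1)=1$; $\psi$ satisfies the braid relation $(\psi\otimes\mathrm{id})(\mathrm{id}\otimes\psi)(\psi\otimes\mathrm{id})=(\mathrm{id}\otimes\psi)(\psi\otimes\mathrm{id})(\mathrm{id}\otimes\psi)$; $\Delta(x^*)=\Delta(x)^*$; $S(x^*)=S(x)^*$;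 and $(x\otimes y)^*=y^*\otimes x^*$ is antimultiplicative for the braided product $(m\otimes m)(\mathrm{id}\otimes\psi\otimes\mathrm{id})$ on $B\otimes B$. Call such a structure a *solution* if it has the following form, with arbitrary complex coefficients. 1. Each of $\Delta(a),\Delta(p),\psi(a\otimes a),\psi(c\otimes b),\psi(b\otimes c)$ is a linear combination of $a\otimes a,\ b\otimes c,\ c\otimes b,\ p\otimes a,\ a\otimes p,\ 1\otimes a,\ a\otimes1,\ 1\otimes1,\ p\otimes p,\ 1\otimes p,\ p\otimes1$. 2. $\Delta(b)=B_1a\otimes b+B_2b\otimes a+B_3b\otimes p+B_4p\otimes b+B_5\,1\otimes b+B_6b\otimes1$ and $\Delta(c)=B_1c\otimes a+B_2a\otimes c+B_3p\otimes c+B_4c\otimes p+B_5c\otimes1+B_6\,1\otimes c$. 3. $\epsilon(b)=\epsilon(c)$. 4. $S(a)$, $S(p)$ are linear combinations of $a,b,c,p,1$; $S(b)=m_1a+m_2b+m_3c+m_4p+m_5$ and $S(c)=m_1a+m_2c+m_3b+m_4p+m_5$. 5. $\psi(a\otimes b)$ is a linear combination of $b\otimes a,\ a\otimes b,\ p\otimes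 b,\ b\otimes p,\ 1\otimes b,\ b\otimes1$; $\psi(a\otimes c)$ is a linear combination of $c\otimes a,\ a\otimes c,\ p\otimes c,\ c\otimes p,\ 1\otimes c,\ c\otimes1$; $\psi(b\otimes b)$ is a multiple of $b\otimes b$; and $\psi(c\otimes a)=\psi(a\otimes b)^*$, $\psi(b\otimes a)=\psi(a\otimes c)^*$, $\psi(c\otimes c)=\psi(b\otimes b)^*$. 6. $\psi(p\otimes x)=x\otimes p$ and $\psi(x\otimes p)=p\otimes x$ for all $x\in B(R)$. **Theorem.** There are exactly two solutions with $\epsilon(a)=1$. Every solution is one of these two or is obtained from one of them by transport along the algebra automorphism $\sigma$ of $B(R)$ with $\sigma(a)=-a$, $\sigma(b)=-b$, $\sigma(c)=-c$, $\sigma(d)=-d$; conversely these transports are solutions. The two solutions are the following (the values $\psi(c\otimes a)$, $\psi(b\otimes a)$, $\psi(c\otimes c)$ being given by item 5). *First solution.* $\Delta(a)=a\otimes a+b\otimes c$, $\Delta(b)=a\otimes b-q^{-2}b\otimes a+b\otimes p$, $\Delta(c)=c\otimes a-q^{-2}a\otimes c+p\otimes c$, $\Delta(p)=(q^{-2}+q^{-4})a\otimes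 a+q^{-2}b\otimes c+c\otimes b-q^{-2}p\otimes a-q^{-2}a\otimes p+p\otimes p$; $\epsilon(a)=1$, $\epsilon(b)=\epsilon(c)=0$, $\epsilon(p)=1+q^{-2}$; $S(a)=q^2(p-a)$, $S(b)=-q^2b$, $S(c)=-q^2c$, $S(p)=p$; $\psi(a\otimes a)=a\otimes a+(1-q^2)b\otimes c$, $\psi(a\otimes b)=b\otimes a$, $\psi(a\otimes c)=c\otimes a+(q^2-q^{-2})a\otimes c+(1-q^2)p\otimes c$, $\psi(b\otimes b)=q^2b\otimes b$, $\psi(c\otimes b)=q^{-2}b\otimes c$, $\psi(b\otimes c)=(-1-q^{-2}+q^{-4}+q^{-6})a\otimes a+(q^2-1-q^{-2}+q^{-4})b\otimes c+q^{-2}c\otimes b+(1-q^{-4})(a\otimes p+p\otimes a)+(q^{-2}-1)p\otimes p$. In terms of $a,b,c,d$ it is the known structure of Majid: $\Delta(a)=a\otimes a+b\otimes c$, $\Delta(b)=a\otimes b+b\otimes d$, $\Delta(c)=c\otimes a+d\otimes c$, $\Delta(d)=c\otimes b+d\otimes d$; $\epsilon(a)=\epsilon(d)=1$, $\epsilon(b)=\epsilon(c)=0$;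 $S(a)=q^2d+(1-q^2)a$, $S(b)=-q^2b$, $S(c)=-q^2c$, $S(d)=a$; $\psi(a\otimes a)=a\otimes a+(1-q^2)b\otimes c$, $\psi(a\otimes b)=b\otimes a$, $\psi(a\otimes c)=c\otimes a+(1-q^2)(d-a)\otimes c$, $\psi(a\otimes d)=d\otimes a+(1-q^{-2})b\otimes c$, $\psi(b\otimes a)=a\otimes b+(1-q^2)b\otimes(d-a)$, $\psi(b\otimes b)=q^2b\otimes b$, $\psi(b\otimes c)=q^{-2}c\otimes b+(1+q^2)(1-q^{-2})^2b\otimes c-(1-q^{-2})(d-a)\otimes(d-a)$, $\psi(b\otimes d)=d\otimes b+(1-q^{-2})b\otimes(d-a)$, $\psi(c\otimes a)=a\otimes c$, $\psi(c\otimes b)=q^{-2}b\otimes c$, $\psi(c\otimes c)=q^2c\otimes c$, $\psi(c\otimes d)=d\otimes c$, $\psi(d\otimes a)=a\otimes d+(1-q^{-2})b\otimes c$, $\psi(d\otimes b)=b\otimes d$, $\psi(d\otimes c)=c\otimes d+(1-q^{-2})(d-a)\otimes c$, $\psi(d\otimes d)=d\otimes d-q^{-2}(1-q^{-2})b\otimes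 c$. *Second solution.* $\Delta(a)=a\otimes a+q^4c\otimes b$, $\Delta(b)=-q^2a\otimes b+b\otimes a+q^2p\otimes b$, $\Delta(c)=-q^2c\otimes a+a\otimes c+q^2c\otimes p$, $\Delta(p)=(1+q^2)a\otimes a+q^2b\otimes c+q^4c\otimes b-q^2p\otimes a-q^2a\otimes p+q^2p\otimes p$; $\epsilon(a)=1$, $\epsilon(b)=\epsilon(c)=0$, $\epsilon(p)=1+q^{-2}$; $S(a)=-q^{-2}a+p$, $S(b)=-q^{-2}b$, $S(c)=-q^{-2}c$, $S(p)=p$; $\psi(a\otimes a)=a\otimes a+(q^4-q^2)c\otimes b$, $\psi(a\otimes b)=b\otimes a+(q^{-2}-q^2)a\otimes b+(q^2-1)p\otimes b$, $\psi(a\otimes c)=c\otimes a$, $\psi(b\otimes b)=q^{-2}b\otimes b$, $\psi(b\otimes c)=q^2c\otimes b$, $\psi(c\otimes b)=(q^2+1-q^{-2}-q^{-4})a\otimes a+q^2b\otimes c+(q^4-q^2+q^{-2}-1)c\otimes b+(q^{-2}-q^2)(a\otimes p+p\otimes a)+(q^2-1)p\otimes p$. -/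

import Mathlib

open scoped TensorProduct

noncomputable section

namespace BraidedSL

/-! ### The algebra `B(R)` of the braided matrix `BSL_q(2)` -/

/-- The names of the four generators. -/
inductive Gen
  | a
  | b
  | c
  | d

/-- A generator, as an element of the free algebra. -/
abbrev gen (i : Gen) : FreeAlgebra ℂ Gen := FreeAlgebra.ι ℂ i

/-- The defining relations of `B(R)`. -/
inductive Rel (q : ℝ) : FreeAlgebra ℂ Gen → FreeAlgebra ℂ Gen → Prop
  | ba : Rel q (gen .b * gen .a) ((q : ℂ) ^ 2 • (gen .a * gen .b))
  | ac : Rel q (gen .a * gen .c) ((q : ℂ) ^ 2 • (gen .c * gen .a))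
  | ad : Rel q (gen .a * gen .d) (gen .d * gen .a)
  | bc : Rel q (gen .b * gen .c)
      (gen .c * gen .b + (1 - (q : ℂ) ^ (-2 : ℤ)) • (gen .a * (gen .d - gen .a)))
  | db : Rel q (gen .d * gen .b)
      (gen .b * gen .d + (1 - (q : ℂ) ^ (-2 : ℤ)) • (gen .a * gen .b))
  | cd : Rel q (gen .c * gen .d)
      (gen .d * gen .c + (1 - (q : ℂ) ^ (-2 : ℤ)) • (gen .c * gen .a))
  | det : Rel q (gen .a * gen .d - (q : ℂ) ^ 2 • (gen .c * gen .b)) 1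

/-- The complex algebra `B(R)`, for a real deformation parameter `q`. -/
def BR (q : ℝ) : Type := RingQuot (Rel q)

instance (q : ℝ) : Ring (BR q) := inferInstanceAs (Ring (RingQuot (Rel q)))

instance (q : ℝ) : Algebra ℂ (BR q) := inferInstanceAs (Algebra ℂ (RingQuot (Rel q)))

/-- The class in `B(R)` of an element of the free algebra. -/
def BR.mk (q : ℝ) : FreeAlgebra ℂ Gen →ₐ[ℂ] BR q := RingQuot.mkAlgHom ℂ (Rel q)

def BR.a (q : ℝ) : BR q := BR.mk q (gen .a)
def BR.b (q : ℝ) : BR q := BR.mk q (gen .b)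
def BR.c (q : ℝ) : BR q := BR.mk q (gen .c)
def BR.d (q : ℝ) : BR q := BR.mk q (gen .d)

/-- The element `p = q⁻² a + d`. -/
def BR.p (q : ℝ) : BR q := (q : ℂ) ^ (-2 : ℤ) • BR.a q + BR.d q

theorem BR.mk_rel {q : ℝ} {x y : FreeAlgebra ℂ Gen} (h : Rel q x y) :
    BR.mk q x = BR.mk q y :=
  RingQuot.mkAlgHom_rel ℂ h

/-- The universal property of `B(R)`. -/
def BR.lift (q : ℝ) {A : Type} [Ring A] [Algebra ℂ A] (f : FreeAlgebra ℂ Gen →ₐ[ℂ] A)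
    (hf : ∀ ⦃x y⦄, Rel q x y → f x = f y) : BR q →ₐ[ℂ] A :=
  RingQuot.liftAlgHom ℂ ⟨f, hf⟩

theorem BR.lift_mk (q : ℝ) {A : Type} [Ring A] [Algebra ℂ A] (f : FreeAlgebra ℂ Gen →ₐ[ℂ] A)
    (hf : ∀ ⦃x y⦄, Rel q x y → f x = f y) (x : FreeAlgebra ℂ Gen) :
    BR.lift q f hf (BR.mk q x) = f x :=
  RingQuot.liftAlgHom_mkAlgHom_apply ℂ f hf x

theorem BR.mk_surjective (q : ℝ) : Function.Surjective (BR.mk q) :=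
  RingQuot.mkAlgHom_surjective ℂ (Rel q)

/-- Induction principle for `B(R)`. -/
theorem BR.induction (q : ℝ) {P : BR q → Prop} (hs : ∀ r : ℂ, P (algebraMap ℂ (BR q) r))
    (hg : ∀ i, P (BR.mk q (gen i))) (hm : ∀ x y, P x → P y → P (x * y))
    (ha : ∀ x y, P x → P y → P (x + y)) (x : BR q) : P x := by
  obtain ⟨w, rfl⟩ := BR.mk_surjective q x
  refine FreeAlgebra.induction ℂ Gen (motive := fun w => P (BR.mk q w)) ?_ ?_ ?_ ?_ w
  · intro r
    rw [AlgHom.commutes]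
    exact hs r
  · exact hg
  · intro x y hx hy
    rw [map_mul]
    exact hm _ _ hx hy
  · intro x y hx hy
    rw [map_add]
    exact ha _ _ hx hy

/-! ### The `*`-structure `a* = a`, `b* = c`, `c* = b`, `d* = d` -/

/-- The opposite algebra with conjugate scalars: algebra maps into it are the
antilinear antimultiplicative maps. -/
def ConjOp (A : Type) : Type := Aᵐᵒᵖ

instance (A : Type) [Ring A] : Ring (ConjOp A) := inferInstanceAs (Ring Aᵐᵒᵖ)

instance (A : Type) [Ring A] [Algebra ℂ A] : Algebra ℂ (ConjOp A) :=
  RingHom.toAlgebra' ((algebraMap ℂ Aᵐᵒᵖ).comp (starRingEnd ℂ))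
    (fun r x => Algebra.commutes (A := Aᵐᵒᵖ) (starRingEnd ℂ r) x)

def ConjOp.of {A : Type} (x : A) : ConjOp A := MulOpposite.op x

def ConjOp.un {A : Type} (x : ConjOp A) : A := MulOpposite.unop x

theorem ConjOp.of_mul {A : Type} [Ring A] (x y : A) :
    ConjOp.of (x * y) = ConjOp.of y * ConjOp.of x := rfl

theorem ConjOp.of_add {A : Type} [Ring A] (x y : A) :
    ConjOp.of (x + y) = ConjOp.of x + ConjOp.of y := rfl

theorem ConjOp.of_sub {A : Type} [Ring A] (x y : A) :
    ConjOp.of (x - y) = ConjOp.of x - ConjOp.of y := rfl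

theorem ConjOp.of_smul {A : Type} [Ring A] [Algebra ℂ A] (r : ℂ) (x : A) :
    ConjOp.of (r • x) = (starRingEnd ℂ r) • ConjOp.of x := by
  rw [Algebra.smul_def, Algebra.commutes, Algebra.smul_def, ConjOp.of_mul]
  congr 1
  change _ = MulOpposite.op (algebraMap ℂ A (starRingEnd ℂ (starRingEnd ℂ r)))
  rw [Complex.conj_conj]
  rfl

/-- The generator `x*`, for a generator `x`. -/
def starGen : Gen → Gen
  | .a => .a
  | .b => .c
  | .c => .b
  | .d => .d

/-- The `*`-involution on the free algebra with values in `B(R)`. -/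
def starFree (q : ℝ) : FreeAlgebra ℂ Gen →ₐ[ℂ] ConjOp (BR q) :=
  FreeAlgebra.lift ℂ (fun i => ConjOp.of (BR.mk q (gen (starGen i))))

theorem starFree_gen (q : ℝ) (i : Gen) :
    starFree q (gen i) = ConjOp.of (BR.mk q (gen (starGen i))) := by
  simp [starFree, gen]

theorem starFree_rel (q : ℝ) ⦃x y : FreeAlgebra ℂ Gen⦄ (h : Rel q x y) :
    starFree q x = starFree q y := by
  cases h with
  | ba =>
    have h := BR.mk_rel (Rel.ac (q := q))
    simp only [map_mul, map_smul] at h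
    simp only [map_mul, map_smul, starFree_gen, starGen, ← ConjOp.of_mul, h, ConjOp.of_smul,
      map_pow, Complex.conj_ofReal]
  | ac =>
    have h := BR.mk_rel (Rel.ba (q := q))
    simp only [map_mul, map_smul] at h
    simp only [map_mul, map_smul, starFree_gen, starGen, ← ConjOp.of_mul, h, ConjOp.of_smul,
      map_pow, Complex.conj_ofReal]
  | ad =>
    have h := BR.mk_rel (Rel.ad (q := q))
    simp only [map_mul] at h
    simp only [map_mul, starFree_gen, starGen, ← ConjOp.of_mul, h]
  | bc =>
    have h := BR.mk_rel (Rel.bc (q := q))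
    have h' := BR.mk_rel (Rel.ad (q := q))
    simp only [map_mul, map_smul, map_add, map_sub, mul_sub] at h h'
    simp only [map_mul, map_smul, map_add, map_sub, starFree_gen, starGen, ← ConjOp.of_mul,
      ← ConjOp.of_sub, mul_sub, h, ← h', ConjOp.of_add, ConjOp.of_smul,
      map_one, map_zpow₀, Complex.conj_ofReal]
  | db =>
    have h := BR.mk_rel (Rel.cd (q := q))
    simp only [map_mul, map_smul, map_add] at h
    simp only [map_mul, map_smul, map_add, starFree_gen, starGen, ← ConjOp.of_mul,
      h, ConjOp.of_add, ConjOp.of_smul, map_sub, map_one, map_zpow₀, Complex.conj_ofReal]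
  | cd =>
    have h := BR.mk_rel (Rel.db (q := q))
    simp only [map_mul, map_smul, map_add] at h
    simp only [map_mul, map_smul, map_add, starFree_gen, starGen, ← ConjOp.of_mul,
      h, ConjOp.of_add, ConjOp.of_smul, map_sub, map_one, map_zpow₀, Complex.conj_ofReal]
  | det =>
    have h := BR.mk_rel (Rel.det (q := q))
    have h' := BR.mk_rel (Rel.ad (q := q))
    simp only [map_mul, map_smul, map_sub, map_one] at h h'
    have h2 := congrArg ConjOp.of h
    rw [ConjOp.of_sub, ConjOp.of_smul, h', map_pow, Complex.conj_ofReal] at h2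
    simp only [map_mul, map_smul, map_sub, map_one, starFree_gen, starGen, ← ConjOp.of_mul]
    exact h2

/-- The involution of `B(R)`, as an algebra map into the conjugate opposite algebra. -/
def starHom (q : ℝ) : BR q →ₐ[ℂ] ConjOp (BR q) := BR.lift q (starFree q) (starFree_rel q)

theorem starHom_gen (q : ℝ) (i : Gen) :
    starHom q (BR.mk q (gen i)) = ConjOp.of (BR.mk q (gen (starGen i))) := by
  rw [starHom, BR.lift_mk, starFree_gen]

theorem starHom_algebraMap (q : ℝ) (r : ℂ) :
    starHom q (algebraMap ℂ (BR q) r) = ConjOp.of (algebraMap ℂ (BR q) (starRingEnd ℂ r)) := by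
  rw [AlgHom.commutes]
  rfl

theorem starHom_starHom (q : ℝ) (x : BR q) :
    ConjOp.un (starHom q (ConjOp.un (starHom q x))) = x := by
  refine BR.induction q (P := fun x => ConjOp.un (starHom q (ConjOp.un (starHom q x))) = x)
    ?_ ?_ ?_ ?_ x
  · intro r
    rw [starHom_algebraMap]
    change ConjOp.un (starHom q (algebraMap ℂ (BR q) (starRingEnd ℂ r))) = _
    rw [starHom_algebraMap, Complex.conj_conj]
    rfl
  · intro i
    rw [starHom_gen]
    change ConjOp.un (starHom q (BR.mk q (gen (starGen i)))) = _
    rw [starHom_gen]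
    cases i <;> rfl
  · intro x y hx hy
    rw [map_mul]
    change ConjOp.un (starHom q (ConjOp.un (starHom q y) * ConjOp.un (starHom q x))) = _
    rw [map_mul]
    change ConjOp.un (starHom q (ConjOp.un (starHom q x))) *
      ConjOp.un (starHom q (ConjOp.un (starHom q y))) = _
    rw [hx, hy]
  · intro x y hx hy
    rw [map_add]
    change ConjOp.un (starHom q (ConjOp.un (starHom q x) + ConjOp.un (starHom q y))) = _
    rw [map_add]
    change ConjOp.un (starHom q (ConjOp.un (starHom q x))) +
      ConjOp.un (starHom q (ConjOp.un (starHom q y))) = _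
    rw [hx, hy]

instance (q : ℝ) : StarRing (BR q) where
  star x := ConjOp.un (starHom q x)
  star_involutive := starHom_starHom q
  star_mul x y := by
    change ConjOp.un (starHom q (x * y)) = _
    rw [map_mul]
    rfl
  star_add x y := by
    change ConjOp.un (starHom q (x + y)) = _
    rw [map_add]
    rfl

theorem BR.star_def {q : ℝ} (x : BR q) : star x = ConjOp.un (starHom q x) := rfl

instance (q : ℝ) : StarModule ℂ (BR q) where
  star_smul r x := by
    rw [BR.star_def, BR.star_def, Algebra.smul_def, Algebra.commutes, map_mul,
      starHom_algebraMap, Algebra.smul_def]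
    rfl

theorem BR.star_a (q : ℝ) : star (BR.a q) = BR.a q := congrArg ConjOp.un (starHom_gen q .a)

theorem BR.star_b (q : ℝ) : star (BR.b q) = BR.c q := congrArg ConjOp.un (starHom_gen q .b)

theorem BR.star_c (q : ℝ) : star (BR.c q) = BR.b q := congrArg ConjOp.un (starHom_gen q .c)

theorem BR.star_d (q : ℝ) : star (BR.d q) = BR.d q := congrArg ConjOp.un (starHom_gen q .d)

/-- The `*`-structure of `B(R) ⊗ B(R)`: `(x ⊗ y)* = y* ⊗ x*`. -/
def starT {q : ℝ} (t : BR q ⊗[ℂ] BR q) : BR q ⊗[ℂ] BR q :=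
  TensorProduct.comm ℂ (BR q) (BR q) (star t)

theorem starT_tmul {q : ℝ} (x y : BR q) : starT (x ⊗ₜ[ℂ] y) = star y ⊗ₜ[ℂ] star x := rfl

/-! ### The sign automorphism -/

/-- The algebra automorphism of `B(R)` that sends every generator to its negative. -/
def signHom (q : ℝ) : BR q →ₐ[ℂ] BR q :=
  BR.lift q (FreeAlgebra.lift ℂ (fun i => -BR.mk q (gen i))) (by
    intro x y h
    have h' := BR.mk_rel h
    cases h <;>
      simpa only [map_mul, map_smul, map_add, map_sub, map_one, FreeAlgebra.lift_ι_apply,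
        neg_mul_neg, gen, sub_neg_eq_add, neg_add_eq_sub, mul_add, neg_mul, mul_neg, neg_neg,
        mul_sub] using h')

theorem signHom_gen (q : ℝ) (i : Gen) : signHom q (BR.mk q (gen i)) = -BR.mk q (gen i) := by
  rw [signHom, BR.lift_mk, gen, FreeAlgebra.lift_ι_apply]

/-! ### Braided Hopf `*`-algebra structures on `B(R)` -/

/-- The maps of a (candidate) braided Hopf structure on the algebra `B(R)`. -/
@[ext] structure HopfData (q : ℝ) where
  /-- the coproduct -/
  Δ : BR q →ₗ[ℂ] BR q ⊗[ℂ] BR q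
  /-- the counit -/
  ε : BR q →ₗ[ℂ] ℂ
  /-- the antipode -/
  S : BR q →ₗ[ℂ] BR q
  /-- the braiding -/
  ψ : BR q ⊗[ℂ] BR q →ₗ[ℂ] BR q ⊗[ℂ] BR q

section
variable (q : ℝ)

/-- The multiplication `m`. -/
abbrev mu : BR q ⊗[ℂ] BR q →ₗ[ℂ] BR q := LinearMap.mul' ℂ (BR q)

/-- The associativity isomorphism of triple tensor products. -/
abbrev asc : (BR q ⊗[ℂ] BR q) ⊗[ℂ] BR q ≃ₗ[ℂ] BR q ⊗[ℂ] (BR q ⊗[ℂ] BR q) :=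
  TensorProduct.assoc ℂ (BR q) (BR q) (BR q)

/-- `m ⊗ id`. -/
def m12 : (BR q ⊗[ℂ] BR q) ⊗[ℂ] BR q →ₗ[ℂ] BR q ⊗[ℂ] BR q := (mu q).rTensor (BR q)

/-- `id ⊗ m`. -/
def m23 : (BR q ⊗[ℂ] BR q) ⊗[ℂ] BR q →ₗ[ℂ] BR q ⊗[ℂ] BR q :=
  (mu q).lTensor (BR q) ∘ₗ (asc q).toLinearMap

variable {q}

/-- `f ⊗ id` on a triple tensor product. -/
def on12 (f : BR q ⊗[ℂ] BR q →ₗ[ℂ] BR q ⊗[ℂ] BR q) :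
    (BR q ⊗[ℂ] BR q) ⊗[ℂ] BR q →ₗ[ℂ] (BR q ⊗[ℂ] BR q) ⊗[ℂ] BR q :=
  f.rTensor (BR q)

/-- `id ⊗ f` on a triple tensor product. -/
def on23 (f : BR q ⊗[ℂ] BR q →ₗ[ℂ] BR q ⊗[ℂ] BR q) :
    (BR q ⊗[ℂ] BR q) ⊗[ℂ] BR q →ₗ[ℂ] (BR q ⊗[ℂ] BR q) ⊗[ℂ] BR q :=
  (asc q).symm.toLinearMap ∘ₗ f.lTensor (BR q) ∘ₗ (asc q).toLinearMap

/-- `Δ ⊗ id`. -/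
def co12 (f : BR q →ₗ[ℂ] BR q ⊗[ℂ] BR q) :
    BR q ⊗[ℂ] BR q →ₗ[ℂ] (BR q ⊗[ℂ] BR q) ⊗[ℂ] BR q :=
  f.rTensor (BR q)

/-- `id ⊗ Δ`. -/
def co23 (f : BR q →ₗ[ℂ] BR q ⊗[ℂ] BR q) :
    BR q ⊗[ℂ] BR q →ₗ[ℂ] (BR q ⊗[ℂ] BR q) ⊗[ℂ] BR q :=
  (asc q).symm.toLinearMap ∘ₗ f.lTensor (BR q)

/-- The multiplication `(m ⊗ m) ∘ (id ⊗ ψ ⊗ id)` of the braided tensor product algebra,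
`(x ⊗ y)(w ⊗ z) = x ψ(y ⊗ w) z`. -/
def braidedMul (ψ : BR q ⊗[ℂ] BR q →ₗ[ℂ] BR q ⊗[ℂ] BR q) :
    (BR q ⊗[ℂ] BR q) ⊗[ℂ] (BR q ⊗[ℂ] BR q) →ₗ[ℂ] BR q ⊗[ℂ] BR q :=
  TensorProduct.map (mu q) (mu q) ∘ₗ
    (TensorProduct.assoc ℂ (BR q) (BR q) (BR q ⊗[ℂ] BR q)).symm.toLinearMap ∘ₗ
    ((asc q).toLinearMap ∘ₗ ψ.rTensor (BR q) ∘ₗ (asc q).symm.toLinearMap).lTensor (BR q) ∘ₗ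
    (TensorProduct.assoc ℂ (BR q) (BR q) (BR q ⊗[ℂ] BR q)).toLinearMap

/-- The braided Hopf `*`-algebra axioms. Associativity and unitality of `m` hold in `B(R)`. -/
structure IsBraidedHopfStar (H : HopfData q) : Prop where
  coassoc : co23 H.Δ ∘ₗ H.Δ = co12 H.Δ ∘ₗ H.Δ
  counit_left : ∀ x, TensorProduct.lid ℂ (BR q) (H.ε.rTensor (BR q) (H.Δ x)) = x
  counit_right : ∀ x, TensorProduct.rid ℂ (BR q) (H.ε.lTensor (BR q) (H.Δ x)) = x
  antipode_right : mu q ∘ₗ H.S.lTensor (BR q) ∘ₗ H.Δ = Algebra.linearMap ℂ (BR q) ∘ₗ H.ε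
  antipode_left : mu q ∘ₗ H.S.rTensor (BR q) ∘ₗ H.Δ = Algebra.linearMap ℂ (BR q) ∘ₗ H.ε
  psi_one_left : ∀ x, H.ψ (1 ⊗ₜ[ℂ] x) = x ⊗ₜ[ℂ] 1
  psi_one_right : ∀ x, H.ψ (x ⊗ₜ[ℂ] 1) = 1 ⊗ₜ[ℂ] x
  psi_mul_left : H.ψ ∘ₗ m12 q = m23 q ∘ₗ on12 H.ψ ∘ₗ on23 H.ψ
  psi_mul_right : H.ψ ∘ₗ m23 q = m12 q ∘ₗ on23 H.ψ ∘ₗ on12 H.ψ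
  psi_comul_left : co23 H.Δ ∘ₗ H.ψ = on12 H.ψ ∘ₗ on23 H.ψ ∘ₗ co12 H.Δ
  psi_comul_right : co12 H.Δ ∘ₗ H.ψ = on23 H.ψ ∘ₗ on12 H.ψ ∘ₗ co23 H.Δ
  comul_one : H.Δ 1 = 1 ⊗ₜ[ℂ] 1
  comul_mul : H.Δ ∘ₗ mu q = braidedMul H.ψ ∘ₗ TensorProduct.map H.Δ H.Δ
  antipode_mul : H.S ∘ₗ mu q = mu q ∘ₗ H.ψ ∘ₗ TensorProduct.map H.S H.S
  comul_antipode : H.Δ ∘ₗ H.S = TensorProduct.map H.S H.S ∘ₗ H.ψ ∘ₗ H.Δ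
  counit_one : H.ε 1 = 1
  counit_mul : ∀ x y, H.ε (x * y) = H.ε x * H.ε y
  yang_baxter : on12 H.ψ ∘ₗ on23 H.ψ ∘ₗ on12 H.ψ = on23 H.ψ ∘ₗ on12 H.ψ ∘ₗ on23 H.ψ
  comul_star : ∀ x, H.Δ (star x) = starT (H.Δ x)
  antipode_star : ∀ x, H.S (star x) = star (H.S x)
  /-- `(x ⊗ y)* = y* ⊗ x*` is an involution of the braided tensor product algebra. -/
  tensor_star : ∀ s t, starT (braidedMul H.ψ (s ⊗ₜ[ℂ] t)) =
    braidedMul H.ψ (starT t ⊗ₜ[ℂ] starT s)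

/-- Transport of a structure along the sign automorphism. -/
def HopfData.signTwist (H : HopfData q) : HopfData q where
  Δ := TensorProduct.map (signHom q).toLinearMap (signHom q).toLinearMap ∘ₗ
    H.Δ ∘ₗ (signHom q).toLinearMap
  ε := H.ε ∘ₗ (signHom q).toLinearMap
  S := (signHom q).toLinearMap ∘ₗ H.S ∘ₗ (signHom q).toLinearMap
  ψ := TensorProduct.map (signHom q).toLinearMap (signHom q).toLinearMap ∘ₗ
    H.ψ ∘ₗ TensorProduct.map (signHom q).toLinearMap (signHom q).toLinearMap

end

/-! ### The ansatz -/

section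
variable (q : ℝ)

local notation "𝐚" => BR.a q
local notation "𝐛" => BR.b q
local notation "𝐜" => BR.c q
local notation "𝐝" => BR.d q
local notation "𝐩" => BR.p q
local notation "𝐪" => (q : ℂ)
local notation "𝟏" => (1 : BR q)

/-- The general expression used for `Δ(a)`, `Δ(p)`, `ψ(a ⊗ a)`, `ψ(c ⊗ b)`, `ψ(b ⊗ c)`. -/
def quadratic (k : Fin 11 → ℂ) : BR q ⊗[ℂ] BR q :=
  k 0 • (𝐚 ⊗ₜ 𝐚) + k 1 • (𝐛 ⊗ₜ 𝐜) + k 2 • (𝐜 ⊗ₜ 𝐛) + k 3 • (𝐩 ⊗ₜ 𝐚) + k 4 • (𝐚 ⊗ₜ 𝐩)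
    + k 5 • (𝟏 ⊗ₜ 𝐚) + k 6 • (𝐚 ⊗ₜ 𝟏) + k 7 • (𝟏 ⊗ₜ 𝟏) + k 8 • (𝐩 ⊗ₜ 𝐩)
    + k 9 • (𝟏 ⊗ₜ 𝐩) + k 10 • (𝐩 ⊗ₜ 𝟏)

/-- The general linear/quadratic ansatz for coproducts, counits, antipodes and braidings of
the generators `a`, `b`, `c`, `p`, the element `p` having trivial braiding. -/
structure IsAnsatz (H : HopfData q) : Prop where
  comul_a : ∃ A : Fin 11 → ℂ, H.Δ 𝐚 = quadratic q A
  comul_bc : ∃ B : Fin 6 → ℂ,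
    H.Δ 𝐛 = B 0 • (𝐚 ⊗ₜ 𝐛) + B 1 • (𝐛 ⊗ₜ 𝐚) + B 2 • (𝐛 ⊗ₜ 𝐩) + B 3 • (𝐩 ⊗ₜ 𝐛)
      + B 4 • (𝟏 ⊗ₜ 𝐛) + B 5 • (𝐛 ⊗ₜ 𝟏) ∧
    H.Δ 𝐜 = B 0 • (𝐜 ⊗ₜ 𝐚) + B 1 • (𝐚 ⊗ₜ 𝐜) + B 2 • (𝐩 ⊗ₜ 𝐜) + B 3 • (𝐜 ⊗ₜ 𝐩)
      + B 4 • (𝐜 ⊗ₜ 𝟏) + B 5 • (𝟏 ⊗ₜ 𝐜)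
  comul_p : ∃ C : Fin 11 → ℂ, H.Δ 𝐩 = quadratic q C
  counit : ∃ e : Fin 3 → ℂ, H.ε 𝐚 = e 0 ∧ H.ε 𝐛 = e 1 ∧ H.ε 𝐜 = e 1 ∧ H.ε 𝐩 = e 2
  antipode_a : ∃ k : Fin 5 → ℂ, H.S 𝐚 = k 0 • 𝐚 + k 1 • 𝐛 + k 2 • 𝐜 + k 3 • 𝐩 + k 4 • 𝟏
  antipode_bc : ∃ m : Fin 5 → ℂ,
    H.S 𝐛 = m 0 • 𝐚 + m 1 • 𝐛 + m 2 • 𝐜 + m 3 • 𝐩 + m 4 • 𝟏 ∧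
    H.S 𝐜 = m 0 • 𝐚 + m 1 • 𝐜 + m 2 • 𝐛 + m 3 • 𝐩 + m 4 • 𝟏
  antipode_p : ∃ n : Fin 5 → ℂ, H.S 𝐩 = n 0 • 𝐚 + n 1 • 𝐛 + n 2 • 𝐜 + n 3 • 𝐩 + n 4 • 𝟏
  psi_aa : ∃ g : Fin 11 → ℂ, H.ψ (𝐚 ⊗ₜ 𝐚) = quadratic q g
  psi_ab : ∃ d : Fin 6 → ℂ, H.ψ (𝐚 ⊗ₜ 𝐛) =
    d 0 • (𝐛 ⊗ₜ 𝐚) + d 1 • (𝐚 ⊗ₜ 𝐛) + d 2 • (𝐩 ⊗ₜ 𝐛) + d 3 • (𝐛 ⊗ₜ 𝐩)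
      + d 4 • (𝟏 ⊗ₜ 𝐛) + d 5 • (𝐛 ⊗ₜ 𝟏)
  psi_ac : ∃ f : Fin 6 → ℂ, H.ψ (𝐚 ⊗ₜ 𝐜) =
    f 0 • (𝐜 ⊗ₜ 𝐚) + f 1 • (𝐚 ⊗ₜ 𝐜) + f 2 • (𝐩 ⊗ₜ 𝐜) + f 3 • (𝐜 ⊗ₜ 𝐩)
      + f 4 • (𝟏 ⊗ₜ 𝐜) + f 5 • (𝐜 ⊗ₜ 𝟏)
  psi_bb : ∃ z : ℂ, H.ψ (𝐛 ⊗ₜ 𝐛) = z • (𝐛 ⊗ₜ 𝐛)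
  psi_cb : ∃ c : Fin 11 → ℂ, H.ψ (𝐜 ⊗ₜ 𝐛) = quadratic q c
  psi_bc : ∃ a : Fin 11 → ℂ, H.ψ (𝐛 ⊗ₜ 𝐜) = quadratic q a
  /-- the remaining braidings are the `*`-involutions of the preceding ones -/
  psi_ca : H.ψ (𝐜 ⊗ₜ 𝐚) = starT (H.ψ (𝐚 ⊗ₜ 𝐛))
  psi_ba : H.ψ (𝐛 ⊗ₜ 𝐚) = starT (H.ψ (𝐚 ⊗ₜ 𝐜))
  psi_cc : H.ψ (𝐜 ⊗ₜ 𝐜) = starT (H.ψ (𝐛 ⊗ₜ 𝐛))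
  psi_p_left : ∀ x, H.ψ (𝐩 ⊗ₜ x) = x ⊗ₜ 𝐩
  psi_p_right : ∀ x, H.ψ (x ⊗ₜ 𝐩) = 𝐩 ⊗ₜ x

/-- A solution: a braided Hopf `*`-algebra structure on `B(R)` of the form of the ansatz. -/
def IsSolution (H : HopfData q) : Prop := IsBraidedHopfStar H ∧ IsAnsatz q H

/-! ### The explicit structures -/

/-- The formulas of the first solution. -/
structure IsFirst (H : HopfData q) : Prop where
  comul_a : H.Δ 𝐚 = 𝐚 ⊗ₜ 𝐚 + 𝐛 ⊗ₜ 𝐜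
  comul_b : H.Δ 𝐛 = 𝐚 ⊗ₜ 𝐛 - 𝐪 ^ (-2 : ℤ) • (𝐛 ⊗ₜ 𝐚) + 𝐛 ⊗ₜ 𝐩
  comul_c : H.Δ 𝐜 = 𝐜 ⊗ₜ 𝐚 - 𝐪 ^ (-2 : ℤ) • (𝐚 ⊗ₜ 𝐜) + 𝐩 ⊗ₜ 𝐜
  comul_p : H.Δ 𝐩 = (𝐪 ^ (-2 : ℤ) + 𝐪 ^ (-4 : ℤ)) • (𝐚 ⊗ₜ 𝐚) + 𝐪 ^ (-2 : ℤ) • (𝐛 ⊗ₜ 𝐜)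
    + 𝐜 ⊗ₜ 𝐛 - 𝐪 ^ (-2 : ℤ) • (𝐩 ⊗ₜ 𝐚) - 𝐪 ^ (-2 : ℤ) • (𝐚 ⊗ₜ 𝐩) + 𝐩 ⊗ₜ 𝐩
  counit_a : H.ε 𝐚 = 1
  counit_b : H.ε 𝐛 = 0
  counit_c : H.ε 𝐜 = 0
  counit_p : H.ε 𝐩 = 1 + 𝐪 ^ (-2 : ℤ)
  antipode_a : H.S 𝐚 = 𝐪 ^ 2 • (𝐩 - 𝐚)
  antipode_b : H.S 𝐛 = -(𝐪 ^ 2 • 𝐛)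
  antipode_c : H.S 𝐜 = -(𝐪 ^ 2 • 𝐜)
  antipode_p : H.S 𝐩 = 𝐩
  psi_aa : H.ψ (𝐚 ⊗ₜ 𝐚) = 𝐚 ⊗ₜ 𝐚 + (1 - 𝐪 ^ 2) • (𝐛 ⊗ₜ 𝐜)
  psi_ab : H.ψ (𝐚 ⊗ₜ 𝐛) = 𝐛 ⊗ₜ 𝐚
  psi_ac : H.ψ (𝐚 ⊗ₜ 𝐜) = 𝐜 ⊗ₜ 𝐚 + (𝐪 ^ 2 - 𝐪 ^ (-2 : ℤ)) • (𝐚 ⊗ₜ 𝐜)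
    + (1 - 𝐪 ^ 2) • (𝐩 ⊗ₜ 𝐜)
  psi_bb : H.ψ (𝐛 ⊗ₜ 𝐛) = 𝐪 ^ 2 • (𝐛 ⊗ₜ 𝐛)
  psi_cb : H.ψ (𝐜 ⊗ₜ 𝐛) = 𝐪 ^ (-2 : ℤ) • (𝐛 ⊗ₜ 𝐜)
  psi_bc : H.ψ (𝐛 ⊗ₜ 𝐜) =
    (-1 - 𝐪 ^ (-2 : ℤ) + 𝐪 ^ (-4 : ℤ) + 𝐪 ^ (-6 : ℤ)) • (𝐚 ⊗ₜ 𝐚)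
    + (𝐪 ^ 2 - 1 - 𝐪 ^ (-2 : ℤ) + 𝐪 ^ (-4 : ℤ)) • (𝐛 ⊗ₜ 𝐜)
    + 𝐪 ^ (-2 : ℤ) • (𝐜 ⊗ₜ 𝐛) + (1 - 𝐪 ^ (-4 : ℤ)) • (𝐚 ⊗ₜ 𝐩)
    + (1 - 𝐪 ^ (-4 : ℤ)) • (𝐩 ⊗ₜ 𝐚) + (𝐪 ^ (-2 : ℤ) - 1) • (𝐩 ⊗ₜ 𝐩)
  psi_ca : H.ψ (𝐜 ⊗ₜ 𝐚) = starT (H.ψ (𝐚 ⊗ₜ 𝐛))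
  psi_ba : H.ψ (𝐛 ⊗ₜ 𝐚) = starT (H.ψ (𝐚 ⊗ₜ 𝐜))
  psi_cc : H.ψ (𝐜 ⊗ₜ 𝐜) = starT (H.ψ (𝐛 ⊗ₜ 𝐛))

/-- The formulas of the second, new solution. -/
structure IsSecond (H : HopfData q) : Prop where
  comul_a : H.Δ 𝐚 = 𝐚 ⊗ₜ 𝐚 + 𝐪 ^ 4 • (𝐜 ⊗ₜ 𝐛)
  comul_b : H.Δ 𝐛 = -(𝐪 ^ 2 • (𝐚 ⊗ₜ 𝐛)) + 𝐛 ⊗ₜ 𝐚 + 𝐪 ^ 2 • (𝐩 ⊗ₜ 𝐛)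
  comul_c : H.Δ 𝐜 = -(𝐪 ^ 2 • (𝐜 ⊗ₜ 𝐚)) + 𝐚 ⊗ₜ 𝐜 + 𝐪 ^ 2 • (𝐜 ⊗ₜ 𝐩)
  comul_p : H.Δ 𝐩 = (1 + 𝐪 ^ 2) • (𝐚 ⊗ₜ 𝐚) + 𝐪 ^ 2 • (𝐛 ⊗ₜ 𝐜) + 𝐪 ^ 4 • (𝐜 ⊗ₜ 𝐛)
    - 𝐪 ^ 2 • (𝐩 ⊗ₜ 𝐚) - 𝐪 ^ 2 • (𝐚 ⊗ₜ 𝐩) + 𝐪 ^ 2 • (𝐩 ⊗ₜ 𝐩)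
  counit_a : H.ε 𝐚 = 1
  counit_b : H.ε 𝐛 = 0
  counit_c : H.ε 𝐜 = 0
  counit_p : H.ε 𝐩 = 1 + 𝐪 ^ (-2 : ℤ)
  antipode_a : H.S 𝐚 = -(𝐪 ^ (-2 : ℤ) • 𝐚) + 𝐩
  antipode_b : H.S 𝐛 = -(𝐪 ^ (-2 : ℤ) • 𝐛)
  antipode_c : H.S 𝐜 = -(𝐪 ^ (-2 : ℤ) • 𝐜)
  antipode_p : H.S 𝐩 = 𝐩
  psi_aa : H.ψ (𝐚 ⊗ₜ 𝐚) = 𝐚 ⊗ₜ 𝐚 + (𝐪 ^ 4 - 𝐪 ^ 2) • (𝐜 ⊗ₜ 𝐛)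
  psi_ab : H.ψ (𝐚 ⊗ₜ 𝐛) = 𝐛 ⊗ₜ 𝐚 + (𝐪 ^ (-2 : ℤ) - 𝐪 ^ 2) • (𝐚 ⊗ₜ 𝐛)
    + (𝐪 ^ 2 - 1) • (𝐩 ⊗ₜ 𝐛)
  psi_ac : H.ψ (𝐚 ⊗ₜ 𝐜) = 𝐜 ⊗ₜ 𝐚
  psi_bb : H.ψ (𝐛 ⊗ₜ 𝐛) = 𝐪 ^ (-2 : ℤ) • (𝐛 ⊗ₜ 𝐛)
  psi_bc : H.ψ (𝐛 ⊗ₜ 𝐜) = 𝐪 ^ 2 • (𝐜 ⊗ₜ 𝐛)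
  psi_cb : H.ψ (𝐜 ⊗ₜ 𝐛) =
    (𝐪 ^ 2 + 1 - 𝐪 ^ (-2 : ℤ) - 𝐪 ^ (-4 : ℤ)) • (𝐚 ⊗ₜ 𝐚) + 𝐪 ^ 2 • (𝐛 ⊗ₜ 𝐜)
    + (𝐪 ^ 4 - 𝐪 ^ 2 + 𝐪 ^ (-2 : ℤ) - 1) • (𝐜 ⊗ₜ 𝐛)
    + (𝐪 ^ (-2 : ℤ) - 𝐪 ^ 2) • (𝐚 ⊗ₜ 𝐩) + (𝐪 ^ (-2 : ℤ) - 𝐪 ^ 2) • (𝐩 ⊗ₜ 𝐚)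
    + (𝐪 ^ 2 - 1) • (𝐩 ⊗ₜ 𝐩)
  psi_ca : H.ψ (𝐜 ⊗ₜ 𝐚) = starT (H.ψ (𝐚 ⊗ₜ 𝐛))
  psi_ba : H.ψ (𝐛 ⊗ₜ 𝐚) = starT (H.ψ (𝐚 ⊗ₜ 𝐜))
  psi_cc : H.ψ (𝐜 ⊗ₜ 𝐜) = starT (H.ψ (𝐛 ⊗ₜ 𝐛))

/-- The formulas of Majid's braided Hopf algebra structure, in the generators `a, b, c, d`. -/
structure IsMajid (H : HopfData q) : Prop where
  comul_a : H.Δ 𝐚 = 𝐚 ⊗ₜ 𝐚 + 𝐛 ⊗ₜ 𝐜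
  comul_b : H.Δ 𝐛 = 𝐚 ⊗ₜ 𝐛 + 𝐛 ⊗ₜ 𝐝
  comul_c : H.Δ 𝐜 = 𝐜 ⊗ₜ 𝐚 + 𝐝 ⊗ₜ 𝐜
  comul_d : H.Δ 𝐝 = 𝐜 ⊗ₜ 𝐛 + 𝐝 ⊗ₜ 𝐝
  counit_a : H.ε 𝐚 = 1
  counit_b : H.ε 𝐛 = 0
  counit_c : H.ε 𝐜 = 0
  counit_d : H.ε 𝐝 = 1
  antipode_a : H.S 𝐚 = 𝐪 ^ 2 • 𝐝 + (1 - 𝐪 ^ 2) • 𝐚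
  antipode_b : H.S 𝐛 = -(𝐪 ^ 2 • 𝐛)
  antipode_c : H.S 𝐜 = -(𝐪 ^ 2 • 𝐜)
  antipode_d : H.S 𝐝 = 𝐚
  psi_aa : H.ψ (𝐚 ⊗ₜ 𝐚) = 𝐚 ⊗ₜ 𝐚 + (1 - 𝐪 ^ 2) • (𝐛 ⊗ₜ 𝐜)
  psi_ab : H.ψ (𝐚 ⊗ₜ 𝐛) = 𝐛 ⊗ₜ 𝐚
  psi_ac : H.ψ (𝐚 ⊗ₜ 𝐜) = 𝐜 ⊗ₜ 𝐚 + (1 - 𝐪 ^ 2) • ((𝐝 - 𝐚) ⊗ₜ 𝐜)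
  psi_ad : H.ψ (𝐚 ⊗ₜ 𝐝) = 𝐝 ⊗ₜ 𝐚 + (1 - 𝐪 ^ (-2 : ℤ)) • (𝐛 ⊗ₜ 𝐜)
  psi_ba : H.ψ (𝐛 ⊗ₜ 𝐚) = 𝐚 ⊗ₜ 𝐛 + (1 - 𝐪 ^ 2) • (𝐛 ⊗ₜ (𝐝 - 𝐚))
  psi_bb : H.ψ (𝐛 ⊗ₜ 𝐛) = 𝐪 ^ 2 • (𝐛 ⊗ₜ 𝐛)
  psi_bc : H.ψ (𝐛 ⊗ₜ 𝐜) = 𝐪 ^ (-2 : ℤ) • (𝐜 ⊗ₜ 𝐛)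
    + ((1 + 𝐪 ^ 2) * (1 - 𝐪 ^ (-2 : ℤ)) ^ 2) • (𝐛 ⊗ₜ 𝐜)
    - (1 - 𝐪 ^ (-2 : ℤ)) • ((𝐝 - 𝐚) ⊗ₜ (𝐝 - 𝐚))
  psi_bd : H.ψ (𝐛 ⊗ₜ 𝐝) = 𝐝 ⊗ₜ 𝐛 + (1 - 𝐪 ^ (-2 : ℤ)) • (𝐛 ⊗ₜ (𝐝 - 𝐚))
  psi_ca : H.ψ (𝐜 ⊗ₜ 𝐚) = 𝐚 ⊗ₜ 𝐜
  psi_cb : H.ψ (𝐜 ⊗ₜ 𝐛) = 𝐪 ^ (-2 : ℤ) • (𝐛 ⊗ₜ 𝐜)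
  psi_cc : H.ψ (𝐜 ⊗ₜ 𝐜) = 𝐪 ^ 2 • (𝐜 ⊗ₜ 𝐜)
  psi_cd : H.ψ (𝐜 ⊗ₜ 𝐝) = 𝐝 ⊗ₜ 𝐜
  psi_da : H.ψ (𝐝 ⊗ₜ 𝐚) = 𝐚 ⊗ₜ 𝐝 + (1 - 𝐪 ^ (-2 : ℤ)) • (𝐛 ⊗ₜ 𝐜)
  psi_db : H.ψ (𝐝 ⊗ₜ 𝐛) = 𝐛 ⊗ₜ 𝐝
  psi_dc : H.ψ (𝐝 ⊗ₜ 𝐜) = 𝐜 ⊗ₜ 𝐝 + (1 - 𝐪 ^ (-2 : ℤ)) • ((𝐝 - 𝐚) ⊗ₜ 𝐜)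
  psi_dd : H.ψ (𝐝 ⊗ₜ 𝐝) = 𝐝 ⊗ₜ 𝐝 - (𝐪 ^ (-2 : ℤ) * (1 - 𝐪 ^ (-2 : ℤ))) • (𝐛 ⊗ₜ 𝐜)

end

end BraidedSL

end

/-!
The algebra `B(R)` is generated by `a, b, c` and the central element `p`; the products `b c` and
`c b` are polynomials in `a` and `p`, and `a` commutes with `b` and `c` up to the factors `q²` and
`q⁻²` (`BR.relations`).

*Existence.* The braiding of the first solution comes from an action on `B(R)` of a group-like
automorphism `γ` and a `γ`-twisted derivation `δ`, which generate the Borel part of `U_q(sl₂)`. For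
an algebra `N` with such an action (`BorelAlg`), the operators `Ta`, `Tb`, `Tc`, `Tp` on
`N ⊗ B(R)` represent `B(R)` (`BorelAlg.relations`), and `ψ(x ⊗ n) = T x (n ⊗ 1)` is a braiding; the
cross relation `BorelAlg.T_mul_lmul` makes `N ⊗ B(R)` an associative algebra `BP`. The braiding is
natural for maps that commute with the actions (`Intertwines.T_natural`). The braid relation is
naturality for `ψ` itself, and the compatibility of `ψ` with `Δ` is naturality for the coproduct.
The coproduct, the counit and the antipode are defined on generators, as algebra maps into the
braided square, into `ℂ` and into the braided opposite algebra. The axioms then need to be checked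
on generators only, except `Δ S = (S ⊗ S) ψ Δ`, which follows from the uniqueness of convolution
inverses. The second solution is the transport of the first solution for `q⁻¹` along the
isomorphism `flipEquiv` of the algebras with parameters `q⁻¹` and `q`, which exchanges `b` and `c`
up to a scalar.

*Uniqueness.* The monomials of degree at most two are linearly independent: the functionals `coef`,
obtained from representations of `B(R)` on sequences, separate them. So every axiom, evaluated on
generators of a solution, can be read as polynomial equations for the coefficients of the ansatz.
* The relation `b a = q² a b` shows that `ψ(a ⊗ b)` has no term `a ⊗ b` or `ψ(a ⊗ c)` has no term
  `a ⊗ c` (`IsSolution.coef_ab_or_coef_ac`), and `flipEquiv` exchanges the two cases.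
* In the first case the relations and the braid relation leave two possibilities for the braiding of
  the generators: a multiple of the flip, or the braiding of the first solution
  (`IsSolution.psiForm`).
* The counit takes the values `ε(a) = ±1`, `ε(b) = ε(c) = 0` (`IsSolution.counit`), and the sign is
  changed by the sign automorphism.
* No coproduct is compatible with a multiple of the flip (`IsSolution.not_psiForm_zero`), and for
  the other braiding the coproduct is that of the first solution (`IsSolution.comul_of_psiForm`).
* The braiding and the coproduct of the generators determine the whole structure (`eq_first`).
-/

noncomputable section

namespace BraidedSL

/-! ### The algebra in the generators `a, b, c, p` -/

/-- The square `q²` of the deformation parameter, as a complex number. -/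
def sq (q : ℝ) : ℂ := (q : ℂ) ^ 2

theorem sq_def (q : ℝ) : (q : ℂ) ^ 2 = sq q := rfl

theorem sq_ne_zero {q : ℝ} (hq : q ≠ 0) : sq q ≠ 0 :=
  pow_ne_zero 2 (Complex.ofReal_ne_zero.mpr hq)

theorem zpow_neg_two (q : ℝ) : (q : ℂ) ^ (-2 : ℤ) = (sq q)⁻¹ := by
  rw [zpow_neg]; rfl

theorem zpow_neg_four (q : ℝ) : (q : ℂ) ^ (-4 : ℤ) = ((sq q)⁻¹) ^ 2 := by
  rw [sq, ← inv_pow, ← pow_mul, zpow_neg, inv_pow]; rfl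

theorem zpow_neg_six (q : ℝ) : (q : ℂ) ^ (-6 : ℤ) = ((sq q)⁻¹) ^ 3 := by
  rw [sq, ← inv_pow, ← pow_mul, zpow_neg, inv_pow]; rfl

theorem pow_four (q : ℝ) : (q : ℂ) ^ 4 = (sq q) ^ 2 := by
  rw [sq, ← pow_mul]

theorem BR.d_eq (q : ℝ) : BR.d q = BR.p q - (sq q)⁻¹ • BR.a q := by
  rw [BR.p, zpow_neg_two]; abel

section
variable {q : ℝ}

local notation "𝐚" => BR.a q
local notation "𝐛" => BR.b q
local notation "𝐜" => BR.c q
local notation "𝐝" => BR.d q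
local notation "𝐩" => BR.p q
local notation "𝐬" => sq q

theorem BR.b_mul_a : 𝐛 * 𝐚 = 𝐬 • (𝐚 * 𝐛) := by
  have h := BR.mk_rel (Rel.ba (q := q))
  simp only [map_mul, map_smul] at h
  exact h

theorem BR.a_mul_c' : 𝐚 * 𝐜 = 𝐬 • (𝐜 * 𝐚) := by
  have h := BR.mk_rel (Rel.ac (q := q))
  simp only [map_mul, map_smul] at h
  exact h

theorem BR.c_mul_a (hq : q ≠ 0) : 𝐜 * 𝐚 = 𝐬⁻¹ • (𝐚 * 𝐜) := by
  rw [BR.a_mul_c', smul_smul, inv_mul_cancel₀ (sq_ne_zero hq), one_smul]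

theorem BR.a_mul_d : 𝐚 * 𝐝 = 𝐝 * 𝐚 := by
  have h := BR.mk_rel (Rel.ad (q := q))
  simp only [map_mul] at h
  exact h

theorem BR.p_mul_a : 𝐩 * 𝐚 = 𝐚 * 𝐩 := by
  simp only [BR.p, add_mul, mul_add, smul_mul_assoc, mul_smul_comm, BR.a_mul_d]

theorem BR.p_mul_b (hq : q ≠ 0) : 𝐩 * 𝐛 = 𝐛 * 𝐩 := by
  have h := BR.mk_rel (Rel.db (q := q))
  simp only [map_mul, map_smul, map_add, zpow_neg_two] at h
  change 𝐝 * 𝐛 = 𝐛 * 𝐝 + _ • (𝐚 * 𝐛) at h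
  have := sq_ne_zero hq
  simp only [BR.p, add_mul, mul_add, smul_mul_assoc, mul_smul_comm, zpow_neg_two, h, BR.b_mul_a]
  match_scalars <;> field_simp
  ring

theorem BR.p_mul_c (hq : q ≠ 0) : 𝐩 * 𝐜 = 𝐜 * 𝐩 := by
  have h := BR.mk_rel (Rel.cd (q := q))
  simp only [map_mul, map_smul, map_add, zpow_neg_two] at h
  change 𝐜 * 𝐝 = 𝐝 * 𝐜 + _ • (𝐜 * 𝐚) at h
  have := sq_ne_zero hq
  simp only [BR.p, add_mul, mul_add, smul_mul_assoc, mul_smul_comm, zpow_neg_two, h, BR.a_mul_c']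
  match_scalars <;> field_simp
  ring

/-- The quantum determinant relation eliminates the product `c b`. -/
theorem BR.c_mul_b (hq : q ≠ 0) :
    𝐜 * 𝐛 = 𝐬⁻¹ • (𝐚 * 𝐩) - (𝐬⁻¹) ^ 2 • (𝐚 * 𝐚) - 𝐬⁻¹ • 1 := by
  have h := BR.mk_rel (Rel.det (q := q))
  simp only [map_mul, map_smul, map_sub, map_one] at h
  change 𝐚 * 𝐝 - 𝐬 • (𝐜 * 𝐛) = 1 at h
  have := sq_ne_zero hq
  rw [← h, BR.d_eq]
  simp only [mul_sub, mul_smul_comm]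
  match_scalars <;> field_simp <;> ring

theorem BR.b_mul_c (hq : q ≠ 0) : 𝐛 * 𝐜 = 𝐚 * 𝐩 - 𝐚 * 𝐚 - 𝐬⁻¹ • 1 := by
  have h := BR.mk_rel (Rel.bc (q := q))
  simp only [map_mul, map_smul, map_sub, map_add, zpow_neg_two] at h
  change 𝐛 * 𝐜 = 𝐜 * 𝐛 + (1 - 𝐬⁻¹) • (𝐚 * (𝐝 - 𝐚)) at h
  have := sq_ne_zero hq
  rw [h, BR.d_eq, BR.c_mul_b hq]
  simp only [mul_sub, mul_smul_comm]
  match_scalars <;> field_simp <;> ring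

/-- Induction on elements of `B(R)` with the generators `a, b, c, p`. -/
theorem BR.ind {P : BR q → Prop} (h1 : P 1) (hs : ∀ (r : ℂ) x, P x → P (r • x))
    (hab : ∀ x y, P x → P y → P (x + y)) (hm : ∀ x y, P x → P y → P (x * y))
    (ha : P 𝐚) (hb : P 𝐛) (hc : P 𝐜) (hp : P 𝐩) (x : BR q) : P x := by
  refine BR.induction q (P := P) (fun r => ?_) (fun i => ?_) hm hab x
  · rw [Algebra.algebraMap_eq_smul_one]
    exact hs r 1 h1
  · cases i
    · exact ha
    · exact hb
    · exact hc
    · change P 𝐝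
      rw [BR.d_eq, sub_eq_add_neg, ← neg_smul]
      exact hab _ _ hp (hs _ _ ha)

/-- The defining relations in terms of `a, b, c, p`, for four elements of an algebra. -/
structure Relations (q : ℝ) {A : Type} [Ring A] [Algebra ℂ A] (a b c p : A) : Prop where
  ba : b * a = sq q • (a * b)
  ca : c * a = (sq q)⁻¹ • (a * c)
  pa : p * a = a * p
  pb : p * b = b * p
  pc : p * c = c * p
  cb : c * b = (sq q)⁻¹ • (a * p) - ((sq q)⁻¹) ^ 2 • (a * a) - (sq q)⁻¹ • 1
  bc : b * c = a * p - a * a - (sq q)⁻¹ • 1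

namespace Relations
variable {A : Type} [Ring A] [Algebra ℂ A] {a b c p : A}

theorem ba_assoc (h : Relations q a b c p) (x : A) : b * (a * x) = sq q • (a * (b * x)) := by
  rw [← mul_assoc, h.ba, smul_mul_assoc, mul_assoc]

theorem ca_assoc (h : Relations q a b c p) (x : A) : c * (a * x) = (sq q)⁻¹ • (a * (c * x)) := by
  rw [← mul_assoc, h.ca, smul_mul_assoc, mul_assoc]

theorem pa_assoc (h : Relations q a b c p) (x : A) : p * (a * x) = a * (p * x) := by
  rw [← mul_assoc, h.pa, mul_assoc]

theorem pb_assoc (h : Relations q a b c p) (x : A) : p * (b * x) = b * (p * x) := by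
  rw [← mul_assoc, h.pb, mul_assoc]

theorem pc_assoc (h : Relations q a b c p) (x : A) : p * (c * x) = c * (p * x) := by
  rw [← mul_assoc, h.pc, mul_assoc]

theorem cb_assoc (h : Relations q a b c p) (x : A) : c * (b * x) =
    (sq q)⁻¹ • (a * (p * x)) - ((sq q)⁻¹) ^ 2 • (a * (a * x)) - (sq q)⁻¹ • x := by
  rw [← mul_assoc, h.cb]
  simp only [sub_mul, smul_mul_assoc, mul_assoc, one_mul]

theorem bc_assoc (h : Relations q a b c p) (x : A) :
    b * (c * x) = a * (p * x) - a * (a * x) - (sq q)⁻¹ • x := by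
  rw [← mul_assoc, h.bc]
  simp only [sub_mul, smul_mul_assoc, mul_assoc, one_mul]

end Relations

theorem BR.relations (hq : q ≠ 0) : Relations q 𝐚 𝐛 𝐜 𝐩 :=
  ⟨BR.b_mul_a, BR.c_mul_a hq, BR.p_mul_a, BR.p_mul_b hq, BR.p_mul_c hq, BR.c_mul_b hq,
    BR.b_mul_c hq⟩

/-- The images of the generators under an algebra map with prescribed values on `a, b, c, p`. -/
def genVal (q : ℝ) {A : Type} [Ring A] [Algebra ℂ A] (a b c p : A) : Gen → A
  | .a => a
  | .b => b
  | .c => c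
  | .d => p - (sq q)⁻¹ • a

/-- The algebra map out of `B(R)` with prescribed values on `a, b, c, p`. -/
def BR.liftP (hq : q ≠ 0) {A : Type} [Ring A] [Algebra ℂ A] {a b c p : A}
    (h : Relations q a b c p) : BR q →ₐ[ℂ] A :=
  BR.lift q (FreeAlgebra.lift ℂ (genVal q a b c p)) (by
    have hs := sq_ne_zero hq
    intro x y hxy
    cases hxy <;>
      simp only [map_mul, map_smul, map_sub, map_add, map_one, gen, FreeAlgebra.lift_ι_apply,
        genVal, sq_def, zpow_neg_two, mul_sub, sub_mul, smul_mul_assoc, mul_smul_comm, h.ba, h.ca,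
        h.pa, h.pb, h.pc, h.cb, h.bc] <;>
      match_scalars <;> field_simp <;> ring)

section
variable (hq : q ≠ 0) {A : Type} [Ring A] [Algebra ℂ A] {a b c p : A} (h : Relations q a b c p)

theorem BR.liftP_a : BR.liftP hq h 𝐚 = a := by
  rw [BR.liftP, BR.a, BR.lift_mk, gen, FreeAlgebra.lift_ι_apply]; rfl

theorem BR.liftP_b : BR.liftP hq h 𝐛 = b := by
  rw [BR.liftP, BR.b, BR.lift_mk, gen, FreeAlgebra.lift_ι_apply]; rfl

theorem BR.liftP_c : BR.liftP hq h 𝐜 = c := by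
  rw [BR.liftP, BR.c, BR.lift_mk, gen, FreeAlgebra.lift_ι_apply]; rfl

theorem BR.liftP_p : BR.liftP hq h 𝐩 = p := by
  have hd : BR.liftP hq h 𝐝 = p - (sq q)⁻¹ • a := by
    rw [BR.liftP, BR.d, BR.lift_mk, gen, FreeAlgebra.lift_ι_apply]; rfl
  rw [BR.p, map_add, map_smul, hd, BR.liftP_a, zpow_neg_two]; abel

end

theorem BR.star_p : star 𝐩 = 𝐩 := by
  simp [BR.p, BR.star_a, BR.star_d, star_add, star_smul]

end

/-! ### Algebras with an action of the Borel part of `U_q(sl₂)` -/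

/-- An action of the Borel part of `U_q(sl₂)` on an algebra `N`: a group-like automorphism `g`
with inverse `g'`, and a `g`-twisted derivation `d` with `d g = q² g d`. -/
structure BorelAlg (q : ℝ) (N : Type) [Ring N] [Algebra ℂ N] where
  g : N →ₐ[ℂ] N
  g' : N →ₐ[ℂ] N
  d : N →ₗ[ℂ] N
  g_g' : ∀ x, g (g' x) = x
  g'_g : ∀ x, g' (g x) = x
  d_g : ∀ x, d (g x) = sq q • g (d x)
  d_mul : ∀ x y, d (x * y) = x * d y + d x * g y

namespace BorelAlg
variable {q : ℝ} {N : Type} [Ring N] [Algebra ℂ N] (M : BorelAlg q N)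

theorem d_one : M.d 1 = 0 := by
  have h := M.d_mul 1 1
  simpa using h

theorem d_g' (hq : q ≠ 0) (x : N) : M.d (M.g' x) = (sq q)⁻¹ • M.g' (M.d x) := by
  have h := M.d_g (M.g' x)
  rw [M.g_g'] at h
  rw [h, map_smul, M.g'_g, smul_smul, inv_mul_cancel₀ (sq_ne_zero hq), one_smul]

local notation "𝐚" => BR.a q
local notation "𝐛" => BR.b q
local notation "𝐜" => BR.c q
local notation "𝐩" => BR.p q
local notation "𝐬" => sq q

/-- The element `w = p - (1 + q⁻²) a`, which is `d - a`. -/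
def _root_.BraidedSL.BR.w (q : ℝ) : BR q := BR.p q - (1 + (sq q)⁻¹) • BR.a q

local notation "𝐰" => BR.w q

/-- The operator `n ⊗ w ↦ f n ⊗ x w`. -/
def op (f : N →ₗ[ℂ] N) (x : BR q) : Module.End ℂ (N ⊗[ℂ] BR q) :=
  TensorProduct.map f (LinearMap.mulLeft ℂ x)

/-- The operator by which `a` acts on `N ⊗ B(R)`. -/
def Ta : Module.End ℂ (N ⊗[ℂ] BR q) := op LinearMap.id 𝐚 + op M.d 𝐜

/-- The operator by which `b` acts on `N ⊗ B(R)`. -/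
def Tb : Module.End ℂ (N ⊗[ℂ] BR q) :=
  op M.g'.toLinearMap 𝐛 + op (M.d ∘ₗ M.g'.toLinearMap) 𝐰
    - op (M.d ∘ₗ M.d ∘ₗ M.g'.toLinearMap) 𝐜

/-- The operator by which `c` acts on `N ⊗ B(R)`. -/
def Tc : Module.End ℂ (N ⊗[ℂ] BR q) := op M.g.toLinearMap 𝐜

/-- The operator by which `p` acts on `N ⊗ B(R)`; it does not involve the Borel action, which is
why `p` has trivial braiding. -/
def Tp : Module.End ℂ (N ⊗[ℂ] BR q) := op LinearMap.id 𝐩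

theorem Ta_tmul (n : N) (w : BR q) :
    M.Ta (n ⊗ₜ w) = n ⊗ₜ (𝐚 * w) + M.d n ⊗ₜ (𝐜 * w) := rfl

theorem Tb_tmul (n : N) (w : BR q) :
    M.Tb (n ⊗ₜ w) = M.g' n ⊗ₜ (𝐛 * w) + M.d (M.g' n) ⊗ₜ (𝐰 * w)
      - M.d (M.d (M.g' n)) ⊗ₜ (𝐜 * w) := rfl

theorem Tc_tmul (n : N) (w : BR q) : M.Tc (n ⊗ₜ w) = M.g n ⊗ₜ (𝐜 * w) := rfl

theorem Tp_tmul (n : N) (w : BR q) :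
    (Tp : Module.End ℂ (N ⊗[ℂ] BR q)) (n ⊗ₜ w) = n ⊗ₜ (𝐩 * w) := rfl

/-- The operators by which the generators act satisfy the relations of `B(R)`. -/
theorem relations (hq : q ≠ 0) : Relations q M.Ta M.Tb M.Tc Tp := by
  have hs := sq_ne_zero hq
  have h := BR.relations hq
  constructor <;>
  · refine TensorProduct.ext' fun n w => ?_
    simp only [Module.End.mul_apply, LinearMap.smul_apply, LinearMap.sub_apply,
      Module.End.one_apply, Ta_tmul, Tb_tmul, Tc_tmul, Tp_tmul, map_add, map_sub, map_smul, BR.w,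
      sub_mul, smul_mul_assoc, M.d_g, M.d_g' hq, M.g_g', M.g'_g, TensorProduct.tmul_sub,
      TensorProduct.tmul_smul, ← TensorProduct.smul_tmul', h.ba_assoc, h.ca_assoc, h.pa_assoc,
      h.pb_assoc, h.pc_assoc, h.cb_assoc, h.bc_assoc]
    try (match_scalars <;> field_simp <;> ring)

/-- The algebra map `B(R) → End (N ⊗ B(R))`: left multiplication by `1 ⊗ x` in the braided tensor
product algebra `N ⊗ B(R)`. -/
def T (hq : q ≠ 0) : BR q →ₐ[ℂ] Module.End ℂ (N ⊗[ℂ] BR q) := BR.liftP hq (M.relations hq)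

variable (hq : q ≠ 0)

theorem T_a : M.T hq 𝐚 = M.Ta := BR.liftP_a ..
theorem T_b : M.T hq 𝐛 = M.Tb := BR.liftP_b ..
theorem T_c : M.T hq 𝐜 = M.Tc := BR.liftP_c ..
theorem T_p : M.T hq 𝐩 = Tp := BR.liftP_p ..

/-- Right multiplication by `1 ⊗ w` on `N ⊗ B(R)`. -/
def rmul (N : Type) [Ring N] [Algebra ℂ N] {q : ℝ} (w : BR q) : Module.End ℂ (N ⊗[ℂ] BR q) :=
  (LinearMap.mulRight ℂ w).lTensor N

@[simp] theorem rmul_tmul (n : N) (x w : BR q) : rmul N w (n ⊗ₜ x) = n ⊗ₜ (x * w) := rfl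

/-- Left multiplication by `n ⊗ 1` on `N ⊗ B(R)`. -/
def lmul (q : ℝ) {N : Type} [Ring N] [Algebra ℂ N] : N →ₗ[ℂ] Module.End ℂ (N ⊗[ℂ] BR q) :=
  LinearMap.rTensorHom (BR q) ∘ₗ LinearMap.mul ℂ N

@[simp] theorem lmul_tmul (n m : N) (x : BR q) : lmul q n (m ⊗ₜ x) = (n * m) ⊗ₜ x := rfl

theorem T_rmul (x w : BR q) (t : N ⊗[ℂ] BR q) :
    M.T hq x (rmul N w t) = rmul N w (M.T hq x t) := by
  revert t
  refine BR.ind (P := fun x => ∀ t, M.T hq x (rmul N w t) = rmul N w (M.T hq x t))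
    ?_ ?_ ?_ ?_ ?_ ?_ ?_ ?_ x
  · simp
  · intro r x h t; simp [h]
  · intro x y hx hy t; simp [hx, hy]
  · intro x y hx hy t; simp [hx, hy]
  all_goals
    intro t
    induction t using TensorProduct.induction_on with
    | zero => simp
    | add t t' h h' => simp only [map_add, h, h']
    | tmul n v =>
      simp [T_a, T_b, T_c, T_p, Ta_tmul, Tb_tmul, Tc_tmul, Tp_tmul, mul_assoc]

theorem T_tmul (x w : BR q) (n : N) :
    M.T hq x (n ⊗ₜ w) = rmul N w (M.T hq x (n ⊗ₜ 1)) := by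
  rw [← T_rmul, rmul_tmul, one_mul]

/-- Left multiplication of the braided tensor product algebra `N ⊗ B(R)`. -/
def rho : N ⊗[ℂ] BR q →ₗ[ℂ] Module.End ℂ (N ⊗[ℂ] BR q) :=
  TensorProduct.lift ((LinearMap.mul ℂ (Module.End ℂ (N ⊗[ℂ] BR q))).compl₁₂ (lmul q)
    (M.T hq).toLinearMap)

theorem rho_tmul (n : N) (x : BR q) : M.rho hq (n ⊗ₜ x) = lmul q n * M.T hq x := rfl

theorem lmul_mul (n m : N) : lmul q (n * m) = lmul q n * lmul q m := by
  refine TensorProduct.ext' fun k w => ?_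
  simp [mul_assoc]

theorem lmul_one : lmul q (1 : N) = 1 := by
  refine TensorProduct.ext' fun k w => ?_
  simp

theorem rho_lmul (n : N) (t : N ⊗[ℂ] BR q) :
    M.rho hq (lmul q n t) = lmul q n * M.rho hq t := by
  induction t using TensorProduct.induction_on with
  | zero => simp
  | add t t' h h' => simp only [map_add, h, h', mul_add]
  | tmul m x => rw [lmul_tmul, rho_tmul, rho_tmul, lmul_mul, mul_assoc]

theorem rho_rmul (x : BR q) (t : N ⊗[ℂ] BR q) :
    M.rho hq (rmul N x t) = M.rho hq t * M.T hq x := by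
  induction t using TensorProduct.induction_on with
  | zero => simp
  | add t t' h h' => simp only [map_add, h, h', add_mul]
  | tmul m y => rw [rmul_tmul, rho_tmul, rho_tmul, map_mul, mul_assoc]

/-- The cross relation of the braided tensor product algebra; associativity of the braided product
follows from it. -/
theorem T_mul_lmul (x : BR q) (n : N) :
    M.T hq x * lmul q n = M.rho hq (M.T hq x (n ⊗ₜ 1)) := by
  revert n
  refine BR.ind (P := fun x => ∀ n, M.T hq x * lmul q n = M.rho hq (M.T hq x (n ⊗ₜ 1)))
    ?_ ?_ ?_ ?_ ?_ ?_ ?_ ?_ x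
  · intro n; simp [rho_tmul]
  · intro r x h n; simp [h]
  · intro x y hx hy n; simp [hx, hy, add_mul]
  · intro x y hx hy n
    rw [map_mul, mul_assoc, hy, Module.End.mul_apply]
    generalize M.T hq y (n ⊗ₜ[ℂ] 1) = t
    induction t using TensorProduct.induction_on with
    | zero => simp
    | add t t' h h' => simp only [map_add, mul_add, h, h']
    | tmul m z => rw [rho_tmul, ← mul_assoc, hx, ← rho_rmul, ← T_tmul]
  all_goals
    intro n
    refine TensorProduct.ext' fun m v => ?_
    simp only [T_a, T_b, T_c, T_p, Ta_tmul, Tb_tmul, Tc_tmul, Tp_tmul, mul_one, map_add, map_sub,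
      rho_tmul, Module.End.mul_apply, lmul_tmul, LinearMap.add_apply, LinearMap.sub_apply, map_mul,
      M.d_mul, M.g_g', TensorProduct.add_tmul, BR.w, map_smul, TensorProduct.tmul_sub,
      TensorProduct.tmul_smul, sub_mul, smul_mul_assoc, LinearMap.smul_apply, M.d_g' hq,
      ← TensorProduct.smul_tmul', mul_smul_comm]
    try module

theorem T_rho (x : BR q) (t : N ⊗[ℂ] BR q) :
    M.T hq x * M.rho hq t = M.rho hq (M.T hq x t) := by
  induction t using TensorProduct.induction_on with
  | zero => simp
  | add t t' h h' => simp only [map_add, mul_add, h, h']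
  | tmul m z => rw [rho_tmul, ← mul_assoc, T_mul_lmul, ← rho_rmul, ← T_tmul]

theorem rho_rho (t u : N ⊗[ℂ] BR q) : M.rho hq (M.rho hq t u) = M.rho hq t * M.rho hq u := by
  induction t using TensorProduct.induction_on with
  | zero => simp
  | add t t' h h' => simp only [map_add, add_mul, h, h', LinearMap.add_apply]
  | tmul m z => rw [rho_tmul, Module.End.mul_apply, rho_lmul, ← T_rho, mul_assoc]

theorem T_one_tmul (x : BR q) : M.T hq x (1 ⊗ₜ 1) = 1 ⊗ₜ x := by
  refine BR.ind (P := fun x => M.T hq x (1 ⊗ₜ 1) = 1 ⊗ₜ x)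
    ?_ ?_ ?_ ?_ ?_ ?_ ?_ ?_ x
  · simp
  · intro r x h; simp [h]
  · intro x y hx hy; simp [hx, hy, TensorProduct.tmul_add]
  · intro x y hx hy; rw [map_mul, Module.End.mul_apply, hy, T_tmul, hx, rmul_tmul]
  all_goals simp [T_a, T_b, T_c, T_p, Ta_tmul, Tb_tmul, Tc_tmul, Tp_tmul, d_one]

theorem rho_one : M.rho hq (1 ⊗ₜ 1) = 1 := by
  rw [rho_tmul, lmul_one, map_one, one_mul]

theorem rho_apply_one_tmul (x : BR q) (t : N ⊗[ℂ] BR q) :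
    M.rho hq t (1 ⊗ₜ x) = rmul N x t := by
  induction t using TensorProduct.induction_on with
  | zero => simp
  | add t t' h h' => simp only [map_add, h, h', LinearMap.add_apply]
  | tmul m z =>
    rw [rho_tmul, Module.End.mul_apply, T_tmul, T_one_tmul, rmul_tmul, lmul_tmul, mul_one,
      rmul_tmul]

theorem rmul_one (t : N ⊗[ℂ] BR q) : rmul N 1 t = t := by
  induction t using TensorProduct.induction_on with
  | zero => simp
  | add t t' h h' => simp only [map_add, h, h']
  | tmul m z => simp

end BorelAlg

section
variable {q : ℝ}

local notation "𝐚" => BR.a q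
local notation "𝐛" => BR.b q
local notation "𝐜" => BR.c q
local notation "𝐩" => BR.p q
local notation "𝐬" => sq q
local notation "𝐰" => BR.w q

section

/-! ### Braided tensor products -/

/-- The underlying space of the braided tensor product algebra `N ⊗ B(R)`. The parameters of this
type synonym determine the product on it. -/
def BP {N : Type} [Ring N] [Algebra ℂ N] (_ : BorelAlg q N) (_ : q ≠ 0) : Type :=
  N ⊗[ℂ] BR q

namespace BP
variable {N : Type} [Ring N] [Algebra ℂ N] (M : BorelAlg q N) (hq : q ≠ 0)

instance : AddCommGroup (BP M hq) := inferInstanceAs (AddCommGroup (N ⊗[ℂ] BR q))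

instance : Module ℂ (BP M hq) := inferInstanceAs (Module ℂ (N ⊗[ℂ] BR q))

/-- The braided product `(n ⊗ x)(m ⊗ y) = n ψ(x ⊗ m) y`. -/
instance : Ring (BP M hq) where
  __ := (inferInstance : AddCommGroup (BP M hq))
  mul s t := M.rho hq s t
  one := (1 : N) ⊗ₜ[ℂ] (1 : BR q)
  mul_assoc s t u := LinearMap.congr_fun (M.rho_rho hq s t) u
  one_mul s := LinearMap.congr_fun (M.rho_one hq) s
  mul_one s := (M.rho_apply_one_tmul hq 1 s).trans (BorelAlg.rmul_one s)
  left_distrib s t u := map_add (M.rho hq s) t u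
  right_distrib s t u := LinearMap.map_add₂ (M.rho hq) s t u
  zero_mul s := LinearMap.map_zero₂ (M.rho hq) s
  mul_zero s := map_zero (M.rho hq s)

instance : Algebra ℂ (BP M hq) :=
  Algebra.ofModule (fun r s t => LinearMap.map_smul₂ (M.rho hq) r s t)
    (fun r s t => map_smul (M.rho hq s) r t)

/-- The element `n ⊗ x` of the braided tensor product. -/
def tm {M : BorelAlg q N} {hq : q ≠ 0} (n : N) (x : BR q) : BP M hq := n ⊗ₜ[ℂ] x

variable {M hq}

theorem mul_def (s t : BP M hq) : s * t = M.rho hq s t := rfl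

theorem one_def : (1 : BP M hq) = tm 1 1 := rfl

theorem tm_one_mul (n : N) (t : BP M hq) : (tm n 1 : BP M hq) * t = BorelAlg.lmul q n t := by
  rw [mul_def, tm, BorelAlg.rho_tmul, map_one, mul_one]

theorem one_tm_mul (x : BR q) (t : BP M hq) : (tm 1 x : BP M hq) * t = M.T hq x t := by
  rw [mul_def, tm, BorelAlg.rho_tmul, BorelAlg.lmul_one, one_mul]

theorem tm_eq (n : N) (x : BR q) : (tm n x : BP M hq) = tm n 1 * tm 1 x := by
  rw [tm_one_mul, tm, tm, BorelAlg.lmul_tmul, mul_one]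

theorem mul_one_tm (x : BR q) (t : BP M hq) : t * (tm 1 x : BP M hq) = BorelAlg.rmul N x t :=
  M.rho_apply_one_tmul hq x t

/-- The inclusion `n ↦ n ⊗ 1`. -/
def inl (M : BorelAlg q N) (hq : q ≠ 0) : N →ₐ[ℂ] BP M hq :=
  AlgHom.ofLinearMap ((TensorProduct.mk ℂ N (BR q)).flip 1 : N →ₗ[ℂ] BP M hq) rfl (by
    intro n m
    change tm (n * m) 1 = (tm n 1 : BP M hq) * tm m 1
    rw [tm_one_mul]; rfl)

/-- The inclusion `x ↦ 1 ⊗ x`. -/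
def inr (M : BorelAlg q N) (hq : q ≠ 0) : BR q →ₐ[ℂ] BP M hq :=
  AlgHom.ofLinearMap ((TensorProduct.mk ℂ N (BR q)) 1 : BR q →ₗ[ℂ] BP M hq) rfl (by
    intro x y
    change tm 1 (x * y) = (tm 1 x : BP M hq) * tm 1 y
    rw [mul_one_tm]; rfl)

theorem inl_apply (n : N) : inl M hq n = (tm n 1 : BP M hq) := rfl
theorem inr_apply (x : BR q) : inr M hq x = (tm 1 x : BP M hq) := rfl

/-- The cross relation of the braided product. -/
theorem inr_mul_inl (x : BR q) (n : N) : inr M hq x * inl M hq n = M.T hq x (n ⊗ₜ 1) :=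
  one_tm_mul x _

theorem inr_a_mul_inl (n : N) : inr M hq 𝐚 * inl M hq n =
    inl M hq n * inr M hq 𝐚 + inl M hq (M.d n) * inr M hq 𝐜 := by
  rw [inr_mul_inl, BorelAlg.T_a, BorelAlg.Ta_tmul, mul_one, mul_one]
  simp only [inl_apply, inr_apply, ← tm_eq]; rfl

theorem inr_c_mul_inl (n : N) : inr M hq 𝐜 * inl M hq n = inl M hq (M.g n) * inr M hq 𝐜 := by
  rw [inr_mul_inl, BorelAlg.T_c, BorelAlg.Tc_tmul, mul_one]
  simp only [inl_apply, inr_apply, ← tm_eq]; rfl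

theorem inr_p_mul_inl (n : N) : inr M hq 𝐩 * inl M hq n = inl M hq n * inr M hq 𝐩 := by
  rw [inr_mul_inl, BorelAlg.T_p, BorelAlg.Tp_tmul, mul_one]
  simp only [inl_apply, inr_apply, ← tm_eq]; rfl

theorem inr_b_mul_inl (n : N) : inr M hq 𝐛 * inl M hq n =
    inl M hq (M.g' n) * inr M hq 𝐛 + inl M hq (M.d (M.g' n)) * inr M hq 𝐰
      - inl M hq (M.d (M.d (M.g' n))) * inr M hq 𝐜 := by
  rw [inr_mul_inl, BorelAlg.T_b, BorelAlg.Tb_tmul, mul_one, mul_one, mul_one]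
  simp only [inl_apply, inr_apply, ← tm_eq]; rfl

end BP

/-! ### The Borel action on `B(R)` -/

theorem torus_relations (hq : q ≠ 0) {t : ℂ} (ht : t ≠ 0) :
    Relations q 𝐚 (t⁻¹ • 𝐛) (t • 𝐜) 𝐩 := by
  have hs := sq_ne_zero hq
  have h := BR.relations hq
  constructor <;>
    simp only [smul_mul_assoc, mul_smul_comm, h.ba, h.ca, h.pa, h.pb, h.pc, h.cb, h.bc] <;>
    match_scalars <;> field_simp

/-- The torus automorphism of `B(R)` that scales `b` by `t⁻¹` and `c` by `t`. -/
def torus (hq : q ≠ 0) {t : ℂ} (ht : t ≠ 0) : BR q →ₐ[ℂ] BR q :=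
  BR.liftP hq (torus_relations hq ht)

/-- An algebra map on `B(R)` is determined by its values on `a, b, c, p`. -/
theorem BR.hom_ext {A : Type} [Ring A] [Algebra ℂ A] {f g : BR q →ₐ[ℂ] A}
    (ha : f 𝐚 = g 𝐚) (hb : f 𝐛 = g 𝐛) (hc : f 𝐜 = g 𝐜) (hp : f 𝐩 = g 𝐩) (x : BR q) :
    f x = g x := by
  refine BR.ind (P := fun x => f x = g x) (by simp) ?_ ?_ ?_ ha hb hc hp x
  · intro r x h; simp [h]
  · intro x y hx hy; simp [hx, hy]
  · intro x y hx hy; simp [hx, hy]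

section
variable (hq : q ≠ 0) {t : ℂ} (ht : t ≠ 0)

theorem torus_a : torus hq ht 𝐚 = 𝐚 := BR.liftP_a ..
theorem torus_b : torus hq ht 𝐛 = t⁻¹ • 𝐛 := BR.liftP_b ..
theorem torus_c : torus hq ht 𝐜 = t • 𝐜 := BR.liftP_c ..
theorem torus_p : torus hq ht 𝐩 = 𝐩 := BR.liftP_p ..

theorem torus_inv {u : ℂ} (hu : u ≠ 0) (htu : t * u = 1) (x : BR q) :
    torus hq ht (torus hq hu x) = x := by
  have htu' : u⁻¹ * t⁻¹ = 1 := by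
    rw [← mul_inv, mul_comm, htu, inv_one]
  exact BR.hom_ext (f := (torus hq ht).comp (torus hq hu)) (g := AlgHom.id ℂ _)
    (by simp [torus_a]) (by simp [torus_b, smul_smul, htu'])
    (by simp [torus_c, smul_smul, mul_comm u t, htu]) (by simp [torus_p]) x

end

section
variable (hq : q ≠ 0)

/-- The automorphism `γ` of `B(R)`, `b ↦ q⁻² b`, `c ↦ q² c`. -/
def gam : BR q →ₐ[ℂ] BR q := torus hq (sq_ne_zero hq)

/-- The inverse of `γ`. -/
def gam' : BR q →ₐ[ℂ] BR q := torus hq (inv_ne_zero (sq_ne_zero hq))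

/-- The relations for the matrices `!![x, δ x; 0, γ x]`, which are multiplicative exactly because
`δ` is a `γ`-twisted derivation. -/
theorem del_relations (hq : q ≠ 0) : Relations q
    !![𝐚, (1 - 𝐬) • 𝐛; 0, 𝐚] !![𝐛, 0; 0, 𝐬⁻¹ • 𝐛] !![𝐜, (1 - 𝐬) • 𝐰; 0, 𝐬 • 𝐜] !![𝐩, 0; 0, 𝐩] := by
  have hs := sq_ne_zero hq
  have h := BR.relations hq
  constructor <;>
  · rw [← Matrix.ext_iff]
    simp only [Fin.forall_fin_two, Matrix.mul_apply, Fin.sum_univ_two, Matrix.smul_apply,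
      Matrix.sub_apply, Matrix.of_apply, Matrix.cons_val', Matrix.cons_val_zero,
      Matrix.cons_val_one, Matrix.one_apply, BR.w, mul_zero, zero_mul, add_zero, zero_add,
      smul_mul_assoc, mul_smul_comm, mul_sub, sub_mul, h.ba, h.ca, h.pa, h.pb, h.pc, h.cb, h.bc]
    refine ⟨⟨?_, ?_⟩, ?_, ?_⟩ <;> (try simp) <;> match_scalars <;>
      field_simp <;> ring

/-- The algebra map `x ↦ !![x, δ x; 0, γ x]`, which encodes `γ` and `δ` together. -/
def delHom : BR q →ₐ[ℂ] Matrix (Fin 2) (Fin 2) (BR q) := BR.liftP hq (del_relations hq)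

/-- The `γ`-twisted derivation `δ` of `B(R)`. -/
def del : BR q →ₗ[ℂ] BR q :=
  Matrix.entryLinearMap ℂ (BR q) 0 1 ∘ₗ (delHom hq).toLinearMap

theorem delHom_apply (x : BR q) : delHom hq x = !![x, del hq x; 0, gam hq x] := by
  have hd : ∀ x, delHom hq x 0 1 = del hq x := fun x => rfl
  have h : ∀ x, delHom hq x 0 0 = x ∧ delHom hq x 1 0 = 0 ∧ delHom hq x 1 1 = gam hq x := by
    intro x
    refine BR.ind (P := fun x => delHom hq x 0 0 = x ∧ delHom hq x 1 0 = 0 ∧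
      delHom hq x 1 1 = gam hq x) (by simp) ?_ ?_ ?_ ?_ ?_ ?_ ?_ x
    · rintro r x ⟨h1, h2, h3⟩; simp [h1, h2, h3]
    · rintro x y ⟨h1, h2, h3⟩ ⟨h4, h5, h6⟩; simp [h1, h2, h3, h4, h5, h6]
    · rintro x y ⟨h1, h2, h3⟩ ⟨h4, h5, h6⟩
      simp [Matrix.mul_apply, Fin.sum_univ_two, h1, h2, h3, h4, h5, h6]
    · simp [delHom, BR.liftP_a, gam, torus_a]
    · simp [delHom, BR.liftP_b, gam, torus_b]
    · simp [delHom, BR.liftP_c, gam, torus_c]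
    · simp [delHom, BR.liftP_p, gam, torus_p]
  obtain ⟨h1, h2, h3⟩ := h x
  ext i j
  fin_cases i <;> fin_cases j <;> simp [h1, h2, h3, hd]

theorem del_mul (x y : BR q) : del hq (x * y) = x * del hq y + del hq x * gam hq y := by
  have h := congrFun (congrFun (map_mul (delHom hq) x y) 0) 1
  simpa [delHom_apply, Matrix.mul_apply, Fin.sum_univ_two] using h

theorem del_a : del hq 𝐚 = (1 - 𝐬) • 𝐛 := by simp [del, delHom, BR.liftP_a]
theorem del_b : del hq 𝐛 = 0 := by simp [del, delHom, BR.liftP_b]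
theorem del_c : del hq 𝐜 = (1 - 𝐬) • 𝐰 := by simp [del, delHom, BR.liftP_c]
theorem del_p : del hq 𝐩 = 0 := by simp [del, delHom, BR.liftP_p]

theorem del_one : del hq 1 = 0 := by simp [del]

theorem gam_gam' (x : BR q) : gam hq (gam' hq x) = x :=
  torus_inv _ _ _ (mul_inv_cancel₀ (sq_ne_zero hq)) x

theorem gam'_gam (x : BR q) : gam' hq (gam hq x) = x :=
  torus_inv _ _ _ (inv_mul_cancel₀ (sq_ne_zero hq)) x

theorem gam_a : gam hq 𝐚 = 𝐚 := torus_a ..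
theorem gam_b : gam hq 𝐛 = 𝐬⁻¹ • 𝐛 := torus_b ..
theorem gam_c : gam hq 𝐜 = 𝐬 • 𝐜 := torus_c ..
theorem gam_p : gam hq 𝐩 = 𝐩 := torus_p ..
theorem gam_w : gam hq 𝐰 = 𝐰 := by simp [BR.w, gam_a, gam_p]
theorem gam'_a : gam' hq 𝐚 = 𝐚 := torus_a ..
theorem gam'_b : gam' hq 𝐛 = 𝐬 • 𝐛 := by rw [gam', torus_b, inv_inv]
theorem gam'_c : gam' hq 𝐜 = 𝐬⁻¹ • 𝐜 := torus_c ..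
theorem gam'_p : gam' hq 𝐩 = 𝐩 := torus_p ..

theorem del_gam (x : BR q) : del hq (gam hq x) = 𝐬 • gam hq (del hq x) := by
  have hs := sq_ne_zero hq
  refine BR.ind (P := fun x => del hq (gam hq x) = 𝐬 • gam hq (del hq x))
    ?_ ?_ ?_ ?_ ?_ ?_ ?_ ?_ x
  · simp [del_one]
  · intro r x h; simp [h, smul_comm r]
  · intro x y hx hy; simp [hx, hy]
  · intro x y hx hy; simp [del_mul, hx, hy]
  · simp [gam_a, del_a, gam_b, smul_smul]; match_scalars; field_simp
  · simp [gam_b, del_b]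
  · simp [gam_c, del_c, gam_w]
  · simp [gam_p, del_p]

/-- The Borel action on `B(R)` itself. -/
def BB : BorelAlg q (BR q) where
  g := gam hq
  g' := gam' hq
  d := del hq
  g_g' := gam_gam' hq
  g'_g := gam'_gam hq
  d_g := del_gam hq
  d_mul := del_mul hq

end

end

section

/-! ### Intertwiners -/

/-- A linear map that commutes with the Borel actions. -/
structure Intertwines {N N' : Type} [Ring N] [Algebra ℂ N] [Ring N'] [Algebra ℂ N']
    (M : BorelAlg q N) (M' : BorelAlg q N') (F : N →ₗ[ℂ] N') : Prop where
  map_g : ∀ x, F (M.g x) = M'.g (F x)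
  map_d : ∀ x, F (M.d x) = M'.d (F x)

namespace Intertwines
variable {N N' : Type} [Ring N] [Algebra ℂ N] [Ring N'] [Algebra ℂ N']
    {M : BorelAlg q N} {M' : BorelAlg q N'} {F : N →ₗ[ℂ] N'} (h : Intertwines M M' F) (hq : q ≠ 0)

theorem map_g' (h : Intertwines M M' F) (x : N) : F (M.g' x) = M'.g' (F x) := by
  rw [← M'.g'_g (F (M.g' x)), ← h.map_g, M.g_g']

/-- The braiding with elements of `B(R)` is natural for intertwiners. -/
theorem T_natural (h : Intertwines M M' F) (hq : q ≠ 0) (x : BR q) (t : N ⊗[ℂ] BR q) :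
    F.rTensor (BR q) (M.T hq x t) = M'.T hq x (F.rTensor (BR q) t) := by
  revert t
  refine BR.ind (P := fun x => ∀ t, F.rTensor (BR q) (M.T hq x t) = M'.T hq x (F.rTensor (BR q) t))
    ?_ ?_ ?_ ?_ ?_ ?_ ?_ ?_ x
  · simp
  · intro r x h t; simp only [map_smul, LinearMap.smul_apply, h]
  · intro x y hx hy t; simp only [map_add, LinearMap.add_apply, hx, hy]
  · intro x y hx hy t; simp only [map_mul, Module.End.mul_apply, hx, hy]
  all_goals
    intro t
    induction t using TensorProduct.induction_on with
    | zero => simp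
    | add t t' h h' => simp only [map_add, h, h']
    | tmul n v =>
      simp only [BorelAlg.T_a, BorelAlg.T_b, BorelAlg.T_c, BorelAlg.T_p, BorelAlg.Ta_tmul,
        BorelAlg.Tb_tmul, BorelAlg.Tc_tmul, BorelAlg.Tp_tmul, map_add, map_sub,
        LinearMap.rTensor_tmul, h.map_g, h.map_g', h.map_d]

end Intertwines

/-! ### The Borel action on a braided tensor product -/

namespace BorelAlg
variable {N : Type} [Ring N] [Algebra ℂ N] (M : BorelAlg q N) (hq : q ≠ 0)

/-- The action of the group-like generator on `N ⊗ B(R)`. -/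
def G : N ⊗[ℂ] BR q →ₗ[ℂ] N ⊗[ℂ] BR q :=
  TensorProduct.map M.g.toLinearMap (gam hq).toLinearMap

/-- The action of the inverse of the group-like generator on `N ⊗ B(R)`. -/
def G' : N ⊗[ℂ] BR q →ₗ[ℂ] N ⊗[ℂ] BR q :=
  TensorProduct.map M.g'.toLinearMap (gam' hq).toLinearMap

/-- The action of the twisted derivation on `N ⊗ B(R)`. -/
def D : N ⊗[ℂ] BR q →ₗ[ℂ] N ⊗[ℂ] BR q :=
  TensorProduct.map LinearMap.id (del hq) + TensorProduct.map M.d (gam hq).toLinearMap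

theorem G_tmul (n : N) (x : BR q) : M.G hq (n ⊗ₜ x) = M.g n ⊗ₜ gam hq x := rfl
theorem G'_tmul (n : N) (x : BR q) : M.G' hq (n ⊗ₜ x) = M.g' n ⊗ₜ gam' hq x := rfl
theorem D_tmul (n : N) (x : BR q) : M.D hq (n ⊗ₜ x) = n ⊗ₜ del hq x + M.d n ⊗ₜ gam hq x := rfl

theorem G_G' (t : N ⊗[ℂ] BR q) : M.G hq (M.G' hq t) = t := by
  induction t using TensorProduct.induction_on with
  | zero => simp
  | add t t' h h' => simp only [map_add, h, h']
  | tmul n v => rw [G'_tmul, G_tmul, M.g_g', gam_gam']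

theorem G'_G (t : N ⊗[ℂ] BR q) : M.G' hq (M.G hq t) = t := by
  induction t using TensorProduct.induction_on with
  | zero => simp
  | add t t' h h' => simp only [map_add, h, h']
  | tmul n v => rw [G_tmul, G'_tmul, M.g'_g, gam'_gam]

theorem D_G (t : N ⊗[ℂ] BR q) : M.D hq (M.G hq t) = 𝐬 • M.G hq (M.D hq t) := by
  induction t using TensorProduct.induction_on with
  | zero => simp
  | add t t' h h' => simp only [map_add, h, h', smul_add]
  | tmul n v =>
    simp only [G_tmul, D_tmul, del_gam, M.d_g, TensorProduct.tmul_smul, map_add,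
      ← TensorProduct.smul_tmul', smul_add]

theorem G_T (x : BR q) (t : N ⊗[ℂ] BR q) :
    M.G hq (M.T hq x t) = M.T hq (gam hq x) (M.G hq t) := by
  have hs := sq_ne_zero hq
  revert t
  refine BR.ind (P := fun x => ∀ t, M.G hq (M.T hq x t) = M.T hq (gam hq x) (M.G hq t))
    ?_ ?_ ?_ ?_ ?_ ?_ ?_ ?_ x
  · simp
  · intro r x h t; simp only [map_smul, LinearMap.smul_apply, h]
  · intro x y hx hy t; simp only [map_add, LinearMap.add_apply, hx, hy]
  · intro x y hx hy t; simp only [map_mul, Module.End.mul_apply, hx, hy]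
  all_goals
    intro t
    induction t using TensorProduct.induction_on with
    | zero => simp
    | add t t' h h' => simp only [map_add, h, h']
    | tmul n v =>
      simp only [gam_a, gam_b, gam_c, gam_p, map_smul, LinearMap.smul_apply, BorelAlg.T_a,
        BorelAlg.T_b, BorelAlg.T_c, BorelAlg.T_p, BorelAlg.Ta_tmul, BorelAlg.Tb_tmul,
        BorelAlg.Tc_tmul, BorelAlg.Tp_tmul, map_add, map_sub, G_tmul, map_mul, smul_mul_assoc,
        TensorProduct.tmul_smul, M.d_g, M.d_g' hq, M.g_g', M.g'_g, ← TensorProduct.smul_tmul',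
        gam_w]
      try (match_scalars <;> field_simp)

theorem D_T (x : BR q) (t : N ⊗[ℂ] BR q) :
    M.D hq (M.T hq x t) = M.T hq x (M.D hq t) + M.T hq (del hq x) (M.G hq t) := by
  have hs := sq_ne_zero hq
  have hr := BR.relations hq
  revert t
  refine BR.ind (P := fun x => ∀ t, M.D hq (M.T hq x t) =
    M.T hq x (M.D hq t) + M.T hq (del hq x) (M.G hq t)) ?_ ?_ ?_ ?_ ?_ ?_ ?_ ?_ x
  · simp [del_one]
  · intro r x h t; simp only [map_smul, LinearMap.smul_apply, h, smul_add]
  · intro x y hx hy t; simp only [map_add, LinearMap.add_apply, hx, hy]; abel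
  · intro x y hx hy t
    simp only [map_mul, Module.End.mul_apply, hx, hy, del_mul, map_add, G_T, LinearMap.add_apply]
    abel
  all_goals
    intro t
    induction t using TensorProduct.induction_on with
    | zero => simp
    | add t t' h h' => simp only [map_add, h, h']; abel
    | tmul n v =>
      simp only [del_a, del_b, del_c, del_p, gam_a, gam_b, gam_c, gam_p, map_smul,
        LinearMap.smul_apply, LinearMap.zero_apply, map_zero, zero_mul, TensorProduct.tmul_zero,
        BorelAlg.T_a, BorelAlg.T_b, BorelAlg.T_c, BorelAlg.T_p, BorelAlg.Ta_tmul, BorelAlg.Tb_tmul,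
        BorelAlg.Tc_tmul, BorelAlg.Tp_tmul, map_add, map_sub, G_tmul, D_tmul, del_mul,
        smul_mul_assoc, TensorProduct.tmul_smul, M.d_g, M.d_g' hq, M.g'_g,
        ← TensorProduct.smul_tmul', map_mul, TensorProduct.tmul_add, LinearMap.sub_apply, BR.w,
        sub_mul, TensorProduct.tmul_sub]
      try (match_scalars <;> field_simp <;> ring)

theorem G_rho (s t : N ⊗[ℂ] BR q) :
    M.G hq (M.rho hq s t) = M.rho hq (M.G hq s) (M.G hq t) := by
  have hl : ∀ n t, M.G hq (lmul q n t) = lmul q (M.g n) (M.G hq t) := by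
    intro n t
    induction t using TensorProduct.induction_on with
    | zero => simp
    | add t t' h h' => simp only [map_add, h, h']
    | tmul m v => simp only [lmul_tmul, G_tmul, map_mul]
  induction s using TensorProduct.induction_on with
  | zero => simp
  | add s s' h h' => simp only [map_add, h, h', LinearMap.add_apply]
  | tmul m v => simp only [rho_tmul, G_tmul, Module.End.mul_apply, hl, G_T]

theorem G'_rho (s t : N ⊗[ℂ] BR q) :
    M.G' hq (M.rho hq s t) = M.rho hq (M.G' hq s) (M.G' hq t) := by
  have h := M.G_rho hq (M.G' hq s) (M.G' hq t)
  rw [G_G', G_G'] at h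
  rw [← h, G'_G]

/-- The action on `N ⊗ B(R)` is by a twisted derivation of the braided product. -/
theorem D_rho (s t : N ⊗[ℂ] BR q) :
    M.D hq (M.rho hq s t) = M.rho hq s (M.D hq t) + M.rho hq (M.D hq s) (M.G hq t) := by
  have hl : ∀ n t, M.D hq (lmul q n t) = lmul q n (M.D hq t) + lmul q (M.d n) (M.G hq t) := by
    intro n t
    induction t using TensorProduct.induction_on with
    | zero => simp
    | add t t' h h' => simp only [map_add, h, h']; abel
    | tmul m v =>
      simp only [lmul_tmul, D_tmul, G_tmul, M.d_mul, map_add, TensorProduct.add_tmul]; abel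
  induction s using TensorProduct.induction_on with
  | zero => simp
  | add s s' h h' => simp only [map_add, h, h', LinearMap.add_apply]; abel
  | tmul m v =>
    simp only [rho_tmul, D_tmul, Module.End.mul_apply, hl, D_T, G_T, map_add, LinearMap.add_apply]
    abel

end BorelAlg

open BorelAlg in
/-- The Borel action on the braided tensor product algebra. -/
def BPB {N : Type} [Ring N] [Algebra ℂ N] (M : BorelAlg q N) (hq : q ≠ 0) :
    BorelAlg q (BP M hq) where
  g := AlgHom.ofLinearMap (M.G hq : BP M hq →ₗ[ℂ] BP M hq)
    (by change M.G hq (1 ⊗ₜ 1) = 1 ⊗ₜ 1; rw [G_tmul, map_one, map_one]) (M.G_rho hq)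
  g' := AlgHom.ofLinearMap (M.G' hq : BP M hq →ₗ[ℂ] BP M hq)
    (by change M.G' hq (1 ⊗ₜ 1) = 1 ⊗ₜ 1; rw [G'_tmul, map_one, map_one]) (M.G'_rho hq)
  d := M.D hq
  g_g' := M.G_G' hq
  g'_g := M.G'_G hq
  d_g := M.D_G hq
  d_mul := M.D_rho hq

section
variable {N N' : Type} [Ring N] [Algebra ℂ N] [Ring N'] [Algebra ℂ N']
    {M : BorelAlg q N} {M' : BorelAlg q N'} (hq : q ≠ 0)

/-- Functoriality of the braided tensor product with `B(R)`. -/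
def BP.map (F : N →ₐ[ℂ] N') (h : Intertwines M M' F.toLinearMap) : BP M hq →ₐ[ℂ] BP M' hq :=
  AlgHom.ofLinearMap (F.toLinearMap.rTensor (BR q) : BP M hq →ₗ[ℂ] BP M' hq)
    (by change F 1 ⊗ₜ 1 = 1 ⊗ₜ 1; rw [map_one]) (by
      intro s t
      have hl : ∀ n (t : N ⊗[ℂ] BR q), F.toLinearMap.rTensor (BR q) (BorelAlg.lmul q n t) =
          BorelAlg.lmul q (F n) (F.toLinearMap.rTensor (BR q) t) := by
        intro n t
        induction t using TensorProduct.induction_on with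
        | zero => simp
        | add t t' h h' => simp only [map_add, h, h']
        | tmul m v => simp
      have key : ∀ s t : N ⊗[ℂ] BR q, F.toLinearMap.rTensor (BR q) (M.rho hq s t) =
          M'.rho hq (F.toLinearMap.rTensor (BR q) s) (F.toLinearMap.rTensor (BR q) t) := by
        intro s t
        induction s using TensorProduct.induction_on with
        | zero => simp
        | add s s' h h' => simp only [map_add, h, h', LinearMap.add_apply]
        | tmul m v =>
          simp only [BorelAlg.rho_tmul, Module.End.mul_apply, hl, h.T_natural hq,
            LinearMap.rTensor_tmul]
          rfl
      exact key s t)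

theorem BP.map_tm (F : N →ₐ[ℂ] N') (h : Intertwines M M' F.toLinearMap) (n : N) (x : BR q) :
    BP.map hq F h (BP.tm n x) = BP.tm (F n) x := rfl

end

/-- The inclusion of `B(R)` as the right factor is an intertwiner. -/
theorem inr_intertwines {N : Type} [Ring N] [Algebra ℂ N] (M : BorelAlg q N) (hq : q ≠ 0) :
    Intertwines (BB hq) (BPB M hq) (BP.inr M hq).toLinearMap where
  map_g x := by
    change (1 : N) ⊗ₜ[ℂ] gam hq x = M.G hq (1 ⊗ₜ x)
    rw [BorelAlg.G_tmul, map_one]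
  map_d x := by
    change (1 : N) ⊗ₜ[ℂ] del hq x = M.D hq (1 ⊗ₜ x)
    rw [BorelAlg.D_tmul, BorelAlg.d_one, TensorProduct.zero_tmul, add_zero]

theorem inl_intertwines {N : Type} [Ring N] [Algebra ℂ N] (M : BorelAlg q N) (hq : q ≠ 0) :
    Intertwines M (BPB M hq) (BP.inl M hq).toLinearMap where
  map_g x := by
    change M.g x ⊗ₜ[ℂ] (1 : BR q) = M.G hq (x ⊗ₜ 1)
    rw [BorelAlg.G_tmul, map_one]
  map_d x := by
    change M.d x ⊗ₜ[ℂ] (1 : BR q) = M.D hq (x ⊗ₜ 1)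
    rw [BorelAlg.D_tmul, del_one, TensorProduct.tmul_zero, zero_add, map_one]

/-! ### The braiding -/

/-- The braiding `ψ(x ⊗ n) = T x (n ⊗ 1)` of `B(R)` with an algebra with Borel action. -/
def psiN {N : Type} [Ring N] [Algebra ℂ N] (M : BorelAlg q N) (hq : q ≠ 0) :
    BR q ⊗[ℂ] N →ₗ[ℂ] N ⊗[ℂ] BR q :=
  TensorProduct.lift ((M.T hq).toLinearMap.compl₂ ((TensorProduct.mk ℂ N (BR q)).flip 1))

section
variable {N : Type} [Ring N] [Algebra ℂ N] (M : BorelAlg q N) (hq : q ≠ 0)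

/-- The operators `T x` for the braided tensor product `N ⊗ B(R)`. -/
def TT : BR q →ₗ[ℂ] Module.End ℂ ((N ⊗[ℂ] BR q) ⊗[ℂ] BR q) := ((BPB M hq).T hq).toLinearMap

theorem TT_one : TT M hq 1 = 1 := map_one ((BPB M hq).T hq)

theorem TT_mul (x y : BR q) : TT M hq (x * y) = TT M hq x * TT M hq y :=
  map_mul ((BPB M hq).T hq) x y

theorem TT_a (n : N) (u v : BR q) : TT M hq 𝐚 ((n ⊗ₜ u) ⊗ₜ v) =
    (n ⊗ₜ u) ⊗ₜ (𝐚 * v) + M.D hq (n ⊗ₜ u) ⊗ₜ (𝐜 * v) :=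
  LinearMap.congr_fun ((BPB M hq).T_a hq) ((n ⊗ₜ u) ⊗ₜ v)

theorem TT_b (n : N) (u v : BR q) : TT M hq 𝐛 ((n ⊗ₜ u) ⊗ₜ v) =
    M.G' hq (n ⊗ₜ u) ⊗ₜ (𝐛 * v) + M.D hq (M.G' hq (n ⊗ₜ u)) ⊗ₜ (𝐰 * v)
      - M.D hq (M.D hq (M.G' hq (n ⊗ₜ u))) ⊗ₜ (𝐜 * v) :=
  LinearMap.congr_fun ((BPB M hq).T_b hq) ((n ⊗ₜ u) ⊗ₜ v)

theorem TT_c (n : N) (u v : BR q) : TT M hq 𝐜 ((n ⊗ₜ u) ⊗ₜ v) =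
    M.G hq (n ⊗ₜ u) ⊗ₜ (𝐜 * v) :=
  LinearMap.congr_fun ((BPB M hq).T_c hq) ((n ⊗ₜ u) ⊗ₜ v)

theorem TT_p (n : N) (u v : BR q) : TT M hq 𝐩 ((n ⊗ₜ u) ⊗ₜ v) = (n ⊗ₜ u) ⊗ₜ (𝐩 * v) :=
  LinearMap.congr_fun ((BPB M hq).T_p hq) ((n ⊗ₜ u) ⊗ₜ v)

/-- The map `(n ⊗ x) ⊗ t ↦ n ⊗ T x t`. -/
def theta : N ⊗[ℂ] BR q →ₗ[ℂ] BR q ⊗[ℂ] BR q →ₗ[ℂ] (N ⊗[ℂ] BR q) ⊗[ℂ] BR q :=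
  TensorProduct.lift (LinearMap.mk₂ ℂ (fun (n : N) (x : BR q) =>
      (TensorProduct.assoc ℂ N (BR q) (BR q)).symm.toLinearMap ∘ₗ
        TensorProduct.mk ℂ N (BR q ⊗[ℂ] BR q) n ∘ₗ (BB hq).T hq x)
    (fun n n' x => by ext; simp) (fun r n x => by ext; simp)
    (fun n x x' => by ext; simp [TensorProduct.tmul_add]) (fun r n x => by ext; simp))

theorem theta_tmul (n : N) (x : BR q) (t : BR q ⊗[ℂ] BR q) : theta hq (n ⊗ₜ x) t =
    (TensorProduct.assoc ℂ N (BR q) (BR q)).symm (n ⊗ₜ (BB hq).T hq x t) := rfl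

theorem theta_rmul (s : N ⊗[ℂ] BR q) (z : BR q) (t : BR q ⊗[ℂ] BR q) :
    theta hq (BorelAlg.rmul N z s) t = theta hq s ((BB hq).T hq z t) := by
  induction s using TensorProduct.induction_on with
  | zero => simp
  | add s s' h h' => simp only [map_add, h, h', LinearMap.add_apply]
  | tmul m v => simp [theta_tmul]

/-- The braiding of `B(R)` with the tensor product `N ⊗ B(R)` is the composite of the braidings with
`N` and with `B(R)`. -/
theorem TT_assoc_symm (x : BR q) (n : N) (t : BR q ⊗[ℂ] BR q) :
    TT M hq x ((TensorProduct.assoc ℂ N (BR q) (BR q)).symm (n ⊗ₜ t)) =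
      theta hq (M.T hq x (n ⊗ₜ 1)) t := by
  have hs := sq_ne_zero hq
  revert n t
  refine BR.ind (P := fun x => ∀ (n : N) t,
    TT M hq x ((TensorProduct.assoc ℂ N (BR q) (BR q)).symm (n ⊗ₜ t)) =
      theta hq (M.T hq x (n ⊗ₜ 1)) t) ?_ ?_ ?_ ?_ ?_ ?_ ?_ ?_ x
  · intro n t
    simp [TT_one, theta_tmul]
  · intro r x h n t; simp only [map_smul, LinearMap.smul_apply, h]
  · intro x y hx hy n t; simp only [map_add, LinearMap.add_apply, hx, hy]
  · intro x y hx hy n t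
    rw [TT_mul, Module.End.mul_apply, hy, map_mul, Module.End.mul_apply]
    generalize M.T hq y (n ⊗ₜ[ℂ] 1) = s
    induction s using TensorProduct.induction_on with
    | zero => simp
    | add s s' h h' => simp only [map_add, h, h', LinearMap.add_apply]
    | tmul m z => rw [theta_tmul, hx, ← theta_rmul, ← BorelAlg.T_tmul]
  all_goals
    intro n t
    induction t using TensorProduct.induction_on with
    | zero => simp
    | add t t' h h' => simp only [map_add, TensorProduct.tmul_add, h, h']
    | tmul u v =>
      have hB1 : (BB hq).g = gam hq := rfl
      have hB2 : (BB hq).g' = gam' hq := rfl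
      have hB3 : (BB hq).d = del hq := rfl
      have hB4 := (BB hq).d_g' hq
      rw [hB2, hB3] at hB4
      simp only [BorelAlg.T_a, BorelAlg.T_b, BorelAlg.T_c, BorelAlg.T_p, BorelAlg.Ta_tmul,
        BorelAlg.Tb_tmul, BorelAlg.Tc_tmul, BorelAlg.Tp_tmul, map_add, map_sub, theta_tmul,
        LinearMap.add_apply, LinearMap.sub_apply, TT_a, TT_b, TT_c, TT_p, mul_one, BR.w, map_smul,
        LinearMap.smul_apply, TensorProduct.assoc_symm_tmul, BorelAlg.D_tmul, BorelAlg.G_tmul,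
        BorelAlg.G'_tmul, TensorProduct.tmul_add, TensorProduct.add_tmul, sub_mul, smul_mul_assoc,
        TensorProduct.tmul_sub, TensorProduct.tmul_smul, ← TensorProduct.smul_tmul', hB1, hB2, hB3,
        hB4, M.d_g' hq, gam_gam']
      try (match_scalars <;> field_simp <;> ring)

end

end

section

/-! ### The braiding of `B(R)` with itself -/

theorem on12_tmul (f : BR q ⊗[ℂ] BR q →ₗ[ℂ] BR q ⊗[ℂ] BR q) (s : BR q ⊗[ℂ] BR q) (z : BR q) :
    on12 f (s ⊗ₜ z) = f s ⊗ₜ z := rfl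

theorem on23_symm (f : BR q ⊗[ℂ] BR q →ₗ[ℂ] BR q ⊗[ℂ] BR q) (x : BR q) (s : BR q ⊗[ℂ] BR q) :
    on23 f ((asc q).symm (x ⊗ₜ s)) = (asc q).symm (x ⊗ₜ f s) := by
  simp [on23]

theorem m12_tmul (x y z : BR q) : m12 q ((x ⊗ₜ y) ⊗ₜ z) = (x * y) ⊗ₜ z := rfl

theorem m23_tmul (s : BR q ⊗[ℂ] BR q) (z : BR q) :
    m23 q (s ⊗ₜ z) = BorelAlg.rmul (BR q) z s := by
  induction s using TensorProduct.induction_on with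
  | zero => simp
  | add s s' h h' => simp only [TensorProduct.add_tmul, map_add, h, h']
  | tmul m y => rfl

theorem m12_symm (x : BR q) (t : BR q ⊗[ℂ] BR q) :
    m12 q ((asc q).symm (x ⊗ₜ t)) = BorelAlg.lmul q x t := by
  induction t using TensorProduct.induction_on with
  | zero => simp
  | add s s' h h' => simp only [TensorProduct.tmul_add, map_add, h, h']
  | tmul m y => rfl

theorem co23_apply (f : BR q →ₗ[ℂ] BR q ⊗[ℂ] BR q) (x y : BR q) :
    co23 f (x ⊗ₜ y) = (asc q).symm (x ⊗ₜ f y) := rfl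

theorem co12_apply (f : BR q →ₗ[ℂ] BR q ⊗[ℂ] BR q) (x y : BR q) :
    co12 f (x ⊗ₜ y) = f x ⊗ₜ y := rfl

/-- The braided product of pure tensors. -/
theorem braidedMul_tmul (ψ : BR q ⊗[ℂ] BR q →ₗ[ℂ] BR q ⊗[ℂ] BR q) (x y z w : BR q) :
    braidedMul ψ ((x ⊗ₜ y) ⊗ₜ (z ⊗ₜ w)) =
      BorelAlg.lmul q x (BorelAlg.rmul (BR q) w (ψ (y ⊗ₜ z))) := by
  have h : ∀ s : BR q ⊗[ℂ] BR q, TensorProduct.map (mu q) (mu q)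
      ((TensorProduct.assoc ℂ (BR q) (BR q) (BR q ⊗[ℂ] BR q)).symm
        (x ⊗ₜ (asc q (s ⊗ₜ w)))) = BorelAlg.lmul q x (BorelAlg.rmul (BR q) w s) := by
    intro s
    induction s using TensorProduct.induction_on with
    | zero => simp
    | add s s' h h' => simp only [TensorProduct.add_tmul, TensorProduct.tmul_add, map_add, h, h']
    | tmul m y => rfl
  exact h _

section
variable (hq : q ≠ 0)

/-- The braiding of `B(R)` with itself. -/
def psi : BR q ⊗[ℂ] BR q →ₗ[ℂ] BR q ⊗[ℂ] BR q := psiN (BB hq) hq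

theorem psi_tmul (x y : BR q) : psi hq (x ⊗ₜ y) = (BB hq).T hq x (y ⊗ₜ 1) := rfl

theorem psi_one_tmul (x : BR q) : psi hq (1 ⊗ₜ x) = x ⊗ₜ 1 := by
  rw [psi_tmul, map_one]; rfl

theorem psi_tmul_one (x : BR q) : psi hq (x ⊗ₜ 1) = 1 ⊗ₜ x := by
  rw [psi_tmul, BorelAlg.T_one_tmul]

theorem m23_on12_psi (x : BR q) (t : BR q ⊗[ℂ] BR q) :
    m23 q (on12 (psi hq) ((asc q).symm (x ⊗ₜ t))) = (BB hq).T hq x t := by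
  induction t using TensorProduct.induction_on with
  | zero => simp
  | add s s' h h' => simp only [TensorProduct.tmul_add, map_add, h, h']
  | tmul m y =>
    rw [TensorProduct.assoc_symm_tmul, on12_tmul, m23_tmul, psi_tmul, ← BorelAlg.T_tmul]

theorem m12_on23_psi (t : BR q ⊗[ℂ] BR q) (x : BR q) :
    m12 q (on23 (psi hq) (t ⊗ₜ x)) = (BB hq).rho hq t (x ⊗ₜ 1) := by
  induction t using TensorProduct.induction_on with
  | zero => simp
  | add s s' h h' => simp only [TensorProduct.add_tmul, map_add, h, h', LinearMap.add_apply]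
  | tmul m y =>
    rw [← TensorProduct.assoc_symm_tmul, on23_symm, m12_symm, psi_tmul]; rfl

theorem psi_mul_left : psi hq ∘ₗ m12 q = m23 q ∘ₗ on12 (psi hq) ∘ₗ on23 (psi hq) := by
  refine TensorProduct.ext_threefold fun x y z => ?_
  simp only [LinearMap.comp_apply]
  rw [← TensorProduct.assoc_symm_tmul, on23_symm, m23_on12_psi, psi_tmul,
    TensorProduct.assoc_symm_tmul, m12_tmul, psi_tmul, map_mul]
  rfl

theorem psi_mul_right : psi hq ∘ₗ m23 q = m12 q ∘ₗ on23 (psi hq) ∘ₗ on12 (psi hq) := by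
  refine TensorProduct.ext_threefold fun x y z => ?_
  simp only [LinearMap.comp_apply]
  rw [on12_tmul, m12_on23_psi, m23_tmul, BorelAlg.rmul_tmul, psi_tmul, psi_tmul,
    ← BorelAlg.T_mul_lmul]
  rfl

/-- The product of the algebra `BP (BB hq) hq` is the braided product for `ψ`. -/
theorem braidedMul_psi (s t : BR q ⊗[ℂ] BR q) :
    braidedMul (psi hq) (s ⊗ₜ t) = (BB hq).rho hq s t := by
  induction s using TensorProduct.induction_on with
  | zero => simp
  | add s s' h h' => simp only [TensorProduct.add_tmul, map_add, h, h', LinearMap.add_apply]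
  | tmul x y =>
    induction t using TensorProduct.induction_on with
    | zero => simp
    | add s s' h h' => simp only [TensorProduct.tmul_add, map_add, h, h']
    | tmul z w =>
      rw [braidedMul_tmul, psi_tmul, ← BorelAlg.T_tmul]; rfl

/-- The braiding commutes with the Borel actions. -/
theorem psi_G (t : BR q ⊗[ℂ] BR q) : psi hq ((BB hq).G hq t) = (BB hq).G hq (psi hq t) := by
  induction t using TensorProduct.induction_on with
  | zero => simp
  | add s s' h h' => simp only [map_add, h, h']
  | tmul x y =>
    rw [psi_tmul, BorelAlg.G_T, BorelAlg.G_tmul, BorelAlg.G_tmul, map_one]; rfl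

theorem psi_D (t : BR q ⊗[ℂ] BR q) : psi hq ((BB hq).D hq t) = (BB hq).D hq (psi hq t) := by
  induction t using TensorProduct.induction_on with
  | zero => simp
  | add s s' h h' => simp only [map_add, h, h']
  | tmul x y =>
    rw [psi_tmul, BorelAlg.D_T, BorelAlg.G_tmul, BorelAlg.D_tmul, BorelAlg.D_tmul, map_add,
      map_one (gam hq), del_one, TensorProduct.tmul_zero, zero_add]; rfl

theorem psi_intertwines :
    Intertwines (BPB (BB hq) hq) (BPB (BB hq) hq) (psi hq : BP (BB hq) hq →ₗ[ℂ] BP (BB hq) hq) :=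
  ⟨psi_G hq, psi_D hq⟩

/-- The braiding of `x` past a tensor product. -/
theorem on23_on12_psi (x : BR q) (t : BR q ⊗[ℂ] BR q) :
    on23 (psi hq) (on12 (psi hq) ((asc q).symm (x ⊗ₜ t))) = TT (BB hq) hq x (t ⊗ₜ 1) := by
  have h : ∀ (s : BR q ⊗[ℂ] BR q) (y : BR q),
      on23 (psi hq) (s ⊗ₜ y) = theta hq s (y ⊗ₜ 1) := by
    intro s y
    induction s using TensorProduct.induction_on with
    | zero => simp
    | add s s' h h' => simp only [TensorProduct.add_tmul, map_add, h, h', LinearMap.add_apply]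
    | tmul m z => rw [← TensorProduct.assoc_symm_tmul, on23_symm, theta_tmul, psi_tmul]
  induction t using TensorProduct.induction_on with
  | zero => simp
  | add s s' h h' => simp only [TensorProduct.tmul_add, TensorProduct.add_tmul, map_add, h, h']
  | tmul m y =>
    rw [TensorProduct.assoc_symm_tmul, on12_tmul, h, psi_tmul, ← TT_assoc_symm,
      TensorProduct.assoc_symm_tmul]

/-- The braid relation is naturality of the braiding for `ψ` itself, which commutes with the Borel
actions. -/
theorem psi_yang_baxter : on12 (psi hq) ∘ₗ on23 (psi hq) ∘ₗ on12 (psi hq) =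
    on23 (psi hq) ∘ₗ on12 (psi hq) ∘ₗ on23 (psi hq) := by
  refine TensorProduct.ext_threefold fun x y z => ?_
  simp only [LinearMap.comp_apply]
  rw [← TensorProduct.assoc_symm_tmul, on23_on12_psi, on23_symm, on23_on12_psi]
  exact (psi_intertwines hq).T_natural hq x ((y ⊗ₜ z) ⊗ₜ 1)

/-! ### The coproduct -/

variable (q) in
/-- The element `Δ(a)`. -/
def comulA : BR q ⊗[ℂ] BR q := 𝐚 ⊗ₜ 𝐚 + 𝐛 ⊗ₜ 𝐜

variable (q) in
/-- The element `Δ(b)`. -/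
def comulB : BR q ⊗[ℂ] BR q := 𝐚 ⊗ₜ 𝐛 - 𝐬⁻¹ • (𝐛 ⊗ₜ 𝐚) + 𝐛 ⊗ₜ 𝐩

variable (q) in
/-- The element `Δ(c)`. -/
def comulC : BR q ⊗[ℂ] BR q := 𝐜 ⊗ₜ 𝐚 - 𝐬⁻¹ • (𝐚 ⊗ₜ 𝐜) + 𝐩 ⊗ₜ 𝐜

variable (q) in
/-- The element `Δ(p)`. -/
def comulP : BR q ⊗[ℂ] BR q := (𝐬⁻¹ + 𝐬⁻¹ ^ 2) • (𝐚 ⊗ₜ 𝐚) + 𝐬⁻¹ • (𝐛 ⊗ₜ 𝐜) + 𝐜 ⊗ₜ 𝐛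
  - 𝐬⁻¹ • (𝐩 ⊗ₜ 𝐚) - 𝐬⁻¹ • (𝐚 ⊗ₜ 𝐩) + 𝐩 ⊗ₜ 𝐩

theorem comul_relations : Relations q (A := BP (BB hq) hq)
    (comulA q : BR q ⊗[ℂ] BR q) (comulB q : BR q ⊗[ℂ] BR q) (comulC q : BR q ⊗[ℂ] BR q)
    (comulP q : BR q ⊗[ℂ] BR q) := by
  have hs := sq_ne_zero hq
  have h := BR.relations hq
  have hB1 : (BB hq).g = gam hq := rfl
  have hB2 : (BB hq).g' = gam' hq := rfl
  have hB3 : (BB hq).d = del hq := rfl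
  -- the relations, written in the underlying space `B(R) ⊗ B(R)`
  have key : let R := (BB hq).rho hq
      R (comulB q) (comulA q) = 𝐬 • R (comulA q) (comulB q) ∧
      R (comulC q) (comulA q) = 𝐬⁻¹ • R (comulA q) (comulC q) ∧
      R (comulP q) (comulA q) = R (comulA q) (comulP q) ∧
      R (comulP q) (comulB q) = R (comulB q) (comulP q) ∧
      R (comulP q) (comulC q) = R (comulC q) (comulP q) ∧
      R (comulC q) (comulB q) = 𝐬⁻¹ • R (comulA q) (comulP q)
        - 𝐬⁻¹ ^ 2 • R (comulA q) (comulA q) - 𝐬⁻¹ • (1 ⊗ₜ 1) ∧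
      R (comulB q) (comulC q) = R (comulA q) (comulP q) - R (comulA q) (comulA q)
        - 𝐬⁻¹ • (1 ⊗ₜ 1) := by
    refine ⟨?_, ?_, ?_, ?_, ?_, ?_, ?_⟩ <;>
    · simp only [comulA, comulB, comulC, comulP, map_add, map_sub, map_smul, LinearMap.add_apply,
        LinearMap.sub_apply, LinearMap.smul_apply, BorelAlg.rho_tmul, Module.End.mul_apply,
        BorelAlg.T_a, BorelAlg.T_b, BorelAlg.T_c, BorelAlg.T_p, BorelAlg.Ta_tmul, BorelAlg.Tb_tmul,
        BorelAlg.Tc_tmul, BorelAlg.Tp_tmul, hB1, hB2, hB3, gam_a, gam_b, gam_c, gam_p, gam'_a,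
        gam'_b, gam'_c, gam'_p, del_a, del_b, del_c, del_p, map_zero, TensorProduct.zero_tmul,
        BorelAlg.lmul_tmul, BR.w, sub_mul, smul_mul_assoc, h.ba, h.ca, h.pa, h.pb, h.pc, h.cb, h.bc,
        TensorProduct.tmul_sub, TensorProduct.sub_tmul, TensorProduct.tmul_smul,
        ← TensorProduct.smul_tmul']
      match_scalars <;> field_simp <;> ring
  obtain ⟨h1, h2, h3, h4, h5, h6, h7⟩ := key
  exact ⟨h1, h2, h3, h4, h5, h6, h7⟩

/-- The coproduct, an algebra map into the braided tensor square. -/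
def comul : BR q →ₐ[ℂ] BP (BB hq) hq := BR.liftP hq (comul_relations hq)

theorem comul_a : comul hq 𝐚 = comulA q := BR.liftP_a ..
theorem comul_b : comul hq 𝐛 = comulB q := BR.liftP_b ..
theorem comul_c : comul hq 𝐜 = comulC q := BR.liftP_c ..
theorem comul_p : comul hq 𝐩 = comulP q := BR.liftP_p ..

end

end

section

section
variable (hq : q ≠ 0)

/-- The coproduct as a linear map. -/
def Del : BR q →ₗ[ℂ] BR q ⊗[ℂ] BR q := (comul hq).toLinearMap

theorem Del_one : Del hq 1 = 1 ⊗ₜ 1 := map_one (comul hq)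

theorem Del_mul (x y : BR q) : Del hq (x * y) = (BB hq).rho hq (Del hq x) (Del hq y) :=
  map_mul (comul hq) x y

theorem Del_a : Del hq 𝐚 = comulA q := comul_a hq
theorem Del_b : Del hq 𝐛 = comulB q := comul_b hq
theorem Del_c : Del hq 𝐜 = comulC q := comul_c hq
theorem Del_p : Del hq 𝐩 = comulP q := comul_p hq

theorem Del_gam (x : BR q) : Del hq (gam hq x) = (BB hq).G hq (Del hq x) := by
  have hs := sq_ne_zero hq
  have hB1 : (BB hq).g = gam hq := rfl
  refine BR.ind (P := fun x => Del hq (gam hq x) = (BB hq).G hq (Del hq x))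
    ?_ ?_ ?_ ?_ ?_ ?_ ?_ ?_ x
  · rw [map_one, Del_one, BorelAlg.G_tmul, map_one, map_one]
  · intro r x h; simp only [map_smul, h]
  · intro x y hx hy; simp only [map_add, hx, hy]
  · intro x y hx hy; simp only [map_mul, Del_mul, hx, hy, BorelAlg.G_rho]
  all_goals
    simp only [gam_a, gam_b, gam_c, gam_p, map_smul, Del_a, Del_b, Del_c, Del_p, comulA, comulB,
      comulC, comulP, map_add, map_sub, BorelAlg.G_tmul, hB1, TensorProduct.tmul_smul,
      ← TensorProduct.smul_tmul']
    match_scalars <;> field_simp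

theorem Del_del (x : BR q) : Del hq (del hq x) = (BB hq).D hq (Del hq x) := by
  have hs := sq_ne_zero hq
  have hB1 : (BB hq).g = gam hq := rfl
  have hB3 : (BB hq).d = del hq := rfl
  refine BR.ind (P := fun x => Del hq (del hq x) = (BB hq).D hq (Del hq x))
    ?_ ?_ ?_ ?_ ?_ ?_ ?_ ?_ x
  · rw [del_one, map_zero, Del_one, BorelAlg.D_tmul, del_one, BorelAlg.d_one,
      TensorProduct.tmul_zero, TensorProduct.zero_tmul, add_zero]
  · intro r x h; simp only [map_smul, h]
  · intro x y hx hy; simp only [map_add, hx, hy]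
  · intro x y hx hy
    simp only [del_mul, map_add, Del_mul, hx, hy, BorelAlg.D_rho, Del_gam]
  all_goals
    simp only [gam_a, gam_b, gam_c, gam_p, del_a, del_b, del_c, del_p, BR.w, map_smul, map_zero,
      Del_a, Del_b, Del_c, Del_p, comulA, comulB, comulC, comulP, map_add, map_sub, BorelAlg.D_tmul,
      hB3, TensorProduct.tmul_smul, ← TensorProduct.smul_tmul', TensorProduct.tmul_zero,
      TensorProduct.zero_tmul, TensorProduct.tmul_sub, TensorProduct.sub_tmul]
    match_scalars <;> field_simp <;> ring

theorem comul_intertwines : Intertwines (BB hq) (BPB (BB hq) hq) (comul hq).toLinearMap :=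
  ⟨Del_gam hq, Del_del hq⟩

/-- Naturality of the braiding for the coproduct in the second argument, as `Δ` commutes with the
Borel actions. -/
theorem psi_comul_right :
    co12 (Del hq) ∘ₗ psi hq = on23 (psi hq) ∘ₗ on12 (psi hq) ∘ₗ co23 (Del hq) := by
  refine TensorProduct.ext' fun x y => ?_
  simp only [LinearMap.comp_apply]
  rw [co23_apply, on23_on12_psi]
  exact (comul_intertwines hq).T_natural hq x (y ⊗ₜ 1)

/-! ### Coassociativity -/

/-- The braided tensor cube of `B(R)`. -/
abbrev BP3 (hq : q ≠ 0) : Type := BP (BPB (BB hq) hq) hq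

/-- The inclusion of the first factor in the tensor cube. -/
def in1 : BR q →ₐ[ℂ] BP3 hq := (BP.inl (BPB (BB hq) hq) hq).comp (BP.inl (BB hq) hq)

/-- The inclusion of the second factor in the tensor cube. -/
def in2 : BR q →ₐ[ℂ] BP3 hq := (BP.inl (BPB (BB hq) hq) hq).comp (BP.inr (BB hq) hq)

/-- The inclusion of the third factor in the tensor cube. -/
def in3 : BR q →ₐ[ℂ] BP3 hq := BP.inr (BPB (BB hq) hq) hq

/-- The inclusion of the last two factors in the tensor cube. -/
def in23 : BP (BB hq) hq →ₐ[ℂ] BP3 hq := BP.map hq (BP.inr (BB hq) hq) (inr_intertwines (BB hq) hq)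

/-- The coproduct `1 ⊗ Δ` as an algebra map into the tensor cube. -/
def comul23 : BR q →ₐ[ℂ] BP3 hq := (in23 hq).comp (comul hq)

theorem in23_tmul (x y : BR q) :
    in23 hq (x ⊗ₜ[ℂ] y : BR q ⊗[ℂ] BR q) = in2 hq x * in3 hq y := by
  change BP.map hq (BP.inr (BB hq) hq) (inr_intertwines (BB hq) hq) (BP.tm x y) = _
  rw [BP.map_tm, BP.tm_eq]; rfl

theorem in1_mul_in23 (x : BR q) (t : BR q ⊗[ℂ] BR q) :
    in1 hq x * in23 hq t = ((asc q).symm (x ⊗ₜ t) : (BR q ⊗[ℂ] BR q) ⊗[ℂ] BR q) := by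
  induction t using TensorProduct.induction_on with
  | zero => rw [TensorProduct.tmul_zero, map_zero]; exact mul_zero _
  | add s s' h h' =>
    rw [TensorProduct.tmul_add, map_add]
    exact ((congrArg (in1 hq x * ·) (map_add (in23 hq) s s')).trans (mul_add _ _ _)).trans
      (congrArg₂ (· + ·) h h')
  | tmul y z =>
    rw [in23_tmul, ← mul_assoc, TensorProduct.assoc_symm_tmul]
    change (BP.inl (BPB (BB hq) hq) hq (BP.tm x 1) * BP.inl (BPB (BB hq) hq) hq (BP.tm 1 y)) * _ = _
    rw [← map_mul, ← BP.tm_eq]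
    exact (BP.tm_eq (M := BPB (BB hq) hq) (hq := hq) (BP.tm x y) z).symm

theorem inl_gam (n : BR q) :
    (BPB (BB hq) hq).g (BP.inl (BB hq) hq n) = BP.inl (BB hq) hq (gam hq n) :=
  ((inl_intertwines (BB hq) hq).map_g n).symm

theorem inl_gam' (n : BR q) :
    (BPB (BB hq) hq).g' (BP.inl (BB hq) hq n) = BP.inl (BB hq) hq (gam' hq n) :=
  ((inl_intertwines (BB hq) hq).map_g' n).symm

theorem inl_del (n : BR q) :
    (BPB (BB hq) hq).d (BP.inl (BB hq) hq n) = BP.inl (BB hq) hq (del hq n) :=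
  ((inl_intertwines (BB hq) hq).map_d n).symm

theorem in3_a_mul_in1 (n : BR q) : in3 hq 𝐚 * in1 hq n =
    in1 hq n * in3 hq 𝐚 + in1 hq (del hq n) * in3 hq 𝐜 := by
  have h := BP.inr_a_mul_inl (M := BPB (BB hq) hq) (hq := hq) (BP.inl (BB hq) hq n)
  rwa [inl_del] at h

theorem in3_b_mul_in1 (n : BR q) : in3 hq 𝐛 * in1 hq n =
    in1 hq (gam' hq n) * in3 hq 𝐛 + in1 hq (del hq (gam' hq n)) * in3 hq 𝐰
      - in1 hq (del hq (del hq (gam' hq n))) * in3 hq 𝐜 := by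
  have h := BP.inr_b_mul_inl (M := BPB (BB hq) hq) (hq := hq) (BP.inl (BB hq) hq n)
  rwa [inl_gam', inl_del, inl_del] at h

theorem in3_c_mul_in1 (n : BR q) : in3 hq 𝐜 * in1 hq n = in1 hq (gam hq n) * in3 hq 𝐜 := by
  have h := BP.inr_c_mul_inl (M := BPB (BB hq) hq) (hq := hq) (BP.inl (BB hq) hq n)
  rwa [inl_gam] at h

theorem in3_p_mul_in1 (n : BR q) : in3 hq 𝐩 * in1 hq n = in1 hq n * in3 hq 𝐩 :=
  BP.inr_p_mul_inl (M := BPB (BB hq) hq) (hq := hq) (BP.inl (BB hq) hq n)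

theorem in2_a_mul_in1 (n : BR q) : in2 hq 𝐚 * in1 hq n =
    in1 hq n * in2 hq 𝐚 + in1 hq (del hq n) * in2 hq 𝐜 := by
  have h := congrArg (BP.inl (BPB (BB hq) hq) hq) (BP.inr_a_mul_inl (M := BB hq) (hq := hq) n)
  rwa [map_add, map_mul, map_mul, map_mul] at h

theorem in2_b_mul_in1 (n : BR q) : in2 hq 𝐛 * in1 hq n =
    in1 hq (gam' hq n) * in2 hq 𝐛 + in1 hq (del hq (gam' hq n)) * in2 hq 𝐰
      - in1 hq (del hq (del hq (gam' hq n))) * in2 hq 𝐜 := by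
  have h := congrArg (BP.inl (BPB (BB hq) hq) hq) (BP.inr_b_mul_inl (M := BB hq) (hq := hq) n)
  rwa [map_sub, map_add, map_mul, map_mul, map_mul, map_mul] at h

theorem in2_c_mul_in1 (n : BR q) : in2 hq 𝐜 * in1 hq n = in1 hq (gam hq n) * in2 hq 𝐜 := by
  have h := congrArg (BP.inl (BPB (BB hq) hq) hq) (BP.inr_c_mul_inl (M := BB hq) (hq := hq) n)
  rwa [map_mul, map_mul] at h

theorem in2_p_mul_in1 (n : BR q) : in2 hq 𝐩 * in1 hq n = in1 hq n * in2 hq 𝐩 := by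
  have h := congrArg (BP.inl (BPB (BB hq) hq) hq) (BP.inr_p_mul_inl (M := BB hq) (hq := hq) n)
  rwa [map_mul, map_mul] at h

/-- The embedding of the last two factors as a linear map on the tensor square. -/
def in23L : BR q ⊗[ℂ] BR q →ₗ[ℂ] BP3 hq := (in23 hq).toLinearMap

theorem in23L_tmul (x y : BR q) : in23L hq (x ⊗ₜ y) = in2 hq x * in3 hq y := in23_tmul hq x y

theorem comul23_a : comul23 hq 𝐚 = in2 hq 𝐚 * in3 hq 𝐚 + in2 hq 𝐛 * in3 hq 𝐜 := by
  have h : comul23 hq 𝐚 = in23L hq (comulA q) := congrArg (in23 hq) (comul_a hq)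
  rw [h, comulA]
  simp only [map_add, in23L_tmul]

theorem comul23_b : comul23 hq 𝐛 = in2 hq 𝐚 * in3 hq 𝐛 - 𝐬⁻¹ • (in2 hq 𝐛 * in3 hq 𝐚)
    + in2 hq 𝐛 * in3 hq 𝐩 := by
  have h : comul23 hq 𝐛 = in23L hq (comulB q) := congrArg (in23 hq) (comul_b hq)
  rw [h, comulB]
  simp only [map_add, map_sub, map_smul, in23L_tmul]

theorem comul23_c : comul23 hq 𝐜 = in2 hq 𝐜 * in3 hq 𝐚 - 𝐬⁻¹ • (in2 hq 𝐚 * in3 hq 𝐜)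
    + in2 hq 𝐩 * in3 hq 𝐜 := by
  have h : comul23 hq 𝐜 = in23L hq (comulC q) := congrArg (in23 hq) (comul_c hq)
  rw [h, comulC]
  simp only [map_add, map_sub, map_smul, in23L_tmul]

theorem comul23_p : comul23 hq 𝐩 = (𝐬⁻¹ + 𝐬⁻¹ ^ 2) • (in2 hq 𝐚 * in3 hq 𝐚)
    + 𝐬⁻¹ • (in2 hq 𝐛 * in3 hq 𝐜) + in2 hq 𝐜 * in3 hq 𝐛 - 𝐬⁻¹ • (in2 hq 𝐩 * in3 hq 𝐚)
    - 𝐬⁻¹ • (in2 hq 𝐚 * in3 hq 𝐩) + in2 hq 𝐩 * in3 hq 𝐩 := by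
  have h : comul23 hq 𝐩 = in23L hq (comulP q) := congrArg (in23 hq) (comul_p hq)
  rw [h, comulP]
  simp only [map_add, map_sub, map_smul, in23L_tmul]

theorem in1_mul_comul23 (x y : BR q) : in1 hq x * comul23 hq y = co23 (Del hq) (x ⊗ₜ y) :=
  in1_mul_in23 hq x _

/-- The coproducts of the generators satisfy the same cross relations with the first tensor factor
as the generators themselves; this and the three following lemmas express naturality of the
braiding for `Δ` in the first argument. -/
theorem comul23_a_mul_in1 (n : BR q) : comul23 hq 𝐚 * in1 hq n =
    in1 hq n * comul23 hq 𝐚 + in1 hq (del hq n) * comul23 hq 𝐜 := by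
  have hs := sq_ne_zero hq
  have h2 : ∀ x, del hq (gam' hq x) = 𝐬⁻¹ • gam' hq (del hq x) := (BB hq).d_g' hq
  simp only [comul23_a, comul23_c, add_mul, mul_assoc, in3_a_mul_in1, in3_c_mul_in1, mul_add,
    mul_sub]
  simp only [← mul_assoc, in2_a_mul_in1, in2_b_mul_in1, add_mul, sub_mul, gam'_gam, BR.w,
    mul_smul_comm, smul_mul_assoc, map_sub, map_smul, mul_sub]
  match_scalars <;> field_simp <;> ring

theorem comul23_b_mul_in1 (n : BR q) : comul23 hq 𝐛 * in1 hq n =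
    in1 hq (gam' hq n) * comul23 hq 𝐛
      + in1 hq (del hq (gam' hq n)) * comul23 hq 𝐰
      - in1 hq (del hq (del hq (gam' hq n))) * comul23 hq 𝐜 := by
  have hs := sq_ne_zero hq
  have h2 : ∀ x, del hq (gam' hq x) = 𝐬⁻¹ • gam' hq (del hq x) := (BB hq).d_g' hq
  simp only [BR.w, map_sub, map_smul, comul23_a, comul23_b, comul23_c, comul23_p, add_mul, sub_mul,
    smul_mul_assoc, mul_assoc, in3_a_mul_in1, in3_b_mul_in1, in3_p_mul_in1, mul_add, mul_sub]
  simp only [← mul_assoc, in2_a_mul_in1, in2_b_mul_in1, add_mul, sub_mul, BR.w, mul_smul_comm,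
    smul_mul_assoc, map_sub, map_smul, mul_sub, h2, mul_add]
  match_scalars <;> field_simp <;> ring

theorem comul23_c_mul_in1 (n : BR q) : comul23 hq 𝐜 * in1 hq n =
    in1 hq (gam hq n) * comul23 hq 𝐜 := by
  have hs := sq_ne_zero hq
  have h2 : ∀ x, del hq (gam' hq x) = 𝐬⁻¹ • gam' hq (del hq x) := (BB hq).d_g' hq
  simp only [comul23_c, add_mul, sub_mul, smul_mul_assoc, mul_assoc, in3_a_mul_in1, in3_c_mul_in1,
    mul_add, mul_sub]
  simp only [← mul_assoc, in2_a_mul_in1, in2_c_mul_in1, in2_p_mul_in1, add_mul, mul_smul_comm,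
    smul_mul_assoc, map_smul, del_gam]
  match_scalars <;> field_simp <;> ring

theorem comul23_p_mul_in1 (n : BR q) : comul23 hq 𝐩 * in1 hq n =
    in1 hq n * comul23 hq 𝐩 := by
  have hs := sq_ne_zero hq
  have h2 : ∀ x, del hq (gam' hq x) = 𝐬⁻¹ • gam' hq (del hq x) := (BB hq).d_g' hq
  simp only [BR.w, map_sub, map_smul, comul23_p, add_mul, sub_mul, smul_mul_assoc, mul_assoc,
    in3_a_mul_in1, in3_b_mul_in1, in3_c_mul_in1, in3_p_mul_in1, mul_add, mul_sub]
  simp only [← mul_assoc, in2_a_mul_in1, in2_b_mul_in1, in2_c_mul_in1, in2_p_mul_in1, add_mul,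
    sub_mul, gam_gam', gam'_gam, BR.w, mul_smul_comm, smul_mul_assoc, map_sub, map_smul, mul_sub,
    h2]
  match_scalars <;> field_simp <;> ring

/-- The identity map from the tensor cube, as a space, to the tensor cube, as an algebra. -/
def toBP3 : (BR q ⊗[ℂ] BR q) ⊗[ℂ] BR q →ₗ[ℂ] BP3 hq :=
  (LinearMap.id : (BR q ⊗[ℂ] BR q) ⊗[ℂ] BR q →ₗ[ℂ] (BR q ⊗[ℂ] BR q) ⊗[ℂ] BR q)

theorem toBP3_tmul (t : BR q ⊗[ℂ] BR q) (x : BR q) : toBP3 hq (t ⊗ₜ x) =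
    BP.inl (BPB (BB hq) hq) hq (t : BR q ⊗[ℂ] BR q) * in3 hq x :=
  BP.tm_eq (M := BPB (BB hq) hq) (hq := hq) t x

theorem toBP3_co23 (x y : BR q) :
    toBP3 hq (co23 (Del hq) (x ⊗ₜ y)) = in1 hq x * comul23 hq y :=
  (in1_mul_comul23 hq x y).symm

/-- The map `id ⊗ Δ` turns left multiplication by `1 ⊗ x` into left multiplication by
`1 ⊗ Δ(x)`. -/
theorem toBP3_co23_T (x : BR q) (t : BR q ⊗[ℂ] BR q) :
    toBP3 hq (co23 (Del hq) ((BB hq).T hq x t)) =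
      comul23 hq x * toBP3 hq (co23 (Del hq) t) := by
  revert t
  refine BR.ind (P := fun x => ∀ t, toBP3 hq (co23 (Del hq) ((BB hq).T hq x t)) =
    comul23 hq x * toBP3 hq (co23 (Del hq) t)) ?_ ?_ ?_ ?_ ?_ ?_ ?_ ?_ x
  · intro t; rw [map_one, map_one, one_mul]; rfl
  · intro r x h t
    simp only [map_smul, smul_mul_assoc, ← h, LinearMap.smul_apply]
  · intro x y hx hy t
    simp only [map_add, add_mul, ← hx, ← hy, LinearMap.add_apply]
  · intro x y hx hy t
    rw [map_mul, Module.End.mul_apply, hx, hy, map_mul, mul_assoc]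
  all_goals
    intro t
    induction t using TensorProduct.induction_on with
    | zero => simp only [map_zero, mul_zero]
    | add t t' h h' => simp only [map_add, h, h', mul_add]
    | tmul n v =>
      have hB1 : (BB hq).g = gam hq := rfl
      have hB2 : (BB hq).g' = gam' hq := rfl
      have hB3 : (BB hq).d = del hq := rfl
      simp only [BorelAlg.T_a, BorelAlg.T_b, BorelAlg.T_c, BorelAlg.T_p, BorelAlg.Ta_tmul,
        BorelAlg.Tb_tmul, BorelAlg.Tc_tmul, BorelAlg.Tp_tmul, map_add, map_sub, toBP3_co23, map_mul,
        ← mul_assoc, comul23_a_mul_in1, comul23_b_mul_in1, comul23_c_mul_in1, comul23_p_mul_in1,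
        add_mul, sub_mul, hB1, hB2, hB3]

/-- The map `1 ⊗ Δ` is multiplicative for the braided products. -/
theorem toBP3_co23_rho (s t : BR q ⊗[ℂ] BR q) :
    toBP3 hq (co23 (Del hq) ((BB hq).rho hq s t)) =
      toBP3 hq (co23 (Del hq) s) * toBP3 hq (co23 (Del hq) t) := by
  have hl : ∀ n t, toBP3 hq (co23 (Del hq) (BorelAlg.lmul q n t)) =
      in1 hq n * toBP3 hq (co23 (Del hq) t) := by
    intro n t
    induction t using TensorProduct.induction_on with
    | zero => simp only [map_zero, mul_zero]
    | add t t' h h' => simp only [map_add, h, h', mul_add]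
    | tmul m x => rw [BorelAlg.lmul_tmul, toBP3_co23, toBP3_co23, map_mul, mul_assoc]
  induction s using TensorProduct.induction_on with
  | zero => simp only [map_zero, zero_mul, LinearMap.zero_apply]
  | add s s' h h' => simp only [map_add, LinearMap.add_apply, h, h', add_mul]
  | tmul n x =>
    rw [BorelAlg.rho_tmul, Module.End.mul_apply, hl, toBP3_co23_T, toBP3_co23, mul_assoc]

/-- Both sides are algebra maps into the braided tensor cube, so that coassociativity has to be
checked on generators only. -/
theorem Del_coassoc : co23 (Del hq) ∘ₗ Del hq = co12 (Del hq) ∘ₗ Del hq := by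
  have hs := sq_ne_zero hq
  ext x
  simp only [LinearMap.comp_apply]
  have h12 : ∀ t u, toBP3 hq (co12 (Del hq) ((BB hq).rho hq t u)) =
      toBP3 hq (co12 (Del hq) t) * toBP3 hq (co12 (Del hq) u) :=
    map_mul (BP.map hq (comul hq) (comul_intertwines hq))
  refine BR.ind (P := fun x => co23 (Del hq) (Del hq x) = co12 (Del hq) (Del hq x))
    ?_ ?_ ?_ ?_ ?_ ?_ ?_ ?_ x
  · rw [Del_one, co23_apply, co12_apply, Del_one]; rfl
  · intro r x h; simp only [map_smul, h]
  · intro x y hx hy; simp only [map_add, hx, hy]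
  · intro x y hx hy
    rw [Del_mul]
    refine (toBP3_co23_rho hq _ _).trans ?_
    rw [hx, hy]
    exact (h12 _ _).symm
  all_goals
    simp only [Del_a, Del_b, Del_c, Del_p, comulA, comulB, comulC, comulP, map_add, map_sub,
      map_smul, co12_apply, co23_apply, TensorProduct.tmul_add, TensorProduct.add_tmul,
      TensorProduct.tmul_sub, TensorProduct.sub_tmul, TensorProduct.tmul_smul,
      ← TensorProduct.smul_tmul', TensorProduct.assoc_symm_tmul]
    match_scalars <;> field_simp <;> ring

/-- The braiding of a tensor product past `n`, as a product in the tensor cube. -/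
theorem on12_on23_psi (t : BR q ⊗[ℂ] BR q) (n : BR q) :
    toBP3 hq (on12 (psi hq) (on23 (psi hq) (t ⊗ₜ n))) = in23L hq t * in1 hq n := by
  induction t using TensorProduct.induction_on with
  | zero => simp only [TensorProduct.zero_tmul, map_zero, zero_mul]
  | add s s' h h' => simp only [TensorProduct.add_tmul, map_add, h, h', add_mul]
  | tmul y z =>
    have h3 : in3 hq z * in1 hq n =
        toBP3 hq (((TensorProduct.mk ℂ (BR q) (BR q)).flip 1).rTensor (BR q)
          ((BB hq).T hq z (n ⊗ₜ 1))) := by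
      refine (BP.inr_mul_inl (M := BPB (BB hq) hq) z (BP.inl (BB hq) hq n)).trans ?_
      exact ((inl_intertwines (BB hq) hq).T_natural hq z (n ⊗ₜ 1)).symm
    rw [in23L_tmul, mul_assoc, h3, ← TensorProduct.assoc_symm_tmul, on23_symm, psi_tmul]
    generalize (BB hq).T hq z (n ⊗ₜ 1) = s
    induction s using TensorProduct.induction_on with
    | zero => simp only [TensorProduct.tmul_zero, map_zero, mul_zero]
    | add s s' h h' => simp only [TensorProduct.tmul_add, map_add, h, h', mul_add]
    | tmul m w =>
      rw [TensorProduct.assoc_symm_tmul, on12_tmul, psi_tmul, toBP3_tmul]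
      have h1 : toBP3 hq (((TensorProduct.mk ℂ (BR q) (BR q)).flip 1).rTensor (BR q) (m ⊗ₜ w)) =
          in1 hq m * in3 hq w := BP.tm_eq (M := BPB (BB hq) hq) _ _
      have h2 : in2 hq y * in1 hq m =
          BP.inl (BPB (BB hq) hq) hq ((BB hq).T hq y (m ⊗ₜ 1) : BR q ⊗[ℂ] BR q) := by
        rw [← BP.inr_mul_inl, map_mul]; rfl
      rw [h1, ← mul_assoc, h2]

theorem psi_comul_left :
    co23 (Del hq) ∘ₗ psi hq = on12 (psi hq) ∘ₗ on23 (psi hq) ∘ₗ co12 (Del hq) := by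
  refine TensorProduct.ext' fun x n => ?_
  simp only [LinearMap.comp_apply]
  rw [co12_apply, psi_tmul]
  refine (toBP3_co23_T hq x _).trans ?_
  rw [toBP3_co23, map_one, mul_one]
  exact (on12_on23_psi hq (Del hq x) n).symm

end

end

section

/-! ### Uniqueness of convolution inverses -/

/-- A left and a right convolution inverse of the same map agree. -/
theorem convolution_inverse_unique {Δ : BR q →ₗ[ℂ] BR q ⊗[ℂ] BR q} {ε : BR q →ₗ[ℂ] ℂ}
    (hc : co23 Δ ∘ₗ Δ = co12 Δ ∘ₗ Δ)
    (hl : ∀ x, TensorProduct.lid ℂ (BR q) (ε.rTensor (BR q) (Δ x)) = x)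
    (hr : ∀ x, TensorProduct.rid ℂ (BR q) (ε.lTensor (BR q) (Δ x)) = x)
    {A : Type} [Ring A] [Algebra ℂ A] {f u g : BR q →ₗ[ℂ] A}
    (h1 : LinearMap.mul' ℂ A ∘ₗ TensorProduct.map f u ∘ₗ Δ = Algebra.linearMap ℂ A ∘ₗ ε)
    (h2 : LinearMap.mul' ℂ A ∘ₗ TensorProduct.map u g ∘ₗ Δ = Algebra.linearMap ℂ A ∘ₗ ε) :
    f = g := by
  let _ : Coalgebra ℂ (BR q) :=
    { comul := Δ
      counit := ε
      coassoc := by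
        ext x
        have h := LinearMap.congr_fun hc x
        simp only [LinearMap.comp_apply] at h ⊢
        refine (congrArg (asc q) h).symm.trans ?_
        exact (asc q).apply_symm_apply _
      rTensor_counit_comp_comul := by
        ext x
        refine (TensorProduct.lid ℂ (BR q)).injective ((hl x).trans ?_)
        simp
      lTensor_counit_comp_comul := by
        ext x
        refine (TensorProduct.rid ℂ (BR q)).injective ((hr x).trans ?_)
        simp }
  have e1 : WithConv.toConv f * WithConv.toConv u = 1 := congrArg WithConv.toConv h1
  have e2 : WithConv.toConv u * WithConv.toConv g = 1 := congrArg WithConv.toConv h2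
  exact WithConv.toConv_injective (left_inv_eq_right_inv e1 e2)

section
variable (hq : q ≠ 0)

/-! ### The counit -/

theorem counit_relations (hq : q ≠ 0) : Relations q (1 : ℂ) 0 0 (1 + 𝐬⁻¹) := by
  have hs := sq_ne_zero hq
  constructor <;> (try simp only [smul_eq_mul]) <;> try (field_simp <;> ring)

/-- The counit. -/
def eps : BR q →ₐ[ℂ] ℂ := BR.liftP hq (counit_relations hq)

theorem eps_a : eps hq 𝐚 = 1 := BR.liftP_a ..
theorem eps_b : eps hq 𝐛 = 0 := BR.liftP_b ..
theorem eps_c : eps hq 𝐜 = 0 := BR.liftP_c ..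
theorem eps_p : eps hq 𝐩 = 1 + 𝐬⁻¹ := BR.liftP_p ..
theorem eps_w : eps hq 𝐰 = 0 := by simp [BR.w, eps_a, eps_p]

theorem eps_gam (x : BR q) : eps hq (gam hq x) = eps hq x :=
  BR.hom_ext (f := (eps hq).comp (gam hq)) (g := eps hq) (by simp [gam_a]) (by simp [gam_b, eps_b])
    (by simp [gam_c, eps_c]) (by simp [gam_p]) x

theorem eps_gam' (x : BR q) : eps hq (gam' hq x) = eps hq x := by
  rw [← eps_gam, gam_gam']

theorem eps_del (x : BR q) : eps hq (del hq x) = 0 := by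
  refine BR.ind (P := fun x => eps hq (del hq x) = 0) ?_ ?_ ?_ ?_ ?_ ?_ ?_ ?_ x
  · rw [del_one, map_zero]
  · intro r x h; rw [map_smul, map_smul, h, smul_zero]
  · intro x y hx hy; rw [map_add, map_add, hx, hy, add_zero]
  · intro x y hx hy; rw [del_mul, map_add, map_mul, map_mul, hx, hy, mul_zero, zero_mul, add_zero]
  · simp [del_a, eps_b]
  · simp [del_b]
  · simp [del_c, eps_w]
  · simp [del_p]

/-- The map `n ⊗ x ↦ ε(x) n`. -/
def epsR : BR q ⊗[ℂ] BR q →ₗ[ℂ] BR q :=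
  (TensorProduct.rid ℂ (BR q)).toLinearMap ∘ₗ (eps hq).toLinearMap.lTensor (BR q)

/-- The map `n ⊗ x ↦ ε(n) x`. -/
def epsL : BR q ⊗[ℂ] BR q →ₗ[ℂ] BR q :=
  (TensorProduct.lid ℂ (BR q)).toLinearMap ∘ₗ (eps hq).toLinearMap.rTensor (BR q)

theorem epsR_tmul (n x : BR q) : epsR hq (n ⊗ₜ x) = eps hq x • n := rfl
theorem epsL_tmul (n x : BR q) : epsL hq (n ⊗ₜ x) = eps hq n • x := rfl

theorem epsR_T (x : BR q) (t : BR q ⊗[ℂ] BR q) :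
    epsR hq ((BB hq).T hq x t) = eps hq x • epsR hq t := by
  revert t
  refine BR.ind (P := fun x => ∀ t, epsR hq ((BB hq).T hq x t) = eps hq x • epsR hq t)
    ?_ ?_ ?_ ?_ ?_ ?_ ?_ ?_ x
  · simp
  · intro r x h t; simp [h, smul_smul]
  · intro x y hx hy t; simp [hx, hy, add_smul]
  · intro x y hx hy t; simp [hx, hy, smul_smul]
  all_goals
    intro t
    induction t using TensorProduct.induction_on with
    | zero => simp
    | add t t' h h' => simp only [map_add, h, h', smul_add]
    | tmul n v =>
      simp [BorelAlg.T_a, BorelAlg.T_b, BorelAlg.T_c, BorelAlg.T_p, BorelAlg.Ta_tmul,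
        BorelAlg.Tb_tmul, BorelAlg.Tc_tmul, BorelAlg.Tp_tmul, epsR_tmul, eps_a, eps_b, eps_c, eps_p,
        eps_w, mul_smul]

theorem epsL_T (x : BR q) (t : BR q ⊗[ℂ] BR q) :
    epsL hq ((BB hq).T hq x t) = x * epsL hq t := by
  have h1 : ∀ x, eps hq ((BB hq).g x) = eps hq x := eps_gam hq
  have h2 : ∀ x, eps hq ((BB hq).g' x) = eps hq x := eps_gam' hq
  have h3 : ∀ x, eps hq ((BB hq).d x) = 0 := eps_del hq
  revert t
  refine BR.ind (P := fun x => ∀ t, epsL hq ((BB hq).T hq x t) = x * epsL hq t)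
    ?_ ?_ ?_ ?_ ?_ ?_ ?_ ?_ x
  · simp
  · intro r x h t; simp [h]
  · intro x y hx hy t; simp [hx, hy, add_mul]
  · intro x y hx hy t; simp [hx, hy, mul_assoc]
  all_goals
    intro t
    induction t using TensorProduct.induction_on with
    | zero => simp
    | add t t' h h' => simp only [map_add, h, h', mul_add]
    | tmul n v =>
      simp [BorelAlg.T_a, BorelAlg.T_b, BorelAlg.T_c, BorelAlg.T_p, BorelAlg.Ta_tmul,
        BorelAlg.Tb_tmul, BorelAlg.Tc_tmul, BorelAlg.Tp_tmul, epsL_tmul, h1, h2, h3]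

theorem epsR_rho (s t : BR q ⊗[ℂ] BR q) :
    epsR hq ((BB hq).rho hq s t) = epsR hq s * epsR hq t := by
  have hl : ∀ n t, epsR hq (BorelAlg.lmul q n t) = n * epsR hq t := by
    intro n t
    induction t using TensorProduct.induction_on with
    | zero => simp
    | add t t' h h' => simp only [map_add, h, h', mul_add]
    | tmul m x => simp [epsR_tmul]
  induction s using TensorProduct.induction_on with
  | zero => simp
  | add s s' h h' => simp only [map_add, LinearMap.add_apply, h, h', add_mul]
  | tmul n x =>
    rw [BorelAlg.rho_tmul, Module.End.mul_apply, hl, epsR_T, epsR_tmul, smul_mul_assoc,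
      mul_smul_comm]

theorem epsL_rho (s t : BR q ⊗[ℂ] BR q) :
    epsL hq ((BB hq).rho hq s t) = epsL hq s * epsL hq t := by
  have hl : ∀ n t, epsL hq (BorelAlg.lmul q n t) = eps hq n • epsL hq t := by
    intro n t
    induction t using TensorProduct.induction_on with
    | zero => simp
    | add t t' h h' => simp only [map_add, h, h', smul_add]
    | tmul m x => simp [epsL_tmul, mul_smul]
  induction s using TensorProduct.induction_on with
  | zero => simp
  | add s s' h h' => simp only [map_add, LinearMap.add_apply, h, h', add_mul]
  | tmul n x =>
    rw [BorelAlg.rho_tmul, Module.End.mul_apply, hl, epsL_T, epsL_tmul, smul_mul_assoc]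

theorem epsR_Del (x : BR q) : epsR hq (Del hq x) = x := by
  have hs := sq_ne_zero hq
  refine BR.ind (P := fun x => epsR hq (Del hq x) = x) ?_ ?_ ?_ ?_ ?_ ?_ ?_ ?_ x
  · rw [Del_one, epsR_tmul, map_one, one_smul]
  · intro r x h; rw [map_smul, map_smul, h]
  · intro x y hx hy; rw [map_add, map_add, hx, hy]
  · intro x y hx hy; rw [Del_mul, epsR_rho, hx, hy]
  all_goals
    simp only [Del_a, Del_b, Del_c, Del_p, comulA, comulB, comulC, comulP, map_add, map_sub,
      map_smul, epsR_tmul, eps_a, eps_b, eps_c, eps_p]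
    match_scalars <;> field_simp <;> ring

theorem epsL_Del (x : BR q) : epsL hq (Del hq x) = x := by
  have hs := sq_ne_zero hq
  refine BR.ind (P := fun x => epsL hq (Del hq x) = x) ?_ ?_ ?_ ?_ ?_ ?_ ?_ ?_ x
  · rw [Del_one, epsL_tmul, map_one, one_smul]
  · intro r x h; rw [map_smul, map_smul, h]
  · intro x y hx hy; rw [map_add, map_add, hx, hy]
  · intro x y hx hy; rw [Del_mul, epsL_rho, hx, hy]
  all_goals
    simp only [Del_a, Del_b, Del_c, Del_p, comulA, comulB, comulC, comulP, map_add, map_sub,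
      map_smul, epsL_tmul, eps_a, eps_b, eps_c, eps_p]
    match_scalars <;> field_simp <;> ring

end

end

section

section
variable (hq : q ≠ 0)

/-! ### The antipode -/

/-- The algebra `B(R)` with the braided opposite product `x ∘ y = m ψ(x ⊗ y)`. -/
def BOp (_ : q ≠ 0) : Type := BR q

instance : AddCommGroup (BOp hq) := inferInstanceAs (AddCommGroup (BR q))

instance : Module ℂ (BOp hq) := inferInstanceAs (Module ℂ (BR q))

/-- The braided opposite product. -/
def mulOp : BR q →ₗ[ℂ] BR q →ₗ[ℂ] BR q := TensorProduct.curry (mu q ∘ₗ psi hq)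

theorem mulOp_apply (x y : BR q) : mulOp hq x y = mu q (psi hq (x ⊗ₜ y)) := rfl

theorem psi_mul_left_apply (t : BR q ⊗[ℂ] BR q) (y : BR q) :
    psi hq (mu q t ⊗ₜ y) = m23 q (on12 (psi hq) (on23 (psi hq) (t ⊗ₜ y))) :=
  LinearMap.congr_fun (psi_mul_left hq) (t ⊗ₜ y)

theorem psi_mul_right_apply (x : BR q) (t : BR q ⊗[ℂ] BR q) :
    psi hq (x ⊗ₜ mu q t) = m12 q (on23 (psi hq) (on12 (psi hq) ((asc q).symm (x ⊗ₜ t)))) := by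
  have h := LinearMap.congr_fun (psi_mul_right hq) ((asc q).symm (x ⊗ₜ t))
  simp only [LinearMap.comp_apply] at h
  rw [← h]
  simp [m23]

theorem mu_m23 : mu q ∘ₗ m23 q = mu q ∘ₗ m12 q := by
  refine TensorProduct.ext_threefold fun x y z => ?_
  simp only [LinearMap.comp_apply, m12_tmul, m23_tmul, BorelAlg.rmul_tmul, LinearMap.mul'_apply,
    mul_assoc]

theorem mulOp_assoc (x y z : BR q) :
    mulOp hq (mulOp hq x y) z = mulOp hq x (mulOp hq y z) := by
  have h1 := LinearMap.congr_fun (psi_yang_baxter hq) ((x ⊗ₜ y) ⊗ₜ z)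
  have h2 := LinearMap.congr_fun (mu_m23 (q := q))
  simp only [LinearMap.comp_apply] at h1 h2
  rw [mulOp_apply, mulOp_apply, psi_mul_left_apply, mulOp_apply, mulOp_apply, psi_mul_right_apply,
    h2, ← on12_tmul, h1, ← on23_symm, TensorProduct.assoc_symm_tmul]

instance : Ring (BOp hq) where
  __ := (inferInstance : AddCommGroup (BOp hq))
  mul x y := mulOp hq x y
  one := (1 : BR q)
  mul_assoc := mulOp_assoc hq
  one_mul x := by
    change mu q (psi hq ((1 : BR q) ⊗ₜ (show BR q from x))) = _
    rw [psi_one_tmul, LinearMap.mul'_apply, mul_one]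
  mul_one x := by
    change mu q (psi hq ((show BR q from x) ⊗ₜ (1 : BR q))) = _
    rw [psi_tmul_one, LinearMap.mul'_apply, one_mul]
  left_distrib x y z := map_add (mulOp hq x) y z
  right_distrib x y z := LinearMap.map_add₂ (mulOp hq) x y z
  zero_mul x := LinearMap.map_zero₂ (mulOp hq) x
  mul_zero x := map_zero (mulOp hq x)

instance : Algebra ℂ (BOp hq) :=
  Algebra.ofModule (fun r x y => LinearMap.map_smul₂ (mulOp hq) r x y)
    (fun r x y => map_smul (mulOp hq x) r y)

theorem antipode_relations : Relations q (A := BOp hq)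
    (𝐬 • (𝐩 - 𝐚) : BR q) (-(𝐬 • 𝐛) : BR q) (-(𝐬 • 𝐜) : BR q) (𝐩 : BR q) := by
  have hs := sq_ne_zero hq
  have h := BR.relations hq
  have hB1 : (BB hq).g = gam hq := rfl
  have hB2 : (BB hq).g' = gam' hq := rfl
  have hB3 : (BB hq).d = del hq := rfl
  -- the relations, written in the underlying space `B(R)`
  have key : let R := mulOp hq
      let A := 𝐬 • (𝐩 - 𝐚)
      let B := -(𝐬 • 𝐛)
      let C := -(𝐬 • 𝐜)
      let P := 𝐩
      R B A = 𝐬 • R A B ∧ R C A = 𝐬⁻¹ • R A C ∧ R P A = R A P ∧ R P B = R B P ∧ R P C = R C P ∧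
      R C B = 𝐬⁻¹ • R A P - 𝐬⁻¹ ^ 2 • R A A - 𝐬⁻¹ • 1 ∧ R B C = R A P - R A A - 𝐬⁻¹ • 1 := by
    refine ⟨?_, ?_, ?_, ?_, ?_, ?_, ?_⟩ <;>
    · simp only [map_add, map_sub, map_smul, map_neg, LinearMap.neg_apply, LinearMap.sub_apply,
        LinearMap.smul_apply, mulOp_apply, psi_tmul, BorelAlg.T_a, BorelAlg.T_b, BorelAlg.T_c,
        BorelAlg.T_p, BorelAlg.Ta_tmul, BorelAlg.Tb_tmul, BorelAlg.Tc_tmul, BorelAlg.Tp_tmul, hB1,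
        hB2, hB3, gam_a, gam_b, gam_p, gam'_a, gam'_c, gam'_p, del_a, del_b, del_c, del_p, mul_one,
        map_zero, LinearMap.mul'_apply, zero_mul, BR.w, sub_mul, mul_sub, smul_mul_assoc,
        mul_smul_comm, h.ba, h.ca, h.pa, h.pb, h.pc, h.cb, h.bc]
      try (match_scalars <;> field_simp <;> ring)
  obtain ⟨h1, h2, h3, h4, h5, h6, h7⟩ := key
  exact ⟨h1, h2, h3, h4, h5, h6, h7⟩

/-- The antipode. -/
def ant : BR q →ₗ[ℂ] BR q := (BR.liftP hq (antipode_relations hq)).toLinearMap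

theorem ant_a : ant hq 𝐚 = 𝐬 • (𝐩 - 𝐚) := BR.liftP_a hq (antipode_relations hq)
theorem ant_b : ant hq 𝐛 = -(𝐬 • 𝐛) := BR.liftP_b hq (antipode_relations hq)
theorem ant_c : ant hq 𝐜 = -(𝐬 • 𝐜) := BR.liftP_c hq (antipode_relations hq)
theorem ant_p : ant hq 𝐩 = 𝐩 := BR.liftP_p hq (antipode_relations hq)
theorem ant_one : ant hq 1 = 1 := map_one (BR.liftP hq (antipode_relations hq))

theorem ant_mul (x y : BR q) : ant hq (x * y) = mu q (psi hq (ant hq x ⊗ₜ ant hq y)) :=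
  map_mul (BR.liftP hq (antipode_relations hq)) x y

theorem ant_w : ant hq 𝐰 = -(𝐬 • 𝐰) := by
  have hs := sq_ne_zero hq
  rw [BR.w, map_sub, map_smul, ant_a, ant_p]
  match_scalars <;> field_simp <;> ring

theorem mu_G (t : BR q ⊗[ℂ] BR q) : mu q ((BB hq).G hq t) = gam hq (mu q t) := by
  induction t using TensorProduct.induction_on with
  | zero => simp
  | add s s' h h' => simp only [map_add, h, h']
  | tmul x y => simp only [BorelAlg.G_tmul, LinearMap.mul'_apply, map_mul]; rfl

theorem mu_D (t : BR q ⊗[ℂ] BR q) : mu q ((BB hq).D hq t) = del hq (mu q t) := by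
  induction t using TensorProduct.induction_on with
  | zero => simp
  | add s s' h h' => simp only [map_add, h, h']
  | tmul x y => simp only [BorelAlg.D_tmul, map_add, LinearMap.mul'_apply, del_mul]; rfl

theorem ant_gam (x : BR q) : ant hq (gam hq x) = gam hq (ant hq x) := by
  refine BR.ind (P := fun x => ant hq (gam hq x) = gam hq (ant hq x)) ?_ ?_ ?_ ?_ ?_ ?_ ?_ ?_ x
  · simp [ant_one]
  · intro r x h; simp only [map_smul, h]
  · intro x y hx hy; simp only [map_add, hx, hy]
  · intro x y hx hy
    rw [map_mul, ant_mul, hx, hy, ant_mul, ← mu_G, ← psi_G]; rfl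
  all_goals
    simp only [gam_a, gam_b, gam_c, gam_p, ant_a, ant_b, ant_c, ant_p, map_smul, map_sub, map_neg,
      smul_neg, smul_comm 𝐬⁻¹ 𝐬]

theorem ant_del (x : BR q) : ant hq (del hq x) = del hq (ant hq x) := by
  refine BR.ind (P := fun x => ant hq (del hq x) = del hq (ant hq x)) ?_ ?_ ?_ ?_ ?_ ?_ ?_ ?_ x
  · simp [ant_one, del_one]
  · intro r x h; simp only [map_smul, h]
  · intro x y hx hy; simp only [map_add, hx, hy]
  · intro x y hx hy
    rw [del_mul, map_add, ant_mul, ant_mul, ant_mul, hx, hy, ant_gam, ← mu_D, ← psi_D,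
      BorelAlg.D_tmul, map_add, map_add]; rfl
  all_goals
    simp only [del_a, del_b, del_c, del_p, ant_a, ant_b, ant_w, ant_c, ant_p, map_smul, map_sub,
      map_neg, map_zero]
    try module

theorem ant_intertwines : Intertwines (BB hq) (BB hq) (ant hq) := ⟨ant_gam hq, ant_del hq⟩

/-- The braiding is natural for the antipode on its right argument. -/
theorem psi_tmul_ant (x y : BR q) :
    psi hq (x ⊗ₜ ant hq y) = (ant hq).rTensor (BR q) (psi hq (x ⊗ₜ y)) :=
  ((ant_intertwines hq).T_natural hq x (y ⊗ₜ 1)).symm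

/-- The braiding is natural for the antipode on its left argument. For products this follows from
the braid relation. -/
theorem psi_ant_tmul (x y : BR q) :
    psi hq (ant hq x ⊗ₜ y) = (ant hq).lTensor (BR q) (psi hq (x ⊗ₜ y)) := by
  revert y
  refine BR.ind (P := fun x => ∀ y, psi hq (ant hq x ⊗ₜ y) =
    (ant hq).lTensor (BR q) (psi hq (x ⊗ₜ y))) ?_ ?_ ?_ ?_ ?_ ?_ ?_ ?_ x
  · intro y
    rw [ant_one, psi_one_tmul, LinearMap.lTensor_tmul, ant_one]
  · intro r x h y; simp only [map_smul, ← TensorProduct.smul_tmul', h]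
  · intro x y hx hy z; simp only [map_add, TensorProduct.add_tmul, hx, hy]
  · intro x x' hx hx' y
    have h1 := LinearMap.congr_fun (psi_yang_baxter hq) ((ant hq x ⊗ₜ ant hq x') ⊗ₜ y)
    have h2 := psi_mul_left_apply hq (x ⊗ₜ x') y
    simp only [LinearMap.comp_apply] at h1 h2
    rw [LinearMap.mul'_apply] at h2
    rw [ant_mul, psi_mul_left_apply, ← on12_tmul, h1, h2, ← TensorProduct.assoc_symm_tmul,
      ← TensorProduct.assoc_symm_tmul, on23_symm, on23_symm, hx']
    generalize psi hq (x' ⊗ₜ y) = t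
    induction t using TensorProduct.induction_on with
    | zero => simp
    | add s s' h h' => simp only [map_add, TensorProduct.tmul_add, h, h']
    | tmul m z =>
      rw [LinearMap.lTensor_tmul, TensorProduct.assoc_symm_tmul, TensorProduct.assoc_symm_tmul,
        on12_tmul, on12_tmul, hx]
      generalize psi hq (x ⊗ₜ m) = u
      induction u using TensorProduct.induction_on with
      | zero => simp
      | add s s' h h' => simp only [map_add, TensorProduct.add_tmul, h, h']
      | tmul n w =>
        rw [LinearMap.lTensor_tmul, ← TensorProduct.assoc_symm_tmul, on23_symm, m23_tmul,
          BorelAlg.rmul_tmul, LinearMap.lTensor_tmul, ant_mul]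
        simp [m23]
  all_goals
    intro y
    simp only [ant_a, ant_b, ant_c, ant_p, ← TensorProduct.smul_tmul', TensorProduct.neg_tmul,
      TensorProduct.sub_tmul, map_smul, map_neg, map_sub, psi_tmul, BorelAlg.T_a, BorelAlg.T_b,
      BorelAlg.T_c, BorelAlg.T_p, BorelAlg.Ta_tmul, BorelAlg.Tb_tmul, BorelAlg.Tc_tmul,
      BorelAlg.Tp_tmul, mul_one, map_add, LinearMap.lTensor_tmul, ant_w, TensorProduct.tmul_smul,
      TensorProduct.tmul_neg, TensorProduct.tmul_sub]
    try module

end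

end

section

section
variable (hq : q ≠ 0)

/-! ### The antipode axioms -/

/-- The map `n ⊗ x ↦ n S(x)`. -/
def antR : BR q ⊗[ℂ] BR q →ₗ[ℂ] BR q := mu q ∘ₗ (ant hq).lTensor (BR q)

/-- The map `n ⊗ x ↦ S(n) x`. -/
def antL : BR q ⊗[ℂ] BR q →ₗ[ℂ] BR q := mu q ∘ₗ (ant hq).rTensor (BR q)

theorem antR_tmul (n x : BR q) : antR hq (n ⊗ₜ x) = n * ant hq x := rfl
theorem antL_tmul (n x : BR q) : antL hq (n ⊗ₜ x) = ant hq n * x := rfl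

theorem mu_lmul (n : BR q) (t : BR q ⊗[ℂ] BR q) : mu q (BorelAlg.lmul q n t) = n * mu q t := by
  induction t using TensorProduct.induction_on with
  | zero => simp
  | add s s' h h' => simp only [map_add, h, h', mul_add]
  | tmul m z => simp [mul_assoc]

theorem antR_lmul (n : BR q) (t : BR q ⊗[ℂ] BR q) :
    antR hq (BorelAlg.lmul q n t) = n * antR hq t := by
  induction t using TensorProduct.induction_on with
  | zero => simp
  | add s s' h h' => simp only [map_add, h, h', mul_add]
  | tmul m z => simp [antR_tmul, mul_assoc]

theorem antR_T (x : BR q) (t : BR q ⊗[ℂ] BR q) :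
    antR hq ((BB hq).T hq x t) = mu q (psi hq (ant hq x ⊗ₜ antR hq t)) := by
  induction t using TensorProduct.induction_on with
  | zero => simp
  | add s s' h h' => simp only [map_add, TensorProduct.tmul_add, h, h']
  | tmul n w =>
    have h1 : psi hq (ant hq x ⊗ₜ (n * ant hq w)) =
        (BB hq).rho hq (psi hq (ant hq x ⊗ₜ n)) (ant hq w ⊗ₜ 1) := by
      rw [psi_tmul, psi_tmul, ← BorelAlg.T_mul_lmul]; rfl
    rw [antR_tmul, h1, psi_ant_tmul, BorelAlg.T_tmul, psi_tmul]
    generalize (BB hq).T hq x (n ⊗ₜ 1) = u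
    induction u using TensorProduct.induction_on with
    | zero => simp
    | add s s' h h' => simp only [map_add, LinearMap.add_apply, h, h']
    | tmul m z =>
      rw [BorelAlg.rmul_tmul, antR_tmul, LinearMap.lTensor_tmul, BorelAlg.rho_tmul,
        Module.End.mul_apply, mu_lmul, ant_mul, psi_tmul]

/-- The identity `m (id ⊗ S) Δ = η ε` passes to products. -/
theorem antR_rho {t : BR q ⊗[ℂ] BR q} {r : ℂ} (h : antR hq t = r • 1) (s : BR q ⊗[ℂ] BR q) :
    antR hq ((BB hq).rho hq s t) = r • antR hq s := by
  induction s using TensorProduct.induction_on with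
  | zero => simp
  | add s s' h h' => simp only [map_add, LinearMap.add_apply, h, h', smul_add]
  | tmul n x =>
    rw [BorelAlg.rho_tmul, Module.End.mul_apply, antR_lmul, antR_T, h, TensorProduct.tmul_smul,
      map_smul, map_smul, psi_tmul_one, LinearMap.mul'_apply, one_mul, mul_smul_comm, antR_tmul]

/-- The identity `m (S ⊗ id) Δ = η ε` passes to products. -/
theorem antL_rho {s : BR q ⊗[ℂ] BR q} {r : ℂ} (h : antL hq s = r • 1) (t : BR q ⊗[ℂ] BR q) :
    antL hq ((BB hq).rho hq s t) = r • antL hq t := by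
  have h2 := LinearMap.congr_fun (mu_m23 (q := q))
  simp only [LinearMap.comp_apply] at h2
  have key : ∀ m w, antL hq ((BB hq).rho hq s (m ⊗ₜ w)) =
      mu q (psi hq (antL hq s ⊗ₜ ant hq m)) * w := by
    intro m w
    clear h
    induction s using TensorProduct.induction_on with
    | zero => simp
    | add s s' h h' =>
      simp only [map_add, LinearMap.add_apply, h, h', TensorProduct.add_tmul, add_mul]
    | tmul n x =>
      have h3 := psi_mul_left_apply hq (ant hq n ⊗ₜ x) (ant hq m)
      rw [LinearMap.mul'_apply] at h3
      rw [antL_tmul, h3, h2, ← TensorProduct.assoc_symm_tmul, on23_symm, psi_tmul_ant,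
        BorelAlg.rho_tmul, Module.End.mul_apply, BorelAlg.T_tmul, psi_tmul]
      generalize (BB hq).T hq x (m ⊗ₜ 1) = u
      induction u using TensorProduct.induction_on with
      | zero => simp
      | add s s' h h' => simp only [map_add, TensorProduct.tmul_add, h, h', add_mul]
      | tmul k z =>
        rw [BorelAlg.rmul_tmul, BorelAlg.lmul_tmul, antL_tmul, ant_mul, LinearMap.rTensor_tmul,
          TensorProduct.assoc_symm_tmul, on12_tmul]
        generalize psi hq (ant hq n ⊗ₜ ant hq k) = v
        have h4 : ∀ v, mu q (m12 q (v ⊗ₜ z)) = mu q v * z := fun v => rfl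
        rw [h4, mul_assoc]
  induction t using TensorProduct.induction_on with
  | zero => simp
  | add s s' h h' => simp only [map_add, h, h', smul_add]
  | tmul m w =>
    rw [key, h, ← TensorProduct.smul_tmul', map_smul, map_smul, psi_one_tmul,
      LinearMap.mul'_apply, mul_one, smul_mul_assoc, antL_tmul]

theorem antR_Del (x : BR q) : antR hq (Del hq x) = eps hq x • 1 := by
  have hs := sq_ne_zero hq
  have h := BR.relations hq
  refine BR.ind (P := fun x => antR hq (Del hq x) = eps hq x • 1) ?_ ?_ ?_ ?_ ?_ ?_ ?_ ?_ x
  · rw [Del_one, antR_tmul, map_one (eps hq), ant_one, one_mul, one_smul]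
  · intro r x h; rw [map_smul, map_smul, map_smul, h, smul_assoc]
  · intro x y hx hy; rw [map_add, map_add, map_add, hx, hy, add_smul]
  · intro x y hx hy; rw [Del_mul, antR_rho hq hy, hx, map_mul, smul_smul, mul_comm]
  all_goals
    simp only [Del_a, Del_b, Del_c, Del_p, comulA, comulB, comulC, comulP, map_add, map_sub,
      map_smul, antR_tmul, eps_a, eps_b, eps_c, eps_p, ant_a, ant_b, ant_c, ant_p, mul_sub, mul_neg,
      mul_smul_comm, h.ba, h.ca, h.pa, h.pc, h.cb, h.bc]
    match_scalars <;> field_simp <;> ring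

theorem antL_Del (x : BR q) : antL hq (Del hq x) = eps hq x • 1 := by
  have hs := sq_ne_zero hq
  have h := BR.relations hq
  refine BR.ind (P := fun x => antL hq (Del hq x) = eps hq x • 1) ?_ ?_ ?_ ?_ ?_ ?_ ?_ ?_ x
  · rw [Del_one, antL_tmul, map_one (eps hq), ant_one, one_mul, one_smul]
  · intro r x h; rw [map_smul, map_smul, map_smul, h, smul_assoc]
  · intro x y hx hy; rw [map_add, map_add, map_add, hx, hy, add_smul]
  · intro x y hx hy; rw [Del_mul, antL_rho hq hx, hy, map_mul, smul_smul]
  all_goals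
    simp only [Del_a, Del_b, Del_c, Del_p, comulA, comulB, comulC, comulP, map_add, map_sub,
      map_smul, antL_tmul, eps_a, eps_b, eps_c, eps_p, ant_a, ant_b, ant_c, ant_p, sub_mul, neg_mul,
      smul_mul_assoc, smul_sub, h.ba, h.ca, h.pa, h.pb, h.pc, h.cb, h.bc]
    match_scalars <;> field_simp <;> ring

/-! ### The antipode and the coproduct -/

/-- The map `(m ⊗ u) ⊗ v ↦ S(m) ⊗ u S(v)`. -/
def antAntR : (BR q ⊗[ℂ] BR q) ⊗[ℂ] BR q →ₗ[ℂ] BR q ⊗[ℂ] BR q :=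
  TensorProduct.map (ant hq) (antR hq) ∘ₗ (asc q).toLinearMap

theorem antAntR_symm (m : BR q) (t : BR q ⊗[ℂ] BR q) :
    antAntR hq ((asc q).symm (m ⊗ₜ t)) = ant hq m ⊗ₜ antR hq t := by
  simp [antAntR]

theorem T_map_ant (y w n : BR q) :
    (BB hq).T hq y (TensorProduct.map (ant hq) (ant hq) (psi hq (w ⊗ₜ n))) =
      antAntR hq (on12 (psi hq) (on23 (psi hq) ((y ⊗ₜ w) ⊗ₜ n))) := by
  rw [← TensorProduct.assoc_symm_tmul, on23_symm]
  generalize psi hq (w ⊗ₜ n) = t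
  induction t using TensorProduct.induction_on with
  | zero => simp
  | add s s' h h' => simp only [map_add, TensorProduct.tmul_add, h, h']
  | tmul m z =>
    rw [TensorProduct.map_tmul, BorelAlg.T_tmul, ← psi_tmul, psi_tmul_ant,
      TensorProduct.assoc_symm_tmul, on12_tmul]
    generalize psi hq (y ⊗ₜ m) = t
    induction t using TensorProduct.induction_on with
    | zero => simp
    | add s s' h h' => simp only [map_add, TensorProduct.add_tmul, h, h']
    | tmul k u =>
      rw [← TensorProduct.assoc_symm_tmul, antAntR_symm]; rfl

/-- Multiplication of the first leg and `(S ⊗ S) ψ` on the last two legs. -/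
def mulMapAnt : (BR q ⊗[ℂ] BR q) ⊗[ℂ] BR q →ₗ[ℂ] BR q ⊗[ℂ] BR q :=
  TensorProduct.lift ((BB hq).T hq).toLinearMap ∘ₗ
    (TensorProduct.map (ant hq) (ant hq) ∘ₗ psi hq).lTensor (BR q) ∘ₗ (asc q).toLinearMap

theorem mulMapAnt_symm (y : BR q) (t : BR q ⊗[ℂ] BR q) : mulMapAnt hq ((asc q).symm (y ⊗ₜ t)) =
    (BB hq).T hq y (TensorProduct.map (ant hq) (ant hq) (psi hq t)) := by
  simp [mulMapAnt]

theorem mulMapAnt_Del (t : BR q ⊗[ℂ] BR q) :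
    mulMapAnt hq (co12 (Del hq) t) = ant hq (epsL hq t) ⊗ₜ 1 := by
  induction t using TensorProduct.induction_on with
  | zero => simp
  | add s s' h h' => simp only [map_add, TensorProduct.add_tmul, h, h']
  | tmul z n =>
    have h : ∀ t : BR q ⊗[ℂ] BR q, mulMapAnt hq (t ⊗ₜ n) =
        antAntR hq (on12 (psi hq) (on23 (psi hq) (t ⊗ₜ n))) := by
      intro t
      induction t using TensorProduct.induction_on with
      | zero => simp
      | add s s' h h' => simp only [map_add, TensorProduct.add_tmul, h, h']
      | tmul y w => rw [← T_map_ant, ← TensorProduct.assoc_symm_tmul, mulMapAnt_symm]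
    have h2 := LinearMap.congr_fun (psi_comul_left hq) (z ⊗ₜ n)
    simp only [LinearMap.comp_apply, co12_apply] at h2
    have h3 : ∀ t : BR q ⊗[ℂ] BR q, antAntR hq (co23 (Del hq) t) =
        ant hq (epsR hq t) ⊗ₜ 1 := by
      intro t
      induction t using TensorProduct.induction_on with
      | zero => simp
      | add s s' h h' => simp only [map_add, TensorProduct.add_tmul, h, h']
      | tmul y w =>
        rw [co23_apply, antAntR_symm, antR_Del, epsR_tmul, map_smul, TensorProduct.tmul_smul,
          TensorProduct.smul_tmul']
    have h4 := epsR_T hq z (n ⊗ₜ 1)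
    rw [co12_apply, h, ← h2, h3, psi_tmul, h4, epsR_tmul, map_one, one_smul, epsL_tmul]

/-- In the braided tensor square, `Δ S` is a left and `(S ⊗ S) ψ Δ` is a right convolution inverse
of `Δ`. -/
theorem comul_antipode :
    Del hq ∘ₗ ant hq = TensorProduct.map (ant hq) (ant hq) ∘ₗ psi hq ∘ₗ Del hq := by
  refine convolution_inverse_unique (A := BP (BB hq) hq) (u := (comul hq).toLinearMap)
    (ε := (eps hq).toLinearMap)
    (Del_coassoc hq) (epsL_Del hq) (epsR_Del hq) ?_ ?_
  · ext x
    have h : ∀ t : BR q ⊗[ℂ] BR q, LinearMap.mul' ℂ (BP (BB hq) hq)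
        (TensorProduct.map ((comul hq).toLinearMap ∘ₗ ant hq) (comul hq).toLinearMap t) =
        comul hq (antL hq t) := by
      intro t
      induction t using TensorProduct.induction_on with
      | zero => simp
      | add s s' h h' => simp only [map_add, h, h']
      | tmul y w =>
        rw [antL_tmul, map_mul]; rfl
    refine (h _).trans ?_
    rw [antL_Del, map_smul, map_one]
    exact (Algebra.algebraMap_eq_smul_one _).symm
  · ext x
    let Λ : BR q ⊗[ℂ] (BR q ⊗[ℂ] BR q) →ₗ[ℂ] BR q ⊗[ℂ] BR q :=
      TensorProduct.lift (BorelAlg.lmul q) ∘ₗ (mulMapAnt hq ∘ₗ co23 (Del hq)).lTensor (BR q)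
    have h1 : ∀ t : BR q ⊗[ℂ] BR q, LinearMap.mul' ℂ (BP (BB hq) hq)
        (TensorProduct.map (comul hq).toLinearMap
          (TensorProduct.map (ant hq) (ant hq) ∘ₗ psi hq ∘ₗ Del hq : BR q →ₗ[ℂ] BP (BB hq) hq) t) =
        Λ (asc q (co12 (Del hq) t)) := by
      intro t
      induction t using TensorProduct.induction_on with
      | zero => simp only [map_zero]; rfl
      | add s s' h h' => simp only [map_add, h, h']; rfl
      | tmul y z =>
        have h2 : ∀ s : BR q ⊗[ℂ] BR q, (BB hq).rho hq s
            (TensorProduct.map (ant hq) (ant hq) (psi hq (Del hq z))) = Λ (asc q (s ⊗ₜ z)) := by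
          intro s
          induction s using TensorProduct.induction_on with
          | zero => simp
          | add s s' h h' => simp only [map_add, LinearMap.add_apply, TensorProduct.add_tmul, h, h']
          | tmul m y =>
            rw [BorelAlg.rho_tmul, Module.End.mul_apply, ← mulMapAnt_symm]; rfl
        exact h2 (Del hq y)
    have h3 := LinearMap.congr_fun (Del_coassoc hq)
    simp only [LinearMap.comp_apply] at h3
    have h4 : ∀ t : BR q ⊗[ℂ] BR q, Λ (asc q (co23 (Del hq) t)) = antR hq t ⊗ₜ 1 := by
      intro t
      induction t using TensorProduct.induction_on with
      | zero => simp
      | add s s' h h' => simp only [map_add, TensorProduct.add_tmul, h, h']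
      | tmul m z =>
        have h5 : Λ (m ⊗ₜ Del hq z) = (m * ant hq z) ⊗ₜ 1 := by
          change BorelAlg.lmul q m (mulMapAnt hq (co23 (Del hq) (Del hq z))) = _
          rw [h3, mulMapAnt_Del, epsL_Del, BorelAlg.lmul_tmul]
        rw [co23_apply, LinearEquiv.apply_symm_apply, h5, antR_tmul]
    refine (h1 _).trans ?_
    rw [← h3, h4, antR_Del]
    refine Eq.trans ?_ (Algebra.algebraMap_eq_smul_one (A := BP (BB hq) hq) (eps hq x)).symm
    exact (TensorProduct.smul_tmul' _ _ _).symm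

end

end

section

/-! ### The involution -/

theorem starT_add (s t : BR q ⊗[ℂ] BR q) : starT (s + t) = starT s + starT t := by
  simp [starT, star_add]

theorem starT_zero : starT (0 : BR q ⊗[ℂ] BR q) = 0 := by simp [starT]

theorem starT_smul (r : ℂ) (t : BR q ⊗[ℂ] BR q) : starT (r • t) = star r • starT t := by
  simp [starT, star_smul]

theorem starT_neg (t : BR q ⊗[ℂ] BR q) : starT (-t) = -starT t := by
  rw [← neg_one_smul ℂ, starT_smul]; simp

theorem starT_sub (s t : BR q ⊗[ℂ] BR q) : starT (s - t) = starT s - starT t := by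
  rw [sub_eq_add_neg, starT_add, starT_neg, sub_eq_add_neg]

theorem star_sq : star 𝐬 = 𝐬 := by simp [sq]

theorem starT_lmul (n : BR q) (t : BR q ⊗[ℂ] BR q) :
    starT (BorelAlg.lmul q n t) = BorelAlg.rmul (BR q) (star n) (starT t) := by
  induction t using TensorProduct.induction_on with
  | zero => simp [starT_zero]
  | add s s' h h' => simp only [map_add, starT_add, h, h']
  | tmul x y => simp [starT_tmul]

theorem starT_rmul (n : BR q) (t : BR q ⊗[ℂ] BR q) :
    starT (BorelAlg.rmul (BR q) n t) = BorelAlg.lmul q (star n) (starT t) := by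
  induction t using TensorProduct.induction_on with
  | zero => simp [starT_zero]
  | add s s' h h' => simp only [map_add, starT_add, h, h']
  | tmul x y => simp [starT_tmul]

theorem mu_starT (t : BR q ⊗[ℂ] BR q) : mu q (starT t) = star (mu q t) := by
  induction t using TensorProduct.induction_on with
  | zero => simp [starT_zero]
  | add s s' h h' => simp only [map_add, starT_add, star_add, h, h']
  | tmul x y => simp [starT_tmul]

variable (q) in
/-- The span of `1` and the generators. -/
def genSpan : Submodule ℂ (BR q) := Submodule.span ℂ {1, 𝐚, 𝐛, 𝐜, 𝐩}

theorem one_mem_genSpan : (1 : BR q) ∈ genSpan q := Submodule.subset_span (by simp)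
theorem a_mem_genSpan : 𝐚 ∈ genSpan q := Submodule.subset_span (by simp)
theorem b_mem_genSpan : 𝐛 ∈ genSpan q := Submodule.subset_span (by simp)
theorem c_mem_genSpan : 𝐜 ∈ genSpan q := Submodule.subset_span (by simp)
theorem p_mem_genSpan : 𝐩 ∈ genSpan q := Submodule.subset_span (by simp)

variable (q) in
/-- The tensors whose second legs are linear in the generators. -/
def tensorGenSpan : Submodule ℂ (BR q ⊗[ℂ] BR q) :=
  Submodule.span ℂ {t | ∃ n, ∃ v ∈ genSpan q, n ⊗ₜ v = t}

theorem tmul_mem_tensorGenSpan (n : BR q) {v : BR q} (hv : v ∈ genSpan q) :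
    n ⊗ₜ v ∈ tensorGenSpan q := Submodule.subset_span ⟨n, v, hv, rfl⟩

theorem tensorGenSpan_induction {P : BR q ⊗[ℂ] BR q → Prop}
    (h : ∀ n, ∀ v ∈ genSpan q, P (n ⊗ₜ v)) (h0 : P 0) (hadd : ∀ s t, P s → P t → P (s + t))
    {t : BR q ⊗[ℂ] BR q} (ht : t ∈ tensorGenSpan q) : P t := by
  suffices ∀ t ∈ tensorGenSpan q, ∀ r : ℂ, P (r • t) by simpa using this t ht 1
  intro t ht
  induction ht using Submodule.span_induction with
  | mem x hx =>
    obtain ⟨n, v, hv, rfl⟩ := hx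
    intro r
    rw [TensorProduct.smul_tmul']
    exact h _ v hv
  | zero => intro r; rwa [smul_zero]
  | add s t _ _ hs ht => intro r; rw [smul_add]; exact hadd _ _ (hs r) (ht r)
  | smul k t _ ht => intro r; rw [smul_smul]; exact ht _

section
variable (hq : q ≠ 0)

/-- The braiding past a combination of generators produces combinations of generators. -/
theorem psi_mem_tensorGenSpan {v : BR q} (hv : v ∈ genSpan q) (y : BR q) :
    psi hq (v ⊗ₜ y) ∈ tensorGenSpan q := by
  have hw : 𝐰 ∈ genSpan q :=
    Submodule.sub_mem _ p_mem_genSpan (Submodule.smul_mem _ _ a_mem_genSpan)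
  induction hv using Submodule.span_induction with
  | zero => simp
  | add s t _ _ hs ht => rw [TensorProduct.add_tmul, map_add]; exact add_mem hs ht
  | smul k t _ ht => rw [← TensorProduct.smul_tmul', map_smul]; exact Submodule.smul_mem _ _ ht
  | mem x hx =>
    simp only [Set.mem_insert_iff, Set.mem_singleton_iff] at hx
    rcases hx with rfl | rfl | rfl | rfl | rfl
    · rw [psi_one_tmul]; exact tmul_mem_tensorGenSpan _ one_mem_genSpan
    · rw [psi_tmul, BorelAlg.T_a, BorelAlg.Ta_tmul, mul_one, mul_one]
      exact add_mem (tmul_mem_tensorGenSpan _ a_mem_genSpan)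
        (tmul_mem_tensorGenSpan _ c_mem_genSpan)
    · rw [psi_tmul, BorelAlg.T_b, BorelAlg.Tb_tmul, mul_one, mul_one, mul_one]
      exact sub_mem (add_mem (tmul_mem_tensorGenSpan _ b_mem_genSpan)
        (tmul_mem_tensorGenSpan _ hw)) (tmul_mem_tensorGenSpan _ c_mem_genSpan)
    · rw [psi_tmul, BorelAlg.T_c, BorelAlg.Tc_tmul, mul_one]
      exact tmul_mem_tensorGenSpan _ c_mem_genSpan
    · rw [psi_tmul, BorelAlg.T_p, BorelAlg.Tp_tmul, mul_one]
      exact tmul_mem_tensorGenSpan _ p_mem_genSpan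

theorem psi_mul_tmul (x x' y : BR q) :
    psi hq ((x * x') ⊗ₜ y) = (BB hq).T hq x (psi hq (x' ⊗ₜ y)) := by
  rw [psi_tmul, map_mul]; rfl

theorem psi_tmul_mul (x y y' : BR q) :
    psi hq (x ⊗ₜ (y * y')) = (BB hq).rho hq (psi hq (x ⊗ₜ y)) (y' ⊗ₜ 1) := by
  rw [psi_tmul, psi_tmul, ← BorelAlg.T_mul_lmul]; rfl

/-- Compatibility of the braiding with `*` when the first argument is linear in the generators. The
induction over `y` stays within this case because the braiding past a generator produces generators
again. -/
theorem starT_psi_gen (y : BR q) : ∀ v ∈ genSpan q,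
    starT (psi hq (v ⊗ₜ y)) = psi hq (star y ⊗ₜ star v) := by
  have hs := sq_ne_zero hq
  have hB1 : (BB hq).g = gam hq := rfl
  have hB2 : (BB hq).g' = gam' hq := rfl
  have hB3 : (BB hq).d = del hq := rfl
  refine BR.ind (P := fun y => ∀ v ∈ genSpan q,
    starT (psi hq (v ⊗ₜ y)) = psi hq (star y ⊗ₜ star v)) ?_ ?_ ?_ ?_ ?_ ?_ ?_ ?_ y
  · intro v hv
    rw [psi_tmul_one, starT_tmul, star_one, psi_one_tmul]
  · intro r y h v hv
    rw [TensorProduct.tmul_smul, map_smul, starT_smul, h v hv, star_smul,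
      ← TensorProduct.smul_tmul', map_smul]
  · intro y y' h h' v hv
    rw [TensorProduct.tmul_add, map_add, starT_add, h v hv, h' v hv, star_add,
      TensorProduct.add_tmul, map_add]
  · intro y y' h h' v hv
    have key : ∀ t ∈ tensorGenSpan q, starT ((BB hq).rho hq t (y' ⊗ₜ 1)) =
        (BB hq).T hq (star y') (starT t) := by
      intro t ht
      refine tensorGenSpan_induction (P := fun t => starT ((BB hq).rho hq t (y' ⊗ₜ 1)) =
        (BB hq).T hq (star y') (starT t)) ?_ ?_ ?_ ht
      · intro n z hz
        rw [BorelAlg.rho_tmul, Module.End.mul_apply, ← psi_tmul, starT_lmul, h' z hz, starT_tmul,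
          psi_tmul, ← BorelAlg.T_tmul]
      · simp [starT_zero]
      · intro s t hs ht; simp only [map_add, LinearMap.add_apply, starT_add, hs, ht]
    rw [psi_tmul_mul, key _ (psi_mem_tensorGenSpan hq hv y), h v hv, star_mul, psi_mul_tmul]
  all_goals
    intro v hv
    induction hv using Submodule.span_induction with
    | zero => simp [starT_zero]
    | add s t _ _ hs ht =>
      rw [TensorProduct.add_tmul, map_add, starT_add, hs, ht, star_add, TensorProduct.tmul_add,
        map_add]
    | smul k t _ ht =>
      rw [← TensorProduct.smul_tmul', map_smul, starT_smul, ht, star_smul,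
        TensorProduct.tmul_smul, map_smul]
    | mem x hx =>
      simp only [Set.mem_insert_iff, Set.mem_singleton_iff] at hx
      rcases hx with rfl | rfl | rfl | rfl | rfl
      · rw [psi_one_tmul, starT_tmul, star_one, psi_tmul_one]
      all_goals
        simp only [BR.star_a, BR.star_b, BR.star_c, BR.star_p, psi_tmul, BorelAlg.T_a, BorelAlg.T_b,
          BorelAlg.T_c, BorelAlg.T_p, BorelAlg.Ta_tmul, BorelAlg.Tb_tmul, BorelAlg.Tc_tmul,
          BorelAlg.Tp_tmul, hB1, hB2, hB3, gam_a, gam_b, gam_c, gam_p, gam'_a, gam'_b, gam'_c,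
          gam'_p, del_a, del_b, del_c, del_p, mul_one, map_zero, TensorProduct.zero_tmul, map_smul,
          BR.w, TensorProduct.tmul_sub, TensorProduct.tmul_smul, ← TensorProduct.smul_tmul',
          starT_add, starT_sub, starT_smul, starT_tmul, star_sub, star_add, star_one, star_inv₀,
          star_sq, TensorProduct.sub_tmul, map_sub, starT_zero]
        try (match_scalars <;> field_simp <;> ring)

theorem starT_psi (t : BR q ⊗[ℂ] BR q) : starT (psi hq t) = psi hq (starT t) := by
  have key : ∀ x y, starT (psi hq (x ⊗ₜ y)) = psi hq (star y ⊗ₜ star x) := by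
    intro x
    refine BR.ind (P := fun x => ∀ y, starT (psi hq (x ⊗ₜ y)) = psi hq (star y ⊗ₜ star x))
      ?_ ?_ ?_ ?_ (fun y => starT_psi_gen hq y _ a_mem_genSpan)
      (fun y => starT_psi_gen hq y _ b_mem_genSpan) (fun y => starT_psi_gen hq y _ c_mem_genSpan)
      (fun y => starT_psi_gen hq y _ p_mem_genSpan) x
    · exact fun y => starT_psi_gen hq y _ one_mem_genSpan
    · intro r x h y
      rw [← TensorProduct.smul_tmul', map_smul, starT_smul, h, star_smul,
        TensorProduct.tmul_smul, map_smul]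
    · intro x x' h h' y
      rw [TensorProduct.add_tmul, map_add, starT_add, h, h', star_add, TensorProduct.tmul_add,
        map_add]
    · intro x x' h h' y
      have key : ∀ t, starT ((BB hq).T hq x t) = (BB hq).rho hq (starT t) (star x ⊗ₜ 1) := by
        intro t
        induction t using TensorProduct.induction_on with
        | zero => simp [starT_zero]
        | add s t hs ht => simp only [map_add, LinearMap.add_apply, starT_add, hs, ht]
        | tmul n z =>
          rw [BorelAlg.T_tmul, ← psi_tmul, starT_rmul, h, psi_tmul, starT_tmul, BorelAlg.rho_tmul]
          rfl
      rw [psi_mul_tmul, key, h', star_mul, psi_tmul_mul]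
  induction t using TensorProduct.induction_on with
  | zero => simp [starT_zero]
  | add s t hs ht => simp only [map_add, starT_add, hs, ht]
  | tmul x y => rw [key, starT_tmul]

/-- The involution is antimultiplicative for the braided product. -/
theorem starT_rho (s t : BR q ⊗[ℂ] BR q) :
    starT ((BB hq).rho hq s t) = (BB hq).rho hq (starT t) (starT s) := by
  induction s using TensorProduct.induction_on with
  | zero => simp [starT_zero]
  | add s s' h h' => simp only [map_add, LinearMap.add_apply, starT_add, h, h']
  | tmul x y =>
    induction t using TensorProduct.induction_on with
    | zero => simp [starT_zero]
    | add s s' h h' => simp only [map_add, LinearMap.add_apply, starT_add, h, h']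
    | tmul z w =>
      rw [BorelAlg.rho_tmul, Module.End.mul_apply, starT_lmul, BorelAlg.T_tmul, starT_rmul,
        ← psi_tmul, starT_psi, starT_tmul, starT_tmul, starT_tmul, BorelAlg.rho_tmul,
        Module.End.mul_apply, BorelAlg.T_tmul, psi_tmul]
      generalize (BB hq).T hq (star z) (star y ⊗ₜ 1) = t
      induction t using TensorProduct.induction_on with
      | zero => simp
      | add s s' h h' => simp only [map_add, h, h']
      | tmul z w => simp

theorem Del_star (x : BR q) : Del hq (star x) = starT (Del hq x) := by
  refine BR.ind (P := fun x => Del hq (star x) = starT (Del hq x)) ?_ ?_ ?_ ?_ ?_ ?_ ?_ ?_ x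
  · rw [star_one, Del_one, starT_tmul, star_one]
  · intro r x h; rw [star_smul, map_smul, map_smul, starT_smul, h]
  · intro x y hx hy; rw [star_add, map_add, map_add, starT_add, hx, hy]
  · intro x y hx hy; rw [star_mul, Del_mul, Del_mul, hx, hy, starT_rho]
  all_goals
    simp only [BR.star_a, BR.star_b, BR.star_c, BR.star_p, Del_a, Del_b, Del_c, Del_p, comulA,
      comulB, comulC, comulP, starT_add, starT_sub, starT_smul, starT_tmul, star_add, star_inv₀,
      star_sq, star_pow]
    try abel

theorem ant_star (x : BR q) : ant hq (star x) = star (ant hq x) := by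
  refine BR.ind (P := fun x => ant hq (star x) = star (ant hq x)) ?_ ?_ ?_ ?_ ?_ ?_ ?_ ?_ x
  · rw [star_one, ant_one, star_one]
  · intro r x h; rw [star_smul, map_smul, map_smul, star_smul, h]
  · intro x y hx hy; rw [star_add, map_add, map_add, star_add, hx, hy]
  · intro x y hx hy
    rw [star_mul, ant_mul, ant_mul, hx, hy, ← starT_tmul, ← starT_psi, mu_starT]
  all_goals
    simp only [BR.star_a, BR.star_b, BR.star_c, BR.star_p, ant_a, ant_b, ant_c, ant_p, star_smul,
      star_sub, star_neg, star_sq]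

/-! ### The first structure -/

/-- The first braided Hopf structure. -/
def first : HopfData q where
  Δ := Del hq
  ε := (eps hq).toLinearMap
  S := ant hq
  ψ := psi hq

theorem isBraidedHopfStar_first : IsBraidedHopfStar (first hq) where
  coassoc := Del_coassoc hq
  counit_left := epsL_Del hq
  counit_right := epsR_Del hq
  antipode_right := by
    ext x
    exact (antR_Del hq x).trans (Algebra.algebraMap_eq_smul_one (eps hq x)).symm
  antipode_left := by
    ext x
    exact (antL_Del hq x).trans (Algebra.algebraMap_eq_smul_one (eps hq x)).symm
  psi_one_left := psi_one_tmul hq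
  psi_one_right := psi_tmul_one hq
  psi_mul_left := psi_mul_left hq
  psi_mul_right := psi_mul_right hq
  psi_comul_left := psi_comul_left hq
  psi_comul_right := psi_comul_right hq
  comul_one := Del_one hq
  comul_mul := TensorProduct.ext' fun x y =>
    (Del_mul hq x y).trans (braidedMul_psi hq (Del hq x) (Del hq y)).symm
  antipode_mul := TensorProduct.ext' fun x y => ant_mul hq x y
  comul_antipode := comul_antipode hq
  counit_one := map_one (eps hq)
  counit_mul := map_mul (eps hq)
  yang_baxter := psi_yang_baxter hq
  comul_star := Del_star hq
  antipode_star := ant_star hq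
  tensor_star s t := by
    change starT (braidedMul (psi hq) (s ⊗ₜ t)) = braidedMul (psi hq) (starT t ⊗ₜ starT s)
    rw [braidedMul_psi, braidedMul_psi, starT_rho]

end

end

section

/-! ### The structure is determined by the braiding and the coproduct of the generators -/

/-- A left counit and a right counit of the same coproduct agree. -/
theorem counit_unique {Δ : BR q →ₗ[ℂ] BR q ⊗[ℂ] BR q} {ε ε' : BR q →ₗ[ℂ] ℂ}
    (hl : ∀ x, TensorProduct.lid ℂ (BR q) (ε.rTensor (BR q) (Δ x)) = x)
    (hr : ∀ x, TensorProduct.rid ℂ (BR q) (ε'.lTensor (BR q) (Δ x)) = x) : ε = ε' := by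
  have key : ∀ t : BR q ⊗[ℂ] BR q, ε (TensorProduct.rid ℂ (BR q) (ε'.lTensor (BR q) t)) =
      ε' (TensorProduct.lid ℂ (BR q) (ε.rTensor (BR q) t)) := by
    intro t
    induction t using TensorProduct.induction_on with
    | zero => simp
    | add s s' h h' => simp only [map_add, h, h']
    | tmul x y => simp [mul_comm]
  ext x
  have h := key (Δ x)
  rwa [hl, hr] at h

theorem mem_genSpan_induction {P : BR q → Prop} (h1 : P 1) (ha : P 𝐚) (hb : P 𝐛) (hc : P 𝐜)
    (hp : P 𝐩) (h0 : P 0) (hadd : ∀ x y, P x → P y → P (x + y))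
    (hs : ∀ (r : ℂ) x, P x → P (r • x)) {x : BR q} (hx : x ∈ genSpan q) : P x := by
  induction hx using Submodule.span_induction with
  | zero => exact h0
  | add s t _ _ hs ht => exact hadd _ _ hs ht
  | smul k t _ ht => exact hs _ _ ht
  | mem x hx =>
    simp only [Set.mem_insert_iff, Set.mem_singleton_iff] at hx
    rcases hx with rfl | rfl | rfl | rfl | rfl <;> assumption

section
variable (hq : q ≠ 0)

/-- A braiding that agrees with `psi` on generators is `psi`. -/
theorem psi_unique {ψ : BR q ⊗[ℂ] BR q →ₗ[ℂ] BR q ⊗[ℂ] BR q}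
    (h1 : ∀ x, ψ (1 ⊗ₜ x) = x ⊗ₜ 1) (h1' : ∀ x, ψ (x ⊗ₜ 1) = 1 ⊗ₜ x)
    (hl : ψ ∘ₗ m12 q = m23 q ∘ₗ on12 ψ ∘ₗ on23 ψ) (hr : ψ ∘ₗ m23 q = m12 q ∘ₗ on23 ψ ∘ₗ on12 ψ)
    (ha : ∀ v ∈ genSpan q, ψ (v ⊗ₜ 𝐚) = psi hq (v ⊗ₜ 𝐚))
    (hb : ∀ v ∈ genSpan q, ψ (v ⊗ₜ 𝐛) = psi hq (v ⊗ₜ 𝐛))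
    (hc : ∀ v ∈ genSpan q, ψ (v ⊗ₜ 𝐜) = psi hq (v ⊗ₜ 𝐜))
    (hp : ∀ v ∈ genSpan q, ψ (v ⊗ₜ 𝐩) = psi hq (v ⊗ₜ 𝐩)) : ψ = psi hq := by
  have key : ∀ y, ∀ v ∈ genSpan q, ψ (v ⊗ₜ y) = psi hq (v ⊗ₜ y) := by
    intro y
    refine BR.ind (P := fun y => ∀ v ∈ genSpan q, ψ (v ⊗ₜ y) = psi hq (v ⊗ₜ y)) ?_ ?_ ?_ ?_
      ha hb hc hp y
    · intro v _; rw [h1', psi_tmul_one]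
    · intro r y h v hv; rw [TensorProduct.tmul_smul, map_smul, map_smul, h v hv]
    · intro y y' h h' v hv; rw [TensorProduct.tmul_add, map_add, map_add, h v hv, h' v hv]
    · intro y y' h h' v hv
      have hm := LinearMap.congr_fun hr ((v ⊗ₜ y) ⊗ₜ y')
      simp only [LinearMap.comp_apply] at hm
      rw [m23_tmul, BorelAlg.rmul_tmul, on12_tmul, h v hv] at hm
      rw [hm, psi_tmul_mul]
      refine tensorGenSpan_induction (P := fun t => m12 q (on23 ψ (t ⊗ₜ y')) =
        (BB hq).rho hq t (y' ⊗ₜ 1)) ?_ ?_ ?_ (psi_mem_tensorGenSpan hq hv y)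
      · intro n z hz
        rw [← TensorProduct.assoc_symm_tmul, on23_symm, m12_symm, h' z hz, psi_tmul]; rfl
      · simp
      · intro s t hs ht
        simp only [TensorProduct.add_tmul, map_add, LinearMap.add_apply, hs, ht]
  refine TensorProduct.ext' fun x y => ?_
  revert y
  refine BR.ind (P := fun x => ∀ y, ψ (x ⊗ₜ y) = psi hq (x ⊗ₜ y)) ?_ ?_ ?_ ?_
    (fun y => key y _ a_mem_genSpan) (fun y => key y _ b_mem_genSpan)
    (fun y => key y _ c_mem_genSpan) (fun y => key y _ p_mem_genSpan) x
  · intro y; rw [h1, psi_one_tmul]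
  · intro r x h y; rw [← TensorProduct.smul_tmul', map_smul, map_smul, h]
  · intro x x' h h' y; rw [TensorProduct.add_tmul, map_add, map_add, h, h']
  · intro x x' h h' y
    have hm := LinearMap.congr_fun hl ((x ⊗ₜ x') ⊗ₜ y)
    simp only [LinearMap.comp_apply] at hm
    rw [m12_tmul, ← TensorProduct.assoc_symm_tmul, on23_symm, h'] at hm
    rw [hm, psi_mul_tmul]
    generalize psi hq (x' ⊗ₜ y) = t
    induction t using TensorProduct.induction_on with
    | zero => simp
    | add s s' h h' => simp only [TensorProduct.tmul_add, map_add, h, h']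
    | tmul n z =>
      rw [TensorProduct.assoc_symm_tmul, on12_tmul, m23_tmul, h, BorelAlg.T_tmul, psi_tmul]

/-- The counit and the antipode are determined by the coproduct, and the coproduct and the braiding
by their values on generators. -/
theorem eq_first {H : HopfData q} (h : IsBraidedHopfStar H)
    (ha : ∀ v ∈ genSpan q, H.ψ (v ⊗ₜ 𝐚) = psi hq (v ⊗ₜ 𝐚))
    (hb : ∀ v ∈ genSpan q, H.ψ (v ⊗ₜ 𝐛) = psi hq (v ⊗ₜ 𝐛))
    (hc : ∀ v ∈ genSpan q, H.ψ (v ⊗ₜ 𝐜) = psi hq (v ⊗ₜ 𝐜))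
    (hp : ∀ v ∈ genSpan q, H.ψ (v ⊗ₜ 𝐩) = psi hq (v ⊗ₜ 𝐩))
    (hΔa : H.Δ 𝐚 = comulA q) (hΔb : H.Δ 𝐛 = comulB q) (hΔc : H.Δ 𝐜 = comulC q)
    (hΔp : H.Δ 𝐩 = comulP q) : H = first hq := by
  have hψ : H.ψ = psi hq := psi_unique hq h.psi_one_left h.psi_one_right h.psi_mul_left
    h.psi_mul_right ha hb hc hp
  have hΔ : H.Δ = Del hq := by
    ext x
    refine BR.ind (P := fun x => H.Δ x = Del hq x) ?_ ?_ ?_ ?_ ?_ ?_ ?_ ?_ x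
    · rw [h.comul_one, Del_one]
    · intro r x h; rw [map_smul, map_smul, h]
    · intro x y hx hy; rw [map_add, map_add, hx, hy]
    · intro x y hx hy
      have hm := LinearMap.congr_fun h.comul_mul (x ⊗ₜ y)
      simp only [LinearMap.comp_apply, LinearMap.mul'_apply, TensorProduct.map_tmul] at hm
      rw [hm, hψ, braidedMul_psi, hx, hy, Del_mul]
    · rw [hΔa, Del_a]
    · rw [hΔb, Del_b]
    · rw [hΔc, Del_c]
    · rw [hΔp, Del_p]
  have h1 := isBraidedHopfStar_first hq
  have hε : H.ε = (eps hq).toLinearMap :=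
    counit_unique (Δ := Del hq) (by rw [← hΔ]; exact h.counit_left) h1.counit_right
  have hS : H.S = ant hq := by
    have e1 := h.antipode_left
    have e2 := h1.antipode_right
    rw [hΔ, hε] at e1
    exact convolution_inverse_unique h1.coassoc h1.counit_left h1.counit_right
      (u := LinearMap.id) e1 e2
  cases H
  simp only at hψ hΔ hε hS
  subst hψ hΔ hε hS
  rfl

end

/-! ### Transport of structures -/

section
variable {q' : ℝ} (e : BR q ≃ₐ[ℂ] BR q')

/-- The square of an isomorphism on the tensor squares. -/
def sqMap : BR q ⊗[ℂ] BR q ≃ₗ[ℂ] BR q' ⊗[ℂ] BR q' :=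
  TensorProduct.congr e.toLinearEquiv e.toLinearEquiv

/-- The cube of an isomorphism on the tensor cubes. -/
def cubeMap : (BR q ⊗[ℂ] BR q) ⊗[ℂ] BR q ≃ₗ[ℂ] (BR q' ⊗[ℂ] BR q') ⊗[ℂ] BR q' :=
  TensorProduct.congr (sqMap e) e.toLinearEquiv

theorem sqMap_tmul (x y : BR q) : sqMap e (x ⊗ₜ y) = e x ⊗ₜ e y := rfl

theorem cubeMap_tmul (t : BR q ⊗[ℂ] BR q) (y : BR q) :
    cubeMap e (t ⊗ₜ y) = sqMap e t ⊗ₜ e y := rfl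

theorem cubeMap_symm (x : BR q) (t : BR q ⊗[ℂ] BR q) :
    cubeMap e ((asc q).symm (x ⊗ₜ t)) = (asc q').symm (e x ⊗ₜ sqMap e t) := by
  induction t using TensorProduct.induction_on with
  | zero => simp
  | add s s' h h' => simp only [TensorProduct.tmul_add, map_add, h, h']
  | tmul y z => rfl

/-- The structure `H'` is the transport of `H` along the isomorphism `e`. -/
structure IsTransport (H : HopfData q) (H' : HopfData q') : Prop where
  comul : ∀ x, H'.Δ (e x) = sqMap e (H.Δ x)
  counit : ∀ x, H'.ε (e x) = H.ε x
  antipode : ∀ x, H'.S (e x) = e (H.S x)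
  psi : ∀ t, H'.ψ (sqMap e t) = sqMap e (H.ψ t)

/-- The transport of a structure along an isomorphism. -/
def HopfData.transport (H : HopfData q) : HopfData q' where
  Δ := (sqMap e).toLinearMap ∘ₗ H.Δ ∘ₗ e.symm.toLinearMap
  ε := H.ε ∘ₗ e.symm.toLinearMap
  S := e.toLinearMap ∘ₗ H.S ∘ₗ e.symm.toLinearMap
  ψ := (sqMap e).toLinearMap ∘ₗ H.ψ ∘ₗ (sqMap e).symm.toLinearMap

theorem isTransport_transport (H : HopfData q) : IsTransport e H (H.transport e) where
  comul x := by simp [HopfData.transport]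
  counit x := by simp [HopfData.transport]
  antipode x := by simp [HopfData.transport]
  psi x := by simp [HopfData.transport]

variable {e}

theorem IsTransport.unique {H : HopfData q} {H₁ H₂ : HopfData q'} (h₁ : IsTransport e H H₁)
    (h₂ : IsTransport e H H₂) : H₁ = H₂ := by
  ext x
  · obtain ⟨x, rfl⟩ := e.surjective x
    rw [h₁.comul, h₂.comul]
  · obtain ⟨x, rfl⟩ := e.surjective x
    rw [h₁.counit, h₂.counit]
  · obtain ⟨x, rfl⟩ := e.surjective x
    rw [h₁.antipode, h₂.antipode]
  · rename_i y
    obtain ⟨x, rfl⟩ := e.surjective x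
    obtain ⟨y, rfl⟩ := e.surjective y
    have h := (h₁.psi (x ⊗ₜ y)).trans (h₂.psi (x ⊗ₜ y)).symm
    exact h

theorem IsTransport.symm {H : HopfData q} {H' : HopfData q'} (h : IsTransport e H H') :
    IsTransport e.symm H' H where
  comul x := by
    obtain ⟨x, rfl⟩ := e.surjective x
    rw [h.comul, e.symm_apply_apply]
    exact ((sqMap e).symm_apply_apply _).symm
  counit x := by
    obtain ⟨x, rfl⟩ := e.surjective x
    rw [h.counit, e.symm_apply_apply]
  antipode x := by
    obtain ⟨x, rfl⟩ := e.surjective x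
    rw [h.antipode, e.symm_apply_apply, e.symm_apply_apply]
  psi x := by
    obtain ⟨x, rfl⟩ := (sqMap e).surjective x
    rw [h.psi]
    refine (congrArg H.ψ ((sqMap e).symm_apply_apply _)).trans ?_
    exact ((sqMap e).symm_apply_apply _).symm

theorem lmul_sqMap (x : BR q) (t : BR q ⊗[ℂ] BR q) :
    sqMap e (BorelAlg.lmul q x t) = BorelAlg.lmul q' (e x) (sqMap e t) := by
  induction t using TensorProduct.induction_on with
  | zero => simp
  | add s s' h h' => simp only [map_add, h, h']
  | tmul y z => simp [sqMap_tmul]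

theorem rmul_sqMap (x : BR q) (t : BR q ⊗[ℂ] BR q) :
    sqMap e (BorelAlg.rmul (BR q) x t) = BorelAlg.rmul (BR q') (e x) (sqMap e t) := by
  induction t using TensorProduct.induction_on with
  | zero => simp
  | add s s' h h' => simp only [map_add, h, h']
  | tmul y z => simp [sqMap_tmul]

theorem mu_sqMap (t : BR q ⊗[ℂ] BR q) : mu q' (sqMap e t) = e (mu q t) := by
  induction t using TensorProduct.induction_on with
  | zero => simp
  | add s s' h h' => simp only [map_add, h, h']
  | tmul y z => simp [sqMap_tmul]

theorem m12_cubeMap (t : (BR q ⊗[ℂ] BR q) ⊗[ℂ] BR q) :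
    m12 q' (cubeMap e t) = sqMap e (m12 q t) := by
  induction t using TensorProduct.induction_on with
  | zero => simp
  | add s s' h h' => simp only [map_add, h, h']
  | tmul s z => 
    have h : ∀ s, m12 q (s ⊗ₜ z) = mu q s ⊗ₜ z := fun _ => rfl
    have h' : ∀ s z, m12 q' (s ⊗ₜ z) = mu q' s ⊗ₜ z := fun _ _ => rfl
    rw [cubeMap_tmul, h, h', mu_sqMap, sqMap_tmul]

theorem m23_cubeMap (t : (BR q ⊗[ℂ] BR q) ⊗[ℂ] BR q) :
    m23 q' (cubeMap e t) = sqMap e (m23 q t) := by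
  induction t using TensorProduct.induction_on with
  | zero => simp
  | add s s' h h' => simp only [map_add, h, h']
  | tmul s z => rw [cubeMap_tmul, m23_tmul, m23_tmul, rmul_sqMap]

theorem starT_sqMap (he : ∀ x, e (star x) = star (e x)) (t : BR q ⊗[ℂ] BR q) :
    starT (sqMap e t) = sqMap e (starT t) := by
  induction t using TensorProduct.induction_on with
  | zero => simp [starT_zero]
  | add s s' h h' => simp only [map_add, starT_add, h, h']
  | tmul s z => rw [sqMap_tmul, starT_tmul, starT_tmul, sqMap_tmul, he, he]

namespace IsTransport
variable {H : HopfData q} {H' : HopfData q'}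

theorem on12_cubeMap (T : IsTransport e H H') (t : (BR q ⊗[ℂ] BR q) ⊗[ℂ] BR q) :
    on12 H'.ψ (cubeMap e t) = cubeMap e (on12 H.ψ t) := by
  induction t using TensorProduct.induction_on with
  | zero => simp
  | add s s' h h' => simp only [map_add, h, h']
  | tmul s z => rw [cubeMap_tmul, on12_tmul, on12_tmul, T.psi, cubeMap_tmul]

theorem on23_cubeMap (T : IsTransport e H H') (t : (BR q ⊗[ℂ] BR q) ⊗[ℂ] BR q) :
    on23 H'.ψ (cubeMap e t) = cubeMap e (on23 H.ψ t) := by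
  obtain ⟨t, rfl⟩ := (asc q).symm.surjective t
  induction t using TensorProduct.induction_on with
  | zero => simp
  | add s s' h h' => simp only [map_add, h, h']
  | tmul x t => rw [cubeMap_symm, on23_symm, on23_symm, T.psi, cubeMap_symm]

theorem co12_sqMap (T : IsTransport e H H') (t : BR q ⊗[ℂ] BR q) :
    co12 H'.Δ (sqMap e t) = cubeMap e (co12 H.Δ t) := by
  induction t using TensorProduct.induction_on with
  | zero => simp
  | add s s' h h' => simp only [map_add, h, h']
  | tmul s z => rw [sqMap_tmul, co12_apply, co12_apply, T.comul, cubeMap_tmul]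

theorem co23_sqMap (T : IsTransport e H H') (t : BR q ⊗[ℂ] BR q) :
    co23 H'.Δ (sqMap e t) = cubeMap e (co23 H.Δ t) := by
  induction t using TensorProduct.induction_on with
  | zero => simp
  | add s s' h h' => simp only [map_add, h, h']
  | tmul s z => rw [sqMap_tmul, co23_apply, co23_apply, T.comul, cubeMap_symm]

theorem braidedMul_sqMap (T : IsTransport e H H') (s t : BR q ⊗[ℂ] BR q) :
    braidedMul H'.ψ (sqMap e s ⊗ₜ sqMap e t) = sqMap e (braidedMul H.ψ (s ⊗ₜ t)) := by
  induction s using TensorProduct.induction_on with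
  | zero => simp
  | add s s' h h' => simp only [TensorProduct.add_tmul, map_add, h, h']
  | tmul x y =>
    induction t using TensorProduct.induction_on with
    | zero => simp
    | add s s' h h' => simp only [TensorProduct.tmul_add, map_add, h, h']
    | tmul z w =>
      rw [sqMap_tmul, sqMap_tmul, braidedMul_tmul, braidedMul_tmul, lmul_sqMap, rmul_sqMap,
        ← T.psi, sqMap_tmul]

theorem map_antipode (T : IsTransport e H H') (t : BR q ⊗[ℂ] BR q) :
    TensorProduct.map H'.S H'.S (sqMap e t) = sqMap e (TensorProduct.map H.S H.S t) := by
  induction t using TensorProduct.induction_on with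
  | zero => simp
  | add s s' h h' => simp only [map_add, h, h']
  | tmul x y =>
    rw [sqMap_tmul, TensorProduct.map_tmul, TensorProduct.map_tmul, T.antipode, T.antipode,
      sqMap_tmul]

theorem lTensor_antipode (T : IsTransport e H H') (t : BR q ⊗[ℂ] BR q) :
    H'.S.lTensor (BR q') (sqMap e t) = sqMap e (H.S.lTensor (BR q) t) := by
  induction t using TensorProduct.induction_on with
  | zero => simp
  | add s s' h h' => simp only [map_add, h, h']
  | tmul x y => simp [sqMap_tmul, T.antipode]

theorem rTensor_antipode (T : IsTransport e H H') (t : BR q ⊗[ℂ] BR q) :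
    H'.S.rTensor (BR q') (sqMap e t) = sqMap e (H.S.rTensor (BR q) t) := by
  induction t using TensorProduct.induction_on with
  | zero => simp
  | add s s' h h' => simp only [map_add, h, h']
  | tmul x y => simp [sqMap_tmul, T.antipode]

theorem lid_counit (T : IsTransport e H H') (t : BR q ⊗[ℂ] BR q) :
    TensorProduct.lid ℂ (BR q') (H'.ε.rTensor (BR q') (sqMap e t)) =
      e (TensorProduct.lid ℂ (BR q) (H.ε.rTensor (BR q) t)) := by
  induction t using TensorProduct.induction_on with
  | zero => simp
  | add s s' h h' => simp only [map_add, h, h']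
  | tmul x y => simp [sqMap_tmul, T.counit]

theorem rid_counit (T : IsTransport e H H') (t : BR q ⊗[ℂ] BR q) :
    TensorProduct.rid ℂ (BR q') (H'.ε.lTensor (BR q') (sqMap e t)) =
      e (TensorProduct.rid ℂ (BR q) (H.ε.lTensor (BR q) t)) := by
  induction t using TensorProduct.induction_on with
  | zero => simp
  | add s s' h h' => simp only [map_add, h, h']
  | tmul x y => simp [sqMap_tmul, T.counit]

/-- The axioms of a braided Hopf `*`-algebra are invariant under `*`-isomorphisms. -/
theorem isBraidedHopfStar (T : IsTransport e H H') (he : ∀ x, e (star x) = star (e x))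
    (h : IsBraidedHopfStar H) : IsBraidedHopfStar H' where
  coassoc := by
    ext x
    obtain ⟨x, rfl⟩ := e.surjective x
    have := LinearMap.congr_fun h.coassoc x
    simp only [LinearMap.comp_apply] at this ⊢
    rw [T.comul, T.co23_sqMap, T.co12_sqMap, this]
  counit_left x := by
    obtain ⟨x, rfl⟩ := e.surjective x
    rw [T.comul, T.lid_counit, h.counit_left]
  counit_right x := by
    obtain ⟨x, rfl⟩ := e.surjective x
    rw [T.comul, T.rid_counit, h.counit_right]
  antipode_right := by
    ext x
    obtain ⟨x, rfl⟩ := e.surjective x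
    have := LinearMap.congr_fun h.antipode_right x
    simp only [LinearMap.comp_apply] at this ⊢
    rw [T.comul, T.lTensor_antipode, mu_sqMap, this, T.counit]
    simp
  antipode_left := by
    ext x
    obtain ⟨x, rfl⟩ := e.surjective x
    have := LinearMap.congr_fun h.antipode_left x
    simp only [LinearMap.comp_apply] at this ⊢
    rw [T.comul, T.rTensor_antipode, mu_sqMap, this, T.counit]
    simp
  psi_one_left x := by
    obtain ⟨x, rfl⟩ := e.surjective x
    rw [← map_one e, ← sqMap_tmul, T.psi, h.psi_one_left, sqMap_tmul]
  psi_one_right x := by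
    obtain ⟨x, rfl⟩ := e.surjective x
    rw [← map_one e, ← sqMap_tmul, T.psi, h.psi_one_right, sqMap_tmul]
  psi_mul_left := by
    refine LinearMap.ext fun t => ?_
    obtain ⟨t, rfl⟩ := (cubeMap e).surjective t
    have := LinearMap.congr_fun h.psi_mul_left t
    simp only [LinearMap.comp_apply] at this ⊢
    rw [m12_cubeMap, T.psi, T.on23_cubeMap, T.on12_cubeMap, m23_cubeMap, this]
  psi_mul_right := by
    refine LinearMap.ext fun t => ?_
    obtain ⟨t, rfl⟩ := (cubeMap e).surjective t
    have := LinearMap.congr_fun h.psi_mul_right t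
    simp only [LinearMap.comp_apply] at this ⊢
    rw [m23_cubeMap, T.psi, T.on12_cubeMap, T.on23_cubeMap, m12_cubeMap, this]
  psi_comul_left := by
    refine LinearMap.ext fun t => ?_
    obtain ⟨t, rfl⟩ := (sqMap e).surjective t
    have := LinearMap.congr_fun h.psi_comul_left t
    simp only [LinearMap.comp_apply] at this ⊢
    rw [T.psi, T.co23_sqMap, T.co12_sqMap, T.on23_cubeMap, T.on12_cubeMap, this]
  psi_comul_right := by
    refine LinearMap.ext fun t => ?_
    obtain ⟨t, rfl⟩ := (sqMap e).surjective t
    have := LinearMap.congr_fun h.psi_comul_right t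
    simp only [LinearMap.comp_apply] at this ⊢
    rw [T.psi, T.co23_sqMap, T.co12_sqMap, T.on12_cubeMap, T.on23_cubeMap, this]
  comul_one := by
    rw [← map_one e, T.comul, h.comul_one, sqMap_tmul]
  comul_mul := by
    refine TensorProduct.ext' fun x y => ?_
    obtain ⟨x, rfl⟩ := e.surjective x
    obtain ⟨y, rfl⟩ := e.surjective y
    have := LinearMap.congr_fun h.comul_mul (x ⊗ₜ y)
    simp only [LinearMap.comp_apply, TensorProduct.map_tmul, LinearMap.mul'_apply] at this ⊢
    rw [← map_mul, T.comul, T.comul, T.comul, T.braidedMul_sqMap, this]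
  antipode_mul := by
    refine LinearMap.ext fun t => ?_
    obtain ⟨t, rfl⟩ := (sqMap e).surjective t
    have := LinearMap.congr_fun h.antipode_mul t
    simp only [LinearMap.comp_apply] at this ⊢
    rw [mu_sqMap, T.antipode, T.map_antipode, T.psi, mu_sqMap, this]
  comul_antipode := by
    refine LinearMap.ext fun t => ?_
    obtain ⟨t, rfl⟩ := e.surjective t
    have := LinearMap.congr_fun h.comul_antipode t
    simp only [LinearMap.comp_apply] at this ⊢
    rw [T.antipode, T.comul, T.comul, T.psi, T.map_antipode, this]
  counit_one := by rw [← map_one e, T.counit, h.counit_one]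
  counit_mul x y := by
    obtain ⟨x, rfl⟩ := e.surjective x
    obtain ⟨y, rfl⟩ := e.surjective y
    rw [← map_mul, T.counit, T.counit, T.counit, h.counit_mul]
  yang_baxter := by
    refine LinearMap.ext fun t => ?_
    obtain ⟨t, rfl⟩ := (cubeMap e).surjective t
    have := LinearMap.congr_fun h.yang_baxter t
    simp only [LinearMap.comp_apply] at this ⊢
    rw [T.on12_cubeMap, T.on23_cubeMap, T.on12_cubeMap, T.on23_cubeMap, T.on12_cubeMap,
      T.on23_cubeMap, this]
  comul_star x := by
    obtain ⟨x, rfl⟩ := e.surjective x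
    rw [← he, T.comul, T.comul, h.comul_star, starT_sqMap he]
  antipode_star x := by
    obtain ⟨x, rfl⟩ := e.surjective x
    rw [← he, T.antipode, T.antipode, h.antipode_star, he]
  tensor_star s t := by
    obtain ⟨s, rfl⟩ := (sqMap e).surjective s
    obtain ⟨t, rfl⟩ := (sqMap e).surjective t
    rw [T.braidedMul_sqMap, starT_sqMap he, starT_sqMap he, starT_sqMap he, T.braidedMul_sqMap,
      h.tensor_star]

end IsTransport

end

end

section

/-! ### Formulas for the first structure -/

/-- The braiding of a braided Hopf `*`-algebra structure commutes with the involution. -/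
theorem IsBraidedHopfStar.psi_star {H : HopfData q} (h : IsBraidedHopfStar H) (x y : BR q) :
    H.ψ (star y ⊗ₜ star x) = starT (H.ψ (x ⊗ₜ y)) := by
  have e : ∀ x y, braidedMul H.ψ ((1 ⊗ₜ x) ⊗ₜ (y ⊗ₜ 1)) = H.ψ (x ⊗ₜ y) := by
    intro x y
    rw [braidedMul_tmul, BorelAlg.lmul_one, BorelAlg.rmul_one]; rfl
  have h1 := h.tensor_star (1 ⊗ₜ x) (y ⊗ₜ 1)
  rw [e, starT_tmul, starT_tmul, star_one, e] at h1
  exact h1.symm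

theorem IsBraidedHopfStar.psi_ca {H : HopfData q} (h : IsBraidedHopfStar H) :
    H.ψ (𝐜 ⊗ₜ 𝐚) = starT (H.ψ (𝐚 ⊗ₜ 𝐛)) := by
  rw [← h.psi_star, BR.star_a, BR.star_b]

theorem IsBraidedHopfStar.psi_ba {H : HopfData q} (h : IsBraidedHopfStar H) :
    H.ψ (𝐛 ⊗ₜ 𝐚) = starT (H.ψ (𝐚 ⊗ₜ 𝐜)) := by
  rw [← h.psi_star, BR.star_a, BR.star_c]

theorem IsBraidedHopfStar.psi_cc {H : HopfData q} (h : IsBraidedHopfStar H) :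
    H.ψ (𝐜 ⊗ₜ 𝐜) = starT (H.ψ (𝐛 ⊗ₜ 𝐛)) := by
  rw [← h.psi_star, BR.star_b]

section
variable (hq : q ≠ 0)

theorem psi_p_tmul (x : BR q) : psi hq (𝐩 ⊗ₜ x) = x ⊗ₜ 𝐩 := by
  rw [psi_tmul, BorelAlg.T_p, BorelAlg.Tp_tmul, mul_one]

theorem psi_tmul_p (x : BR q) : psi hq (x ⊗ₜ 𝐩) = 𝐩 ⊗ₜ x := by
  have h := starT_psi hq (𝐩 ⊗ₜ star x)
  rw [psi_p_tmul, starT_tmul, starT_tmul, star_star, BR.star_p] at h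
  exact h.symm

theorem isFirst_first : IsFirst q (first hq) := by
  have hs := sq_ne_zero hq
  have hB1 : (BB hq).g = gam hq := rfl
  have hB2 : (BB hq).g' = gam' hq := rfl
  have hB3 : (BB hq).d = del hq := rfl
  have h1 : (first hq).Δ = Del hq := rfl
  have h2 : ∀ x, (first hq).ε x = eps hq x := fun _ => rfl
  have h3 : (first hq).S = ant hq := rfl
  have h4 : (first hq).ψ = psi hq := rfl
  have h5 := (isBraidedHopfStar_first hq).psi_ca
  have h6 := (isBraidedHopfStar_first hq).psi_ba
  have h7 := (isBraidedHopfStar_first hq).psi_cc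
  refine ⟨?_, ?_, ?_, ?_, ?_, ?_, ?_, ?_, ?_, ?_, ?_, ?_, ?_, ?_, ?_, ?_, ?_, ?_, h5, h6, h7⟩ <;>
    simp only [h1, h2, h3, h4, Del_a, Del_b, Del_c, Del_p, comulA, comulB, comulC, comulP, eps_a,
      eps_b, eps_c, eps_p, ant_a, ant_b, ant_c, ant_p, psi_tmul, zpow_neg_two, zpow_neg_four,
      zpow_neg_six, sq_def, BorelAlg.T_a, BorelAlg.T_b, BorelAlg.T_c, BorelAlg.Ta_tmul,
      BorelAlg.Tb_tmul, BorelAlg.Tc_tmul, hB1, hB2, hB3, gam_b, gam'_b, gam'_c, del_a, del_b, del_c,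
      del_p, mul_one, map_zero, TensorProduct.zero_tmul, map_smul, BR.w, TensorProduct.tmul_sub,
      TensorProduct.sub_tmul, map_sub, TensorProduct.tmul_smul, ← TensorProduct.smul_tmul'] <;>
    (match_scalars <;> field_simp <;> try ring)

theorem IsFirst.isMajid (hq : q ≠ 0) {H : HopfData q} (h : IsFirst q H)
    (hp : ∀ x, H.ψ (𝐩 ⊗ₜ x) = x ⊗ₜ 𝐩) (hp' : ∀ x, H.ψ (x ⊗ₜ 𝐩) = 𝐩 ⊗ₜ x) : IsMajid q H := by
  have hs := sq_ne_zero hq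
  have e : star (1 : BR q) = 1 := star_one _
  constructor <;>
    simp only [BR.d_eq, map_sub, map_smul, TensorProduct.tmul_sub, TensorProduct.sub_tmul,
      TensorProduct.tmul_smul, ← TensorProduct.smul_tmul', h.comul_a, h.comul_b, h.comul_c,
      h.comul_p, h.counit_a, h.counit_b, h.counit_c, h.counit_p, h.antipode_a, h.antipode_b,
      h.antipode_c, h.antipode_p, h.psi_aa, h.psi_ab, h.psi_ac, h.psi_bb, h.psi_cb, h.psi_bc,
      h.psi_ca, h.psi_ba, h.psi_cc, hp, hp', starT_add, starT_smul, starT_tmul, BR.star_a,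
      BR.star_b, BR.star_c, BR.star_p, zpow_neg_two, zpow_neg_four, zpow_neg_six, sq_def, star_sub,
      star_one, star_sq, star_inv₀, smul_eq_mul] <;>
    first
    | (match_scalars <;> field_simp <;> ring)
    | (field_simp; ring)

theorem isAnsatz_first : IsAnsatz q (first hq) := by
  have h := isFirst_first hq
  have hh := isBraidedHopfStar_first hq
  have e : ∀ k0 k1 k2 k3 k4 k8 : ℂ, quadratic q ![k0, k1, k2, k3, k4, 0, 0, 0, k8, 0, 0] =
      k0 • (𝐚 ⊗ₜ 𝐚) + k1 • (𝐛 ⊗ₜ 𝐜) + k2 • (𝐜 ⊗ₜ 𝐛) + k3 • (𝐩 ⊗ₜ 𝐚) + k4 • (𝐚 ⊗ₜ 𝐩)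
        + k8 • (𝐩 ⊗ₜ 𝐩) := by
    intro k0 k1 k2 k3 k4 k8
    have h0 : (![k0, k1, k2, k3, k4, 0, 0, 0, k8, 0, 0] : Fin 11 → ℂ) 10 = 0 := rfl
    have h1 : (![k0, k1, k2, k3, k4, 0, 0, 0, k8, 0, 0] : Fin 11 → ℂ) 9 = 0 := rfl
    have h2 : (![k0, k1, k2, k3, k4, 0, 0, 0, k8, 0, 0] : Fin 11 → ℂ) 8 = k8 := rfl
    simp [quadratic]
  exact
  { comul_a := ⟨![1, 1, 0, 0, 0, 0, 0, 0, 0, 0, 0], by rw [e, h.comul_a]; module⟩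
    comul_bc := ⟨![1, -𝐬⁻¹, 1, 0, 0, 0], by
      rw [h.comul_b, h.comul_c, zpow_neg_two]
      constructor <;> simp <;> module⟩
    comul_p := ⟨![𝐬⁻¹ + 𝐬⁻¹ ^ 2, 𝐬⁻¹, 1, -𝐬⁻¹, -𝐬⁻¹, 0, 0, 0, 1, 0, 0], by
      rw [e, h.comul_p, zpow_neg_two, zpow_neg_four]; module⟩
    counit := ⟨![1, 0, 1 + 𝐬⁻¹], h.counit_a, h.counit_b, h.counit_c,
      h.counit_p.trans (by rw [zpow_neg_two]; rfl)⟩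
    antipode_a := ⟨![-𝐬, 0, 0, 𝐬, 0], by rw [h.antipode_a, sq_def]; simp; module⟩
    antipode_bc := ⟨![0, -𝐬, 0, 0, 0], by rw [h.antipode_b, h.antipode_c, sq_def]; simp⟩
    antipode_p := ⟨![0, 0, 0, 1, 0], by rw [h.antipode_p]; simp⟩
    psi_aa := ⟨![1, 1 - 𝐬, 0, 0, 0, 0, 0, 0, 0, 0, 0], by rw [e, h.psi_aa, sq_def]; module⟩
    psi_ab := ⟨![1, 0, 0, 0, 0, 0], by rw [h.psi_ab]; simp⟩
    psi_ac := ⟨![1, 𝐬 - 𝐬⁻¹, 1 - 𝐬, 0, 0, 0], by rw [h.psi_ac, zpow_neg_two, sq_def]; simp⟩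
    psi_bb := ⟨𝐬, h.psi_bb⟩
    psi_cb := ⟨![0, 𝐬⁻¹, 0, 0, 0, 0, 0, 0, 0, 0, 0], by rw [e, h.psi_cb, zpow_neg_two]; module⟩
    psi_bc := ⟨![-1 - 𝐬⁻¹ + 𝐬⁻¹ ^ 2 + 𝐬⁻¹ ^ 3, 𝐬 - 1 - 𝐬⁻¹ + 𝐬⁻¹ ^ 2, 𝐬⁻¹, 1 - 𝐬⁻¹ ^ 2,
      1 - 𝐬⁻¹ ^ 2, 0, 0, 0, 𝐬⁻¹ - 1, 0, 0], by
      rw [e, h.psi_bc, zpow_neg_two, zpow_neg_four, zpow_neg_six, sq_def]; module⟩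
    psi_ca := hh.psi_ca
    psi_ba := hh.psi_ba
    psi_cc := hh.psi_cc
    psi_p_left := psi_p_tmul hq
    psi_p_right := psi_tmul_p hq }

end

/-! ### Isomorphisms that scale the generators -/

variable {q' : ℝ}

/-- The isomorphism `e` multiplies the generators by scalars. -/
structure Scales (e : BR q ≃ₐ[ℂ] BR q') (α β π : ℂ) : Prop where
  hα : α ≠ 0
  hβ : β ≠ 0
  hπ : π ≠ 0
  a : e 𝐚 = α • BR.a q'
  b : e 𝐛 = β • BR.b q'
  c : e 𝐜 = β • BR.c q'
  p : e 𝐩 = π • BR.p q'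

/-- The isomorphism `e` multiplies the generators by scalars and exchanges `b` and `c`. -/
structure Flips (e : BR q ≃ₐ[ℂ] BR q') (α β π : ℂ) : Prop where
  hα : α ≠ 0
  hβ : β ≠ 0
  hπ : π ≠ 0
  a : e 𝐚 = α • BR.a q'
  b : e 𝐛 = β • BR.c q'
  c : e 𝐜 = β • BR.b q'
  p : e 𝐩 = π • BR.p q'

namespace IsTransport
variable {e : BR q ≃ₐ[ℂ] BR q'} {H : HopfData q} {H' : HopfData q'} {c c' : ℂ} {x x' : BR q}
  {y y' : BR q'}

theorem comul_of_eq (T : IsTransport e H H') (hc : c ≠ 0) (h : e x = c • y) :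
    H'.Δ y = c⁻¹ • sqMap e (H.Δ x) := by
  rw [← T.comul, h, map_smul, smul_smul, inv_mul_cancel₀ hc, one_smul]

theorem counit_of_eq (T : IsTransport e H H') (hc : c ≠ 0) (h : e x = c • y) :
    H'.ε y = c⁻¹ * H.ε x := by
  rw [← T.counit, h, map_smul, smul_eq_mul, ← mul_assoc, inv_mul_cancel₀ hc, one_mul]

theorem antipode_of_eq (T : IsTransport e H H') (hc : c ≠ 0) (h : e x = c • y) :
    H'.S y = c⁻¹ • e (H.S x) := by
  rw [← T.antipode, h, map_smul, smul_smul, inv_mul_cancel₀ hc, one_smul]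

theorem psi_of_eq (T : IsTransport e H H') (hc : c ≠ 0) (hc' : c' ≠ 0) (h : e x = c • y)
    (h' : e x' = c' • y') : H'.ψ (y ⊗ₜ y') = (c * c')⁻¹ • sqMap e (H.ψ (x ⊗ₜ x')) := by
  rw [← T.psi, sqMap_tmul, h, h', TensorProduct.tmul_smul, ← TensorProduct.smul_tmul', map_smul,
    map_smul, smul_smul, smul_smul, mul_comm c c', mul_assoc, inv_mul_cancel₀ (mul_ne_zero hc' hc),
    one_smul]

end IsTransport

theorem Scales.quadratic {e : BR q ≃ₐ[ℂ] BR q'} {α β π : ℂ} (h : Scales e α β π)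
    (r : ℂ) (k : Fin 11 → ℂ) : ∃ k', r • sqMap e (quadratic q k) = BraidedSL.quadratic q' k' := by
  refine ⟨![r * (α * α * k 0), r * (β * β * k 1), r * (β * β * k 2), r * (π * α * k 3),
    r * (α * π * k 4), r * (α * k 5), r * (α * k 6), r * k 7, r * (π * π * k 8), r * (π * k 9),
    r * (π * k 10)], ?_⟩
  simp [BraidedSL.quadratic, sqMap_tmul, h.a, h.b, h.c, h.p, smul_smul, TensorProduct.tmul_smul,
    ← TensorProduct.smul_tmul']
  module

theorem Scales.isAnsatz {e : BR q ≃ₐ[ℂ] BR q'} {α β π : ℂ} (h : Scales e α β π)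
    {H : HopfData q} {H' : HopfData q'} (T : IsTransport e H H') (hH' : IsBraidedHopfStar H')
    (A : IsAnsatz q H) : IsAnsatz q' H' where
  comul_a := by
    obtain ⟨k, hk⟩ := A.comul_a
    rw [T.comul_of_eq h.hα h.a, hk]
    exact h.quadratic _ _
  comul_p := by
    obtain ⟨k, hk⟩ := A.comul_p
    rw [T.comul_of_eq h.hπ h.p, hk]
    exact h.quadratic _ _
  psi_aa := by
    obtain ⟨k, hk⟩ := A.psi_aa
    rw [T.psi_of_eq h.hα h.hα h.a h.a, hk]
    exact h.quadratic _ _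
  psi_cb := by
    obtain ⟨k, hk⟩ := A.psi_cb
    rw [T.psi_of_eq h.hβ h.hβ h.c h.b, hk]
    exact h.quadratic _ _
  psi_bc := by
    obtain ⟨k, hk⟩ := A.psi_bc
    rw [T.psi_of_eq h.hβ h.hβ h.b h.c, hk]
    exact h.quadratic _ _
  comul_bc := by
    obtain ⟨k, hb, hc⟩ := A.comul_bc
    rw [T.comul_of_eq h.hβ h.b, T.comul_of_eq h.hβ h.c, hb, hc]
    let r := β⁻¹
    refine ⟨![r * (α * β * k 0), r * (α * β * k 1), r * (β * π * k 2), r * (β * π * k 3),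
      r * (β * k 4), r * (β * k 5)], ?_⟩
    constructor <;>
    · simp [sqMap_tmul, h.a, h.b, h.c, h.p, smul_smul, TensorProduct.tmul_smul,
        ← TensorProduct.smul_tmul', r]
      module
  counit := by
    obtain ⟨k, ha, hb, hc, hp⟩ := A.counit
    refine ⟨![α⁻¹ * k 0, β⁻¹ * k 1, π⁻¹ * k 2], ?_, ?_, ?_, ?_⟩
    · rw [T.counit_of_eq h.hα h.a, ha]; rfl
    · rw [T.counit_of_eq h.hβ h.b, hb]; rfl
    · rw [T.counit_of_eq h.hβ h.c, hc]; rfl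
    · rw [T.counit_of_eq h.hπ h.p, hp]; rfl
  antipode_a := by
    obtain ⟨k, hk⟩ := A.antipode_a
    refine ⟨![α⁻¹ * (α * k 0), α⁻¹ * (β * k 1), α⁻¹ * (β * k 2), α⁻¹ * (π * k 3),
      α⁻¹ * k 4], ?_⟩
    rw [T.antipode_of_eq h.hα h.a, hk]
    simp [h.a, h.b, h.c, h.p, smul_smul]
    module
  antipode_p := by
    obtain ⟨k, hk⟩ := A.antipode_p
    refine ⟨![π⁻¹ * (α * k 0), π⁻¹ * (β * k 1), π⁻¹ * (β * k 2), π⁻¹ * (π * k 3),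
      π⁻¹ * k 4], ?_⟩
    rw [T.antipode_of_eq h.hπ h.p, hk]
    simp [h.a, h.b, h.c, h.p, smul_smul]
    module
  antipode_bc := by
    obtain ⟨k, hb, hc⟩ := A.antipode_bc
    refine ⟨![β⁻¹ * (α * k 0), β⁻¹ * (β * k 1), β⁻¹ * (β * k 2), β⁻¹ * (π * k 3),
      β⁻¹ * k 4], ?_⟩
    rw [T.antipode_of_eq h.hβ h.b, hb, T.antipode_of_eq h.hβ h.c, hc]
    constructor <;>
    · simp [h.a, h.b, h.c, h.p, smul_smul]
      module
  psi_ab := by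
    obtain ⟨k, hk⟩ := A.psi_ab
    let r := (α * β)⁻¹
    refine ⟨![r * (α * β * k 0), r * (α * β * k 1), r * (β * π * k 2), r * (β * π * k 3),
      r * (β * k 4), r * (β * k 5)], ?_⟩
    rw [T.psi_of_eq h.hα h.hβ h.a h.b, hk]
    simp [sqMap_tmul, h.a, h.b, h.p, smul_smul, TensorProduct.tmul_smul, ← TensorProduct.smul_tmul',
      r]
    module
  psi_ac := by
    obtain ⟨k, hk⟩ := A.psi_ac
    let r := (α * β)⁻¹
    refine ⟨![r * (α * β * k 0), r * (α * β * k 1), r * (β * π * k 2), r * (β * π * k 3),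
      r * (β * k 4), r * (β * k 5)], ?_⟩
    rw [T.psi_of_eq h.hα h.hβ h.a h.c, hk]
    simp [sqMap_tmul, h.a, h.c, h.p, smul_smul, TensorProduct.tmul_smul, ← TensorProduct.smul_tmul',
      r]
    module
  psi_bb := by
    obtain ⟨z, hz⟩ := A.psi_bb
    refine ⟨z, ?_⟩
    rw [T.psi_of_eq h.hβ h.hβ h.b h.b, hz]
    have := h.hβ
    simp [sqMap_tmul, h.b, smul_smul, TensorProduct.tmul_smul, ← TensorProduct.smul_tmul']
    match_scalars
    field_simp
  psi_ca := hH'.psi_ca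
  psi_ba := hH'.psi_ba
  psi_cc := hH'.psi_cc
  psi_p_left x := by
    obtain ⟨x, rfl⟩ := e.surjective x
    rw [T.psi_of_eq h.hπ one_ne_zero h.p (one_smul ℂ (e x)).symm, A.psi_p_left, sqMap_tmul, h.p,
      TensorProduct.tmul_smul, smul_smul, mul_one, inv_mul_cancel₀ h.hπ, one_smul]
  psi_p_right x := by
    obtain ⟨x, rfl⟩ := e.surjective x
    rw [T.psi_of_eq one_ne_zero h.hπ (one_smul ℂ (e x)).symm h.p, A.psi_p_right, sqMap_tmul, h.p,
      ← TensorProduct.smul_tmul', smul_smul, one_mul, inv_mul_cancel₀ h.hπ, one_smul]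

theorem Flips.quadratic {e : BR q ≃ₐ[ℂ] BR q'} {α β π : ℂ} (h : Flips e α β π)
    (r : ℂ) (k : Fin 11 → ℂ) : ∃ k', r • sqMap e (quadratic q k) = BraidedSL.quadratic q' k' := by
  refine ⟨![r * (α * α * k 0), r * (β * β * k 2), r * (β * β * k 1), r * (π * α * k 3),
    r * (α * π * k 4), r * (α * k 5), r * (α * k 6), r * k 7, r * (π * π * k 8), r * (π * k 9),
    r * (π * k 10)], ?_⟩
  simp [BraidedSL.quadratic, sqMap_tmul, h.a, h.b, h.c, h.p, smul_smul, TensorProduct.tmul_smul,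
    ← TensorProduct.smul_tmul']
  module

theorem Flips.isAnsatz {e : BR q ≃ₐ[ℂ] BR q'} {α β π : ℂ} (h : Flips e α β π)
    {H : HopfData q} {H' : HopfData q'} (T : IsTransport e H H') (hH' : IsBraidedHopfStar H')
    (A : IsAnsatz q H) : IsAnsatz q' H' where
  comul_a := by
    obtain ⟨k, hk⟩ := A.comul_a
    rw [T.comul_of_eq h.hα h.a, hk]
    exact h.quadratic _ _
  comul_p := by
    obtain ⟨k, hk⟩ := A.comul_p
    rw [T.comul_of_eq h.hπ h.p, hk]
    exact h.quadratic _ _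
  psi_aa := by
    obtain ⟨k, hk⟩ := A.psi_aa
    rw [T.psi_of_eq h.hα h.hα h.a h.a, hk]
    exact h.quadratic _ _
  psi_cb := by
    obtain ⟨k, hk⟩ := A.psi_bc
    rw [T.psi_of_eq h.hβ h.hβ h.b h.c, hk]
    exact h.quadratic _ _
  psi_bc := by
    obtain ⟨k, hk⟩ := A.psi_cb
    rw [T.psi_of_eq h.hβ h.hβ h.c h.b, hk]
    exact h.quadratic _ _
  comul_bc := by
    obtain ⟨k, hb, hc⟩ := A.comul_bc
    rw [T.comul_of_eq h.hβ h.b, T.comul_of_eq h.hβ h.c, hb, hc]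
    let r := β⁻¹
    refine ⟨![r * (α * β * k 1), r * (α * β * k 0), r * (β * π * k 3), r * (β * π * k 2),
      r * (β * k 5), r * (β * k 4)], ?_⟩
    constructor <;>
    · simp [sqMap_tmul, h.a, h.b, h.c, h.p, smul_smul, TensorProduct.tmul_smul,
        ← TensorProduct.smul_tmul', r]
      module
  counit := by
    obtain ⟨k, ha, hb, hc, hp⟩ := A.counit
    refine ⟨![α⁻¹ * k 0, β⁻¹ * k 1, π⁻¹ * k 2], ?_, ?_, ?_, ?_⟩
    · rw [T.counit_of_eq h.hα h.a, ha]; rfl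
    · rw [T.counit_of_eq h.hβ h.c, hc]; rfl
    · rw [T.counit_of_eq h.hβ h.b, hb]; rfl
    · rw [T.counit_of_eq h.hπ h.p, hp]; rfl
  antipode_a := by
    obtain ⟨k, hk⟩ := A.antipode_a
    refine ⟨![α⁻¹ * (α * k 0), α⁻¹ * (β * k 2), α⁻¹ * (β * k 1), α⁻¹ * (π * k 3),
      α⁻¹ * k 4], ?_⟩
    rw [T.antipode_of_eq h.hα h.a, hk]
    simp [h.a, h.b, h.c, h.p, smul_smul]
    module
  antipode_p := by
    obtain ⟨k, hk⟩ := A.antipode_p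
    refine ⟨![π⁻¹ * (α * k 0), π⁻¹ * (β * k 2), π⁻¹ * (β * k 1), π⁻¹ * (π * k 3),
      π⁻¹ * k 4], ?_⟩
    rw [T.antipode_of_eq h.hπ h.p, hk]
    simp [h.a, h.b, h.c, h.p, smul_smul]
    module
  antipode_bc := by
    obtain ⟨k, hb, hc⟩ := A.antipode_bc
    refine ⟨![β⁻¹ * (α * k 0), β⁻¹ * (β * k 1), β⁻¹ * (β * k 2), β⁻¹ * (π * k 3),
      β⁻¹ * k 4], ?_⟩
    rw [T.antipode_of_eq h.hβ h.b, hb, T.antipode_of_eq h.hβ h.c, hc]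
    constructor <;>
    · simp [h.a, h.b, h.c, h.p, smul_smul]
      module
  psi_ab := by
    obtain ⟨k, hk⟩ := A.psi_ac
    let r := (α * β)⁻¹
    refine ⟨![r * (α * β * k 0), r * (α * β * k 1), r * (β * π * k 2), r * (β * π * k 3),
      r * (β * k 4), r * (β * k 5)], ?_⟩
    rw [T.psi_of_eq h.hα h.hβ h.a h.c, hk]
    simp [sqMap_tmul, h.a, h.c, h.p, smul_smul, TensorProduct.tmul_smul, ← TensorProduct.smul_tmul',
      r]
    module
  psi_ac := by
    obtain ⟨k, hk⟩ := A.psi_ab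
    let r := (α * β)⁻¹
    refine ⟨![r * (α * β * k 0), r * (α * β * k 1), r * (β * π * k 2), r * (β * π * k 3),
      r * (β * k 4), r * (β * k 5)], ?_⟩
    rw [T.psi_of_eq h.hα h.hβ h.a h.b, hk]
    simp [sqMap_tmul, h.a, h.b, h.p, smul_smul, TensorProduct.tmul_smul, ← TensorProduct.smul_tmul',
      r]
    module
  psi_bb := by
    obtain ⟨z, hz⟩ := A.psi_bb
    have hz' := A.psi_cc
    rw [hz, starT_smul, starT_tmul, BR.star_b] at hz'
    refine ⟨star z, ?_⟩
    rw [T.psi_of_eq h.hβ h.hβ h.c h.c, hz']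
    have := h.hβ
    simp [sqMap_tmul, h.c, smul_smul, TensorProduct.tmul_smul, ← TensorProduct.smul_tmul']
    match_scalars
    field_simp
  psi_ca := hH'.psi_ca
  psi_ba := hH'.psi_ba
  psi_cc := hH'.psi_cc
  psi_p_left x := by
    obtain ⟨x, rfl⟩ := e.surjective x
    rw [T.psi_of_eq h.hπ one_ne_zero h.p (one_smul ℂ (e x)).symm, A.psi_p_left, sqMap_tmul, h.p,
      TensorProduct.tmul_smul, smul_smul, mul_one, inv_mul_cancel₀ h.hπ, one_smul]
  psi_p_right x := by
    obtain ⟨x, rfl⟩ := e.surjective x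
    rw [T.psi_of_eq one_ne_zero h.hπ (one_smul ℂ (e x)).symm h.p, A.psi_p_right, sqMap_tmul, h.p,
      ← TensorProduct.smul_tmul', smul_smul, one_mul, inv_mul_cancel₀ h.hπ, one_smul]

end

section

/-! ### The sign automorphism -/

theorem signHom_a : signHom q 𝐚 = -𝐚 := signHom_gen q .a
theorem signHom_b : signHom q 𝐛 = -𝐛 := signHom_gen q .b
theorem signHom_c : signHom q 𝐜 = -𝐜 := signHom_gen q .c
theorem signHom_p : signHom q 𝐩 = -𝐩 := by
  have h : signHom q (BR.d q) = -BR.d q := signHom_gen q .d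
  rw [BR.p, map_add, map_smul, signHom_a, h, smul_neg, neg_add]

theorem signHom_signHom (hq : q ≠ 0) (x : BR q) : signHom q (signHom q x) = x :=
  BR.hom_ext (f := (signHom q).comp (signHom q)) (g := AlgHom.id ℂ _) (by simp [signHom_a])
    (by simp [signHom_b]) (by simp [signHom_c]) (by simp [signHom_p]) x

/-- The sign automorphism as an equivalence. -/
def signEquiv (hq : q ≠ 0) : BR q ≃ₐ[ℂ] BR q :=
  AlgEquiv.ofAlgHom (signHom q) (signHom q) (AlgHom.ext (signHom_signHom hq))
    (AlgHom.ext (signHom_signHom hq))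

theorem scales_signEquiv (hq : q ≠ 0) : Scales (signEquiv hq) (-1) (-1) (-1) where
  hα := by simp
  hβ := by simp
  hπ := by simp
  a := by rw [neg_one_smul]; exact signHom_a
  b := by rw [neg_one_smul]; exact signHom_b
  c := by rw [neg_one_smul]; exact signHom_c
  p := by rw [neg_one_smul]; exact signHom_p

theorem isTransport_signTwist (hq : q ≠ 0) (H : HopfData q) :
    IsTransport (signEquiv hq) H H.signTwist where
  comul x := by
    change TensorProduct.map _ _ (H.Δ (signHom q (signHom q x))) = _
    rw [signHom_signHom hq]; rfl
  counit x := by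
    change H.ε (signHom q (signHom q x)) = _
    rw [signHom_signHom hq]
  antipode x := by
    change signHom q (H.S (signHom q (signHom q x))) = _
    rw [signHom_signHom hq]; rfl
  psi t := by
    have h : ∀ t, TensorProduct.map (signHom q).toLinearMap (signHom q).toLinearMap
        (sqMap (signEquiv hq) t) = t := by
      intro t
      induction t using TensorProduct.induction_on with
      | zero => simp
      | add s s' h h' => simp only [map_add, h, h']
      | tmul x y =>
        exact congrArg₂ (· ⊗ₜ ·) (signHom_signHom hq x) (signHom_signHom hq y)
    change TensorProduct.map _ _ (H.ψ (TensorProduct.map _ _ (sqMap (signEquiv hq) t))) = _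
    rw [h]; rfl

theorem signEquiv_symm (hq : q ≠ 0) : (signEquiv hq).symm = signEquiv hq := rfl

theorem signTwist_signTwist (hq : q ≠ 0) (H : HopfData q) : H.signTwist.signTwist = H :=
  (isTransport_signTwist hq H.signTwist).unique
    (by simpa [signEquiv_symm] using (isTransport_signTwist hq H).symm)

/-- A `*`-compatibility that holds on generators holds everywhere. -/
theorem star_map {q' : ℝ} {e : BR q ≃ₐ[ℂ] BR q'} (ha : e (star 𝐚) = star (e 𝐚))
    (hb : e (star 𝐛) = star (e 𝐛)) (hc : e (star 𝐜) = star (e 𝐜)) (hp : e (star 𝐩) = star (e 𝐩))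
    (x : BR q) : e (star x) = star (e x) := by
  refine BR.ind (P := fun x => e (star x) = star (e x)) (by simp) ?_ ?_ ?_ ha hb hc hp x
  · intro r x h; rw [star_smul, map_smul, map_smul, star_smul, h]
  · intro x y hx hy; rw [star_add, map_add, map_add, star_add, hx, hy]
  · intro x y hx hy; rw [star_mul, map_mul, map_mul, star_mul, hx, hy]

theorem signEquiv_star (hq : q ≠ 0) (x : BR q) :
    signEquiv hq (star x) = star (signEquiv hq x) := by
  have h := scales_signEquiv hq
  refine star_map ?_ ?_ ?_ ?_ x <;>
    simp [h.a, h.b, h.c, h.p, BR.star_a, BR.star_b, BR.star_c, BR.star_p]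

theorem IsSolution.signTwist (hq : q ≠ 0) {H : HopfData q} (h : IsSolution q H) :
    IsSolution q H.signTwist :=
  have T := isTransport_signTwist hq H
  have hh := T.isBraidedHopfStar (signEquiv_star hq) h.1
  ⟨hh, (scales_signEquiv hq).isAnsatz T hh h.2⟩

/-! ### The isomorphism between the algebras with parameters `q` and `q⁻¹` -/

section
variable {q' : ℝ}

theorem sq_mul_sq (h : q * q' = 1) : sq q * sq q' = 1 := by
  rw [sq, sq, ← mul_pow, ← Complex.ofReal_mul, h]; simp

theorem ne_zero_of_mul (h : q * q' = 1) : q ≠ 0 := left_ne_zero_of_mul (h ▸ one_ne_zero)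

theorem flip_relations (h : q * q' = 1) : Relations q (BR.a q') (sq q' • BR.c q')
    (sq q' • BR.b q') (sq q' • BR.p q') := by
  have hq' : q' ≠ 0 := ne_zero_of_mul ((mul_comm q' q).trans h)
  have hs := sq_ne_zero hq'
  have hr := BR.relations hq'
  have e : sq q = (sq q')⁻¹ := eq_inv_of_mul_eq_one_left (sq_mul_sq h)
  constructor <;>
    simp only [e, smul_mul_assoc, mul_smul_comm, hr.ba, hr.ca, hr.pa, hr.pb, hr.pc, hr.cb,
      hr.bc] <;>
    match_scalars <;> field_simp

/-- The algebra map `a ↦ a`, `b ↦ q'² c`, `c ↦ q'² b`, `p ↦ q'² p`, where `q q' = 1`. -/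
def flipHom (h : q * q' = 1) : BR q →ₐ[ℂ] BR q' :=
  BR.liftP (ne_zero_of_mul h) (flip_relations h)

theorem flipHom_flipHom (h : q * q' = 1) (h' : q' * q = 1) (x : BR q) :
    flipHom h' (flipHom h x) = x := by
  have e := sq_mul_sq h'
  exact BR.hom_ext (f := (flipHom h').comp (flipHom h)) (g := AlgHom.id ℂ _)
    (by simp [flipHom, BR.liftP_a]) (by simp [flipHom, BR.liftP_b, BR.liftP_c, smul_smul, e])
    (by simp [flipHom, BR.liftP_b, BR.liftP_c, smul_smul, e])
    (by simp [flipHom, BR.liftP_p, smul_smul, e]) x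

/-- The isomorphism of the algebras with inverse parameters, exchanging `b` and `c`. -/
def flipEquiv (h : q * q' = 1) : BR q ≃ₐ[ℂ] BR q' :=
  AlgEquiv.ofAlgHom (flipHom h) (flipHom ((mul_comm q' q).trans h))
    (AlgHom.ext (flipHom_flipHom _ _)) (AlgHom.ext (flipHom_flipHom _ _))

theorem flips_flipEquiv (h : q * q' = 1) : Flips (flipEquiv h) 1 (sq q') (sq q') where
  hα := one_ne_zero
  hβ := sq_ne_zero (ne_zero_of_mul ((mul_comm q' q).trans h))
  hπ := sq_ne_zero (ne_zero_of_mul ((mul_comm q' q).trans h))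
  a := by rw [one_smul]; exact BR.liftP_a ..
  b := BR.liftP_b ..
  c := BR.liftP_c ..
  p := BR.liftP_p ..

theorem flipEquiv_star (h : q * q' = 1) (x : BR q) :
    flipEquiv h (star x) = star (flipEquiv h x) := by
  have h := flips_flipEquiv h
  refine star_map ?_ ?_ ?_ ?_ x <;>
    simp [h.a, h.b, h.c, h.p, BR.star_a, BR.star_b, BR.star_c, BR.star_p, star_sq, star_smul]

theorem IsSolution.transport_flip (h : q * q' = 1) {H : HopfData q} (hH : IsSolution q H) :
    IsSolution q' (H.transport (flipEquiv h)) :=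
  have T := isTransport_transport (flipEquiv h) H
  have hh := T.isBraidedHopfStar (flipEquiv_star h) hH.1
  ⟨hh, (flips_flipEquiv h).isAnsatz T hh hH.2⟩

theorem transport_flip_flip (h : q * q' = 1) (h' : q' * q = 1) (H : HopfData q) :
    (H.transport (flipEquiv h)).transport (flipEquiv h') = H :=
  (isTransport_transport (flipEquiv h') _).unique (isTransport_transport (flipEquiv h) H).symm

end

/-! ### The second structure -/

section
variable (hq : q ≠ 0)

/-- The second structure: the transport of the first structure for `q⁻¹`. -/
def second : HopfData q :=
  (first (inv_ne_zero hq)).transport (flipEquiv (inv_mul_cancel₀ hq))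

theorem isSolution_first : IsSolution q (first hq) :=
  ⟨isBraidedHopfStar_first hq, isAnsatz_first hq⟩

theorem isSolution_second : IsSolution q (second hq) :=
  (isSolution_first (inv_ne_zero hq)).transport_flip _

theorem isSecond_second : IsSecond q (second hq) := by
  have hs := sq_ne_zero hq
  have e : sq q⁻¹ = 𝐬⁻¹ := eq_inv_of_mul_eq_one_left (sq_mul_sq (inv_mul_cancel₀ hq))
  have F := flips_flipEquiv (inv_mul_cancel₀ hq)
  have T := isTransport_transport (flipEquiv (inv_mul_cancel₀ hq)) (first (inv_ne_zero hq))
  have f := isFirst_first (inv_ne_zero hq)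
  have h := (isSolution_second hq).1
  have hsec : (first (inv_ne_zero hq)).transport (flipEquiv (inv_mul_cancel₀ hq)) = second hq := rfl
  rw [hsec] at T
  refine ⟨?_, ?_, ?_, ?_, ?_, ?_, ?_, ?_, ?_, ?_, ?_, ?_, ?_, ?_, ?_, ?_, ?_, ?_, h.psi_ca,
    h.psi_ba, h.psi_cc⟩
  · rw [T.comul_of_eq F.hα F.a, f.comul_a]
    simp only [sqMap_tmul, F.a, F.b, F.c, TensorProduct.tmul_smul, ← TensorProduct.smul_tmul',
      pow_four, map_add, one_smul]
    match_scalars <;> field_simp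
  · rw [T.comul_of_eq F.hβ F.c, f.comul_c]
    simp only [sqMap_tmul, F.a, F.c, F.p, TensorProduct.tmul_smul, ← TensorProduct.smul_tmul',
      zpow_neg_two, sq_def, e, map_add, map_sub, map_smul, one_smul]
    match_scalars <;> field_simp
  · rw [T.comul_of_eq F.hβ F.b, f.comul_b]
    simp only [sqMap_tmul, F.a, F.b, F.p, TensorProduct.tmul_smul, ← TensorProduct.smul_tmul',
      zpow_neg_two, sq_def, e, map_add, map_sub, map_smul, one_smul]
    match_scalars <;> field_simp
  · rw [T.comul_of_eq F.hπ F.p, f.comul_p]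
    simp only [sqMap_tmul, F.a, F.b, F.c, F.p, TensorProduct.tmul_smul, ← TensorProduct.smul_tmul',
      pow_four, zpow_neg_two, zpow_neg_four, sq_def, e, map_add, map_sub, map_smul, one_smul]
    match_scalars <;> field_simp
  · rw [T.counit_of_eq F.hα F.a, f.counit_a]
    simp
  · rw [T.counit_of_eq F.hβ F.c, f.counit_c]
    simp
  · rw [T.counit_of_eq F.hβ F.b, f.counit_b]
    simp
  · rw [T.counit_of_eq F.hπ F.p, f.counit_p]
    simp only [zpow_neg_two, e]
    field_simp
    try ring
  · rw [T.antipode_of_eq F.hα F.a, f.antipode_a]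
    simp only [F.a, F.p, zpow_neg_two, sq_def, e, map_sub, map_smul, one_smul]
    match_scalars <;> field_simp
  · rw [T.antipode_of_eq F.hβ F.c, f.antipode_c]
    simp only [F.c, zpow_neg_two, sq_def, e, map_smul, map_neg]
    match_scalars <;> field_simp
  · rw [T.antipode_of_eq F.hβ F.b, f.antipode_b]
    simp only [F.b, zpow_neg_two, sq_def, e, map_smul, map_neg]
    match_scalars <;> field_simp
  · rw [T.antipode_of_eq F.hπ F.p, f.antipode_p]
    simp only [F.p]
    match_scalars <;> field_simp
  · rw [T.psi_of_eq F.hα F.hα F.a F.a, f.psi_aa]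
    simp only [sqMap_tmul, F.a, F.b, F.c, TensorProduct.tmul_smul, ← TensorProduct.smul_tmul',
      pow_four, sq_def, e, map_add, map_smul, one_smul]
    match_scalars <;> field_simp
  · rw [T.psi_of_eq F.hα F.hβ F.a F.c, f.psi_ac]
    simp only [sqMap_tmul, F.a, F.c, F.p, TensorProduct.tmul_smul, ← TensorProduct.smul_tmul',
      zpow_neg_two, sq_def, e, map_add, map_smul, one_smul]
    match_scalars <;> field_simp
  · rw [T.psi_of_eq F.hα F.hβ F.a F.b, f.psi_ab]
    simp only [sqMap_tmul, F.a, F.b, ← TensorProduct.smul_tmul', one_smul]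
    match_scalars <;> field_simp
  · rw [T.psi_of_eq F.hβ F.hβ F.c F.c, f.psi_cc, f.psi_bb, starT_smul, starT_tmul, BR.star_b,
      sq_def, star_sq]
    simp only [sqMap_tmul, F.c, TensorProduct.tmul_smul, ← TensorProduct.smul_tmul', zpow_neg_two,
      e, map_smul]
    match_scalars <;> field_simp
  · rw [T.psi_of_eq F.hβ F.hβ F.c F.b, f.psi_cb]
    simp only [sqMap_tmul, F.b, F.c, TensorProduct.tmul_smul, ← TensorProduct.smul_tmul',
      zpow_neg_two, sq_def, e, map_smul]
    match_scalars <;> field_simp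
  · rw [T.psi_of_eq F.hβ F.hβ F.b F.c, f.psi_bc]
    simp only [sqMap_tmul, F.a, F.b, F.c, F.p, TensorProduct.tmul_smul, ← TensorProduct.smul_tmul',
      pow_four, zpow_neg_two, zpow_neg_four, zpow_neg_six, sq_def, e, map_add, map_smul, one_smul]
    match_scalars <;> field_simp <;> try ring

end

end

section

/-! ### Linear independence of the monomials of degree at most two -/

/-- The ordered monomials of degree at most two in `a, b, c, p`; the products `b c` and `c b`
are combinations of the others. -/
inductive Mon
  | one | a | p | aa | ap | pp | b | ab | bp | c | ac | cp | bb | cc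
  deriving DecidableEq

/-- The scalar by which `c b` acts on the `n`-th weight space, when `a` acts on it by `α sⁿ` and
`p` by `π`. -/
def weight (q : ℝ) (α π : ℂ) (n : ℤ) : ℂ :=
  (sq q)⁻¹ * (α * sq q ^ n * π) - ((sq q)⁻¹) ^ 2 * (α * sq q ^ n) ^ 2 - (sq q)⁻¹

/-- The action of `a` on sequences, in the weight representation with parameter `α`. -/
def wtA (q : ℝ) (α : ℂ) : Module.End ℂ (ℤ → ℂ) where
  toFun f n := α * sq q ^ n * f n
  map_add' f g := by funext n; simp [mul_add]
  map_smul' r f := by funext n; simp [mul_left_comm]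

/-- The action of `b` lowers the weight. The weight factors are distributed over `b` and `c` in
such a way that `b` and `c` both act without factors when they move away from weight zero. -/
def wtB (q : ℝ) (α π : ℂ) : Module.End ℂ (ℤ → ℂ) where
  toFun f n := (if n + 1 ≤ 0 then 1 else weight q α π (n + 1)) * f (n + 1)
  map_add' f g := by funext n; simp [mul_add]
  map_smul' r f := by funext n; simp [mul_left_comm]

/-- The action of `c` raises the weight. -/
def wtC (q : ℝ) (α π : ℂ) : Module.End ℂ (ℤ → ℂ) where
  toFun f n := (if n ≤ 0 then weight q α π n else 1) * f (n - 1)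
  map_add' f g := by funext n; simp [mul_add]
  map_smul' r f := by funext n; simp [mul_left_comm]

/-- The weight representations of `B(R)`. Their matrix coefficients separate the monomials. -/
theorem weight_relations (hq : q ≠ 0) (α π : ℂ) :
    Relations q (wtA q α) (wtB q α π) (wtC q α π) (π • (1 : Module.End ℂ (ℤ → ℂ))) := by
  have hs := sq_ne_zero hq
  constructor <;> ext1 f <;> funext n <;>
    simp only [wtA, wtB, wtC, Module.End.mul_apply, LinearMap.coe_mk, AddHom.coe_mk,
      LinearMap.smul_apply, Pi.smul_apply, smul_eq_mul, Module.End.one_apply, LinearMap.sub_apply,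
      Pi.sub_apply, sub_add_cancel, add_sub_cancel_right, zpow_add₀ hs, zpow_sub₀ hs, zpow_one]
  · ring
  · field_simp
  · ring
  · ring
  · ring
  · split_ifs <;> simp only [weight] <;> ring
  · split_ifs <;> simp only [weight, zpow_add₀ hs, zpow_one] <;> field_simp

/-- The monomial as an element of `B(R)`. -/
def Mon.toBR (q : ℝ) : Mon → BR q
  | .one => 1
  | .a => BR.a q
  | .p => BR.p q
  | .aa => BR.a q * BR.a q
  | .ap => BR.a q * BR.p q
  | .pp => BR.p q * BR.p q
  | .b => BR.b q
  | .ab => BR.a q * BR.b q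
  | .bp => BR.b q * BR.p q
  | .c => BR.c q
  | .ac => BR.a q * BR.c q
  | .cp => BR.c q * BR.p q
  | .bb => BR.b q * BR.b q
  | .cc => BR.c q * BR.c q

section
variable (hq : q ≠ 0)

/-- The matrix coefficient of the weight representation with parameters `α, π` that sends `x`
to the component of weight `n` of `x e₀`. -/
def ev (n : ℤ) (α π : ℂ) : BR q →ₗ[ℂ] ℂ :=
  LinearMap.proj n ∘ₗ LinearMap.applyₗ (Pi.single (0 : ℤ) (1 : ℂ)) ∘ₗ
    (BR.liftP hq (weight_relations hq α π)).toLinearMap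

theorem ev_apply (n : ℤ) (α π : ℂ) (x : BR q) :
    ev hq n α π x = BR.liftP hq (weight_relations hq α π) x (Pi.single (0 : ℤ) (1 : ℂ)) n := rfl

/-- The coefficient of a monomial, obtained by interpolation in the parameters `α` and `π`. -/
def coef : Mon → BR q →ₗ[ℂ] ℂ
  | .one => ev hq 0 0 0
  | .a => (1 / 2 : ℂ) • (ev hq 0 1 0 - ev hq 0 (-1) 0)
  | .p => (1 / 2 : ℂ) • (ev hq 0 0 1 - ev hq 0 0 (-1))
  | .aa => (1 / 2 : ℂ) • (ev hq 0 1 0 + ev hq 0 (-1) 0) - ev hq 0 0 0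
  | .ap => ev hq 0 1 1 - ev hq 0 1 0 - ev hq 0 0 1 + ev hq 0 0 0
  | .pp => (1 / 2 : ℂ) • (ev hq 0 0 1 + ev hq 0 0 (-1)) - ev hq 0 0 0
  | .b => ev hq (-1) 0 0
  | .ab => 𝐬 • (ev hq (-1) 1 0 - ev hq (-1) 0 0)
  | .bp => ev hq (-1) 0 1 - ev hq (-1) 0 0
  | .c => ev hq 1 0 0
  | .ac => 𝐬⁻¹ • (ev hq 1 1 0 - ev hq 1 0 0)
  | .cp => ev hq 1 0 1 - ev hq 1 0 0
  | .bb => ev hq (-2) 0 0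
  | .cc => ev hq 2 0 0

set_option maxHeartbeats 1000000 in
theorem coef_toBR (i j : Mon) : coef hq i (j.toBR q) = if i = j then 1 else 0 := by
  have hs := sq_ne_zero hq
  cases j <;> cases i <;> simp [coef, ev_apply, BR.liftP_a, BR.liftP_b, BR.liftP_c, BR.liftP_p,
    wtA, wtB, wtC, Pi.single_apply, hs, Mon.toBR] <;> norm_num

theorem coef_one (i : Mon) : coef hq i 1 = if i = .one then 1 else 0 :=
  coef_toBR hq i .one

theorem coef_a (i : Mon) : coef hq i 𝐚 = if i = .a then 1 else 0 :=
  coef_toBR hq i .a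

theorem coef_p (i : Mon) : coef hq i 𝐩 = if i = .p then 1 else 0 :=
  coef_toBR hq i .p

theorem coef_aa (i : Mon) : coef hq i (𝐚 * 𝐚) = if i = .aa then 1 else 0 :=
  coef_toBR hq i .aa

theorem coef_ap (i : Mon) : coef hq i (𝐚 * 𝐩) = if i = .ap then 1 else 0 :=
  coef_toBR hq i .ap

theorem coef_pp (i : Mon) : coef hq i (𝐩 * 𝐩) = if i = .pp then 1 else 0 :=
  coef_toBR hq i .pp

theorem coef_b (i : Mon) : coef hq i 𝐛 = if i = .b then 1 else 0 :=
  coef_toBR hq i .b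

theorem coef_ab (i : Mon) : coef hq i (𝐚 * 𝐛) = if i = .ab then 1 else 0 :=
  coef_toBR hq i .ab

theorem coef_bp (i : Mon) : coef hq i (𝐛 * 𝐩) = if i = .bp then 1 else 0 :=
  coef_toBR hq i .bp

theorem coef_c (i : Mon) : coef hq i 𝐜 = if i = .c then 1 else 0 :=
  coef_toBR hq i .c

theorem coef_ac (i : Mon) : coef hq i (𝐚 * 𝐜) = if i = .ac then 1 else 0 :=
  coef_toBR hq i .ac

theorem coef_cp (i : Mon) : coef hq i (𝐜 * 𝐩) = if i = .cp then 1 else 0 :=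
  coef_toBR hq i .cp

theorem coef_bb (i : Mon) : coef hq i (𝐛 * 𝐛) = if i = .bb then 1 else 0 :=
  coef_toBR hq i .bb

theorem coef_cc (i : Mon) : coef hq i (𝐜 * 𝐜) = if i = .cc then 1 else 0 :=
  coef_toBR hq i .cc

end

end

section

/-! ### Comparison of coefficients in tensor products -/

section
variable (hq : q ≠ 0)

/-- The coefficient of a pair of monomials in `B(R) ⊗ B(R)`. -/
def coef₂ (i j : Mon) : BR q ⊗[ℂ] BR q →ₗ[ℂ] ℂ :=
  LinearMap.mul' ℂ ℂ ∘ₗ TensorProduct.map (coef hq i) (coef hq j)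

theorem coef₂_tmul (i j : Mon) (x y : BR q) :
    coef₂ hq i j (x ⊗ₜ y) = coef hq i x * coef hq j y := rfl

/-- The coefficient of a triple of monomials in the triple tensor product. -/
def coef₃ (i j k : Mon) : (BR q ⊗[ℂ] BR q) ⊗[ℂ] BR q →ₗ[ℂ] ℂ :=
  LinearMap.mul' ℂ ℂ ∘ₗ TensorProduct.map (coef₂ hq i j) (coef hq k)

theorem coef₃_tmul (i j k : Mon) (s : BR q ⊗[ℂ] BR q) (z : BR q) :
    coef₃ hq i j k (s ⊗ₜ z) = coef₂ hq i j s * coef hq k z := rfl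

theorem coef₃_symm (i j k : Mon) (x : BR q) (s : BR q ⊗[ℂ] BR q) :
    coef₃ hq i j k ((asc q).symm (x ⊗ₜ s)) = coef hq i x * coef₂ hq j k s := by
  induction s using TensorProduct.induction_on with
  | zero => simp
  | add s s' h h' => simp only [TensorProduct.tmul_add, map_add, h, h', mul_add]
  | tmul m y => rw [TensorProduct.assoc_symm_tmul, coef₃_tmul, coef₂_tmul, coef₂_tmul, mul_assoc]

end

/-- The involution of the index set of `quadratic` given by `*` on tensors. -/
def quadStar (k : Fin 11 → ℂ) : Fin 11 → ℂ :=
  ![star (k 0), star (k 1), star (k 2), star (k 4), star (k 3), star (k 6), star (k 5),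
    star (k 7), star (k 8), star (k 10), star (k 9)]

theorem starT_quadratic (k : Fin 11 → ℂ) : starT (quadratic q k) = quadratic q (quadStar k) := by
  simp only [quadratic, starT_add, starT_smul, starT_tmul, BR.star_a, BR.star_b, BR.star_c,
    BR.star_p, star_one, quadStar]
  simp only [Matrix.cons_val]
  abel

theorem quadratic_injective (hq : q ≠ 0) {k l : Fin 11 → ℂ} (h : quadratic q k = quadratic q l) :
    k = l := by
  have E := fun i j => congrArg (coef₂ hq i j) h
  simp only [quadratic, map_add, map_smul, coef₂_tmul, coef_one, coef_a, coef_b, coef_c, coef_p,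
    smul_eq_mul] at E
  funext i
  fin_cases i
  · simpa using E .a .a
  · simpa using E .b .c
  · simpa using E .c .b
  · simpa using E .p .a
  · simpa using E .a .p
  · simpa using E .one .a
  · simpa using E .a .one
  · simpa using E .one .one
  · simpa using E .p .p
  · simpa using E .one .p
  · simpa using E .p .one

theorem quadStar_of_starT (hq : q ≠ 0) {k : Fin 11 → ℂ}
    (h : quadratic q k = starT (quadratic q k)) : k = quadStar k :=
  quadratic_injective hq (h.trans (starT_quadratic k))

/-- Left multiplication by `u` in the first argument of `ψ`, expressed on the values of `ψ`:
`ψ(u v ⊗ x) = leftAct ψ u (ψ(v ⊗ x))`. -/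
def leftAct (ψ : BR q ⊗[ℂ] BR q →ₗ[ℂ] BR q ⊗[ℂ] BR q) (u : BR q) :
    BR q ⊗[ℂ] BR q →ₗ[ℂ] BR q ⊗[ℂ] BR q :=
  m23 q ∘ₗ on12 ψ ∘ₗ (asc q).symm.toLinearMap ∘ₗ TensorProduct.mk ℂ (BR q) (BR q ⊗[ℂ] BR q) u

theorem leftAct_tmul (ψ : BR q ⊗[ℂ] BR q →ₗ[ℂ] BR q ⊗[ℂ] BR q) (u x v : BR q) :
    leftAct ψ u (x ⊗ₜ v) = BorelAlg.rmul (BR q) v (ψ (u ⊗ₜ x)) := by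
  rw [← m23_tmul]; rfl

namespace IsBraidedHopfStar
variable {H : HopfData q}

theorem psi_mul_tmul (h : IsBraidedHopfStar H) (u v x : BR q) :
    H.ψ ((u * v) ⊗ₜ x) = leftAct H.ψ u (H.ψ (v ⊗ₜ x)) := by
  have := LinearMap.congr_fun h.psi_mul_left ((u ⊗ₜ v) ⊗ₜ x)
  simp only [LinearMap.comp_apply, m12_tmul] at this
  rw [this, ← TensorProduct.assoc_symm_tmul, on23_symm]; rfl

theorem leftAct_ba (h : IsBraidedHopfStar H) (x : BR q) :
    leftAct H.ψ 𝐛 (H.ψ (𝐚 ⊗ₜ x)) = 𝐬 • leftAct H.ψ 𝐚 (H.ψ (𝐛 ⊗ₜ x)) := by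
  rw [← h.psi_mul_tmul, ← h.psi_mul_tmul, BR.b_mul_a, ← TensorProduct.smul_tmul', map_smul]

theorem leftAct_ac (h : IsBraidedHopfStar H) (x : BR q) :
    leftAct H.ψ 𝐚 (H.ψ (𝐜 ⊗ₜ x)) = 𝐬 • leftAct H.ψ 𝐜 (H.ψ (𝐚 ⊗ₜ x)) := by
  rw [← h.psi_mul_tmul, ← h.psi_mul_tmul, BR.a_mul_c', ← TensorProduct.smul_tmul', map_smul]

theorem leftAct_cb (h : IsBraidedHopfStar H) (hq : q ≠ 0) (x : BR q) :
    leftAct H.ψ 𝐜 (H.ψ (𝐛 ⊗ₜ x)) = 𝐬⁻¹ • leftAct H.ψ 𝐚 (H.ψ (𝐩 ⊗ₜ x)) -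
      (𝐬⁻¹) ^ 2 • leftAct H.ψ 𝐚 (H.ψ (𝐚 ⊗ₜ x)) - 𝐬⁻¹ • (x ⊗ₜ 1) := by
  rw [← h.psi_mul_tmul, ← h.psi_mul_tmul, ← h.psi_mul_tmul, BR.c_mul_b hq, TensorProduct.sub_tmul,
    TensorProduct.sub_tmul, map_sub, map_sub, ← TensorProduct.smul_tmul', map_smul,
    ← TensorProduct.smul_tmul', map_smul, ← TensorProduct.smul_tmul', map_smul, h.psi_one_left]

end IsBraidedHopfStar

end

section

/-! ### The possible braidings -/

theorem sq_ne_one (hq1 : q ^ 2 ≠ 1) : 𝐬 ≠ 1 := by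
  rw [sq]; exact_mod_cast hq1

theorem one_add_sq_ne_zero : 1 + 𝐬 ≠ 0 := by
  rw [sq]
  have : (1 : ℝ) + q ^ 2 ≠ 0 := by positivity
  exact_mod_cast this

/-- At least one of the two braidings `ψ(a ⊗ b)` and `ψ(a ⊗ c)` has no diagonal term. -/
theorem IsSolution.coef_ab_or_coef_ac (hq : q ≠ 0) {H : HopfData q} (h : IsSolution q H) :
    coef₂ hq .a .b (H.ψ (𝐚 ⊗ₜ 𝐛)) = 0 ∨ coef₂ hq .a .c (H.ψ (𝐚 ⊗ₜ 𝐜)) = 0 := by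
  obtain ⟨h, hA⟩ := h
  obtain ⟨d, hab⟩ := hA.psi_ab
  obtain ⟨f, hac⟩ := hA.psi_ac
  obtain ⟨z, hbb⟩ := hA.psi_bb
  have hba := h.psi_ba
  rw [hac] at hba
  simp only [starT_add, starT_smul, starT_tmul, BR.star_a, BR.star_c, BR.star_p, star_one] at hba
  have hs := sq_ne_zero hq
  have E := fun i j => congrArg (coef₂ hq i j) (h.leftAct_ba 𝐛)
  simp only [hab, hba, hbb, hA.psi_p_right, h.psi_one_right, map_add, map_smul, leftAct_tmul,
    BorelAlg.rmul_tmul, one_mul, mul_one, BR.b_mul_a, BR.p_mul_b hq, coef₂_tmul, coef_one, coef_a,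
    coef_b, coef_p, coef_ab, coef_bb, coef_bp, smul_eq_mul] at E
  have e := E .b .ab
  simp only [hab, hac, map_add, map_smul, one_mul, mul_one, coef₂_tmul, coef_one, coef_a, coef_b,
    coef_c, coef_p, smul_eq_mul, reduceCtorEq, if_true, if_false, mul_zero, mul_one, add_zero,
    zero_add] at e ⊢
  have e' : d 1 * star (f 1) = 0 := by
    have : 𝐬 * (d 1 * star (f 1)) = 0 := by linear_combination 𝐬 * e
    exact (mul_eq_zero.1 this).resolve_left hs
  rcases mul_eq_zero.1 e' with e' | e'
  · exact .inl e'
  · exact .inr (star_eq_zero.1 e')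

/-- The shape of `ψ(a ⊗ b)`, `ψ(b ⊗ b)` and `ψ(c ⊗ b)` forced by the compatibility of `ψ` with the
relations `b a = q² a b` and `a d - q² c b = 1`. -/
theorem IsSolution.psi_tmul_b (hq : q ≠ 0) (hq1 : q ^ 2 ≠ 1) {H : HopfData q} (h : IsSolution q H)
    (h1 : coef₂ hq .a .b (H.ψ (𝐚 ⊗ₜ 𝐛)) = 0) :
    H.ψ (𝐚 ⊗ₜ 𝐛) = 𝐛 ⊗ₜ 𝐚 ∧ ∃ z y : ℂ, z * y = 1 ∧ star y = y ∧
      H.ψ (𝐛 ⊗ₜ 𝐛) = z • (𝐛 ⊗ₜ 𝐛) ∧ H.ψ (𝐜 ⊗ₜ 𝐛) = y • (𝐛 ⊗ₜ 𝐜) := by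
  obtain ⟨h, hA⟩ := h
  obtain ⟨d, hab⟩ := hA.psi_ab
  obtain ⟨f, hac⟩ := hA.psi_ac
  obtain ⟨z, hbb⟩ := hA.psi_bb
  obtain ⟨c, hcb⟩ := hA.psi_cb
  obtain ⟨g, haa⟩ := hA.psi_aa
  have hba := h.psi_ba
  rw [hac] at hba
  simp only [starT_add, starT_smul, starT_tmul, BR.star_a, BR.star_c, BR.star_p, star_one] at hba
  have hs := sq_ne_zero hq
  have hs1 := sq_ne_one hq1
  simp only [hab, map_add, map_smul, mul_one, coef₂_tmul, coef_one, coef_a, coef_b, coef_p,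
    smul_eq_mul, reduceCtorEq, if_true, if_false, mul_zero, mul_one, add_zero, zero_add] at h1
  -- the relation for `c b` in the first argument, against `b`
  have E := fun i j => congrArg (coef₂ hq i j) (h.leftAct_cb hq 𝐛)
  simp only [hab, hbb, hcb, hA.psi_p_left, hA.psi_p_right, h.psi_one_right, quadratic, h1,
    zero_smul, map_add, map_sub, map_smul, map_zero, leftAct_tmul, BorelAlg.rmul_tmul, one_mul,
    mul_one, BR.b_mul_a, BR.p_mul_a, BR.p_mul_b hq, BR.c_mul_b hq, coef₂_tmul, coef_one, coef_a,
    coef_b, coef_c, coef_p, coef_aa, coef_ab, coef_ap, coef_bb, coef_bp, coef_pp, smul_eq_mul] at E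
  have e1 := E .b .a
  have e2 := E .b .p
  have e3 := E .b .pp
  have e4 := E .b .one
  have e5 := E .b .ap
  have e6 := E .p .bp
  have e7 := E .one .bp
  have e8 := E .a .ab
  have e9 := E .a .bp
  have e10 := E .c .bb
  have e11 := E .a .b
  have e12 := E .one .b
  have e13 := E .p .b
  have e14 := E .p .ab
  simp only [reduceCtorEq, if_true, if_false, mul_zero, mul_one, zero_mul, add_zero, zero_add,
    sub_zero, zero_sub, sub_self] at e1 e2 e3 e4 e5 e6 e7 e8 e9 e10 e11 e12 e13 e14
  have E := congrArg (coef₂ hq .b .bp) (h.leftAct_ba 𝐛)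
  simp only [hab, hbb, hA.psi_p_right, h.psi_one_right, h1, zero_smul, map_add, map_smul,
    leftAct_tmul, BorelAlg.rmul_tmul, one_mul, mul_one, BR.b_mul_a, BR.p_mul_b hq, coef₂_tmul,
    coef_one, coef_b, coef_p, coef_ab, coef_bb, coef_bp, smul_eq_mul, reduceCtorEq, if_true,
    if_false, mul_zero, mul_one, add_zero, zero_add] at E
  have hi := inv_ne_zero hs
  have hd5 : d 5 = 0 := by
    by_contra h5
    have hx : 2 * (𝐬⁻¹ * d 3) = 1 :=
      mul_left_cancel₀ (mul_ne_zero hi h5) (by linear_combination e2)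
    exact one_ne_zero (α := ℂ) (by linear_combination (-4) * e3 + (2 * (𝐬⁻¹ * d 3) - 1) * hx)
  have hzc : z * c 1 = 1 := mul_left_cancel₀ hi (by rw [hd5] at e4; linear_combination -e4)
  have hz : z ≠ 0 := left_ne_zero_of_mul_eq_one hzc
  have hd3 : d 3 = 0 := by
    have := mul_left_cancel₀ (mul_ne_zero (sub_ne_zero.2 hs1) hz)
      (show (𝐬 - 1) * z * d 3 = (𝐬 - 1) * z * 0 by linear_combination -E)
    exact this
  have hd0 : d 0 = 1 := mul_left_cancel₀ hi (by
    rw [hd3] at e5; linear_combination 𝐬⁻¹ * hzc - e5)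
  have key : c = quadStar c :=
    quadStar_of_starT hq (by rw [← hcb, ← h.psi_star, BR.star_b, BR.star_c])
  have hc0 : c 0 = 0 := (mul_eq_zero.1 e8).resolve_left hz
  have hc4 : c 4 = 0 := (mul_eq_zero.1 e9).resolve_left hz
  have hc2 : c 2 = 0 := (mul_eq_zero.1 e10).resolve_left hz
  have hc6 : c 6 = 0 := (mul_eq_zero.1 e11).resolve_left hz
  have hc3 : c 3 = 0 := by rw [key]; simp [quadStar, hc4]
  have hc5 : c 5 = 0 := by rw [key]; simp [quadStar, hc6]
  have hd2 : d 2 = 0 := by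
    rw [hc3, hd0] at e14
    refine (mul_eq_zero.1 (show (1 + 𝐬) * d 2 = 0 from ?_)).resolve_left one_add_sq_ne_zero
    refine (mul_eq_zero.1 (show 𝐬⁻¹ ^ 2 * ((1 + 𝐬) * d 2) = 0 from ?_)).resolve_left
      (pow_ne_zero 2 hi)
    linear_combination e14
  have hc7 : c 7 = 0 := (mul_eq_zero.1 (e12.trans (by rw [hd5]; ring))).resolve_left hz
  have hc10 : c 10 = 0 := (mul_eq_zero.1 (e13.trans (by rw [hd5]; ring))).resolve_left hz
  have hc8 : c 8 = 0 := (mul_eq_zero.1 (e6.trans (by rw [hd2]; ring))).resolve_left hz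
  have hc9 : c 9 = 0 := by rw [key]; simp [quadStar, hc10]
  have hd4 : d 4 = 0 := (mul_eq_zero.1 (show 𝐬⁻¹ * d 4 = 0 by
    rw [hc9, hd3] at e7; linear_combination -e7)).resolve_left hi
  refine ⟨by simp [hab, hd0, h1, hd2, hd3, hd4, hd5], z, c 1, hzc, ?_, hbb, ?_⟩
  · conv_rhs => rw [key]
    rfl
  · simp [hcb, quadratic, hc0, hc2, hc3, hc4, hc5, hc6, hc7, hc8, hc9, hc10]

/-- The compatibility of `ψ(· ⊗ a)` with the relations `a c = q² c a` and `a d - q² c b = 1`. -/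
theorem IsSolution.psi_tmul_a (hq : q ≠ 0) (hq1 : q ^ 2 ≠ 1) {H : HopfData q} (h : IsSolution q H)
    {z y : ℂ} (hzy : z * y = 1) (hy : star y = y) (hab : H.ψ (𝐚 ⊗ₜ 𝐛) = 𝐛 ⊗ₜ 𝐚)
    (hbb : H.ψ (𝐛 ⊗ₜ 𝐛) = z • (𝐛 ⊗ₜ 𝐛)) (hcb : H.ψ (𝐜 ⊗ₜ 𝐛) = y • (𝐛 ⊗ₜ 𝐜)) :
    ∃ g : ℂ, star g = g ∧ (1 - 𝐬 * y) * g = 0 ∧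
      H.ψ (𝐚 ⊗ₜ 𝐚) = 𝐚 ⊗ₜ 𝐚 + g • (𝐛 ⊗ₜ 𝐜) ∧
      H.ψ (𝐚 ⊗ₜ 𝐜) = 𝐜 ⊗ₜ 𝐚 - (𝐬⁻¹ * (1 + 𝐬⁻¹) * z * g) • (𝐚 ⊗ₜ 𝐜)
        + (𝐬⁻¹ * z * g) • (𝐩 ⊗ₜ 𝐜) := by
  obtain ⟨h, hA⟩ := h
  obtain ⟨f, hac⟩ := hA.psi_ac
  obtain ⟨g, haa⟩ := hA.psi_aa
  have hba := h.psi_ba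
  rw [hac] at hba
  have hca := h.psi_ca
  rw [hab] at hca
  have hcc := h.psi_cc
  rw [hbb] at hcc
  simp only [starT_add, starT_smul, starT_tmul, BR.star_a, BR.star_b, BR.star_c, BR.star_p,
    star_one] at hba hca hcc
  have hs := sq_ne_zero hq
  have hs1 := sq_ne_one hq1
  have hi := inv_ne_zero hs
  have E := fun i j => congrArg (coef₂ hq i j) (h.leftAct_ac 𝐚)
  simp only [hca, hcb, hcc, haa, hA.psi_p_right, h.psi_one_right, quadratic, map_add, map_sub,
    map_smul, leftAct_tmul, BorelAlg.rmul_tmul, one_mul, mul_one, BR.c_mul_a hq, BR.p_mul_c hq,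
    BR.c_mul_b hq, BR.b_mul_c hq, coef₂_tmul, coef_one, coef_a, coef_b, coef_c, coef_p, coef_aa,
    coef_ac, coef_ap, coef_cc, coef_cp, smul_eq_mul] at E
  have e1 := E .b .cc
  have e2 := E .c .ap
  have e3 := E .c .aa
  have e4 := E .a .cp
  have e5 := E .a .c
  have e6 := E .one .c
  have e7 := E .p .cp
  have e8 := E .one .cp
  have e9 := E .p .c
  simp only [reduceCtorEq, if_true, if_false, mul_zero, mul_one, add_zero, zero_add, sub_zero,
    zero_sub, sub_self] at e1 e2 e3 e4 e5 e6 e7 e8 e9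
  clear E
  have key : g = quadStar g :=
    quadStar_of_starT hq (by rw [← haa, ← h.psi_star, BR.star_a])
  have hz' : star z = z := by
    have hy0 : y ≠ 0 := right_ne_zero_of_mul_eq_one hzy
    refine mul_right_cancel₀ hy0 ?_
    rw [hzy]
    nth_rw 1 [← hy]
    rw [← star_mul', hzy, star_one]
  have cancel : ∀ x : ℂ, x = 𝐬 * x → x = 0 := fun x hx =>
    (mul_eq_zero.1 (show (1 - 𝐬) * x = 0 by linear_combination hx)).resolve_left
      (sub_ne_zero.2 hs1.symm)
  have hg4 := cancel _ e4
  have hg6 := cancel _ e5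
  have hg7 := cancel _ e6
  have hg8 := cancel _ e7
  have hg9 := cancel _ e8
  have hg10 := cancel _ e9
  have hg3 : g 3 = 0 := by rw [key]; simp [quadStar, hg4]
  have hg5 : g 5 = 0 := by rw [key]; simp [quadStar, hg6]
  have hg2 : g 2 = 0 := by
    refine cancel _ ?_
    field_simp at e2 e3
    linear_combination e2 + e3
  have haa' : H.ψ (𝐚 ⊗ₜ 𝐚) = g 0 • (𝐚 ⊗ₜ 𝐚) + g 1 • (𝐛 ⊗ₜ 𝐜) := by
    simp [haa, quadratic, hg2, hg3, hg4, hg5, hg6, hg7, hg8, hg9, hg10]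
  have E := fun i j => congrArg (coef₂ hq i j) (h.leftAct_cb hq 𝐚)
  simp only [hab, hca, hba, hcb, haa', hA.psi_p_left, hA.psi_p_right, h.psi_one_right, map_add,
    map_sub, map_smul, leftAct_tmul, BorelAlg.rmul_tmul, mul_one, BR.c_mul_a hq, BR.c_mul_b hq,
    coef₂_tmul, coef_one, coef_a, coef_b, coef_c, coef_p, coef_aa, coef_ac, coef_ap, coef_cp,
    smul_eq_mul] at E
  have k1 := E .b .ac
  have k2 := E .b .cp
  have k3 := E .b .c
  have k4 := E .a .aa
  have k5 := E .a .one
  have k6 := E .a .ap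
  have k7 := E .p .ap
  have k8 := E .one .ap
  simp only [reduceCtorEq, if_true, if_false, mul_zero, mul_one, zero_mul, add_zero, zero_add,
    sub_zero, zero_sub, sub_self] at k1 k2 k3 k4 k5 k6 k7 k8
  clear E
  have real : ∀ {x v : ℂ}, star x = v → star v = v → x = v := fun {x v} hx hv => by
    rw [← star_star x, hx, hv]
  have hg1 : star (g 1) = g 1 := by
    conv_rhs => rw [key]
    rfl
  have hf0 : f 0 = 1 := real (mul_left_cancel₀ hi (by linear_combination -k5)) (star_one _)
  have hg0 : g 0 = 1 := mul_left_cancel₀ hi (by rw [hf0, star_one] at k6; linear_combination -k6)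
  have hf3 : f 3 = 0 := star_eq_zero.1 ((mul_eq_zero.1 k7).resolve_right (by simpa using hs))
  have hf5 : f 5 = 0 := star_eq_zero.1 ((mul_eq_zero.1 k8).resolve_right (by simpa using hs))
  have hf4 : f 4 = 0 :=
    star_eq_zero.1 ((mul_eq_zero.1 k3).resolve_right (right_ne_zero_of_mul_eq_one hzy))
  have hf1 : f 1 = -(𝐬⁻¹ * (1 + 𝐬⁻¹) * z * g 1) := by
    refine real ?_ ?_
    · rw [hg0] at k1
      refine mul_left_cancel₀ hi ?_
      linear_combination z * k1 - star (f 1) * 𝐬⁻¹ * hzy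
    · simp only [star_neg, star_mul', star_add, star_inv₀, star_sq, star_one, hz', hg1]
  have hf2 : f 2 = 𝐬⁻¹ * z * g 1 := by
    refine real ?_ ?_
    · linear_combination z * k2 - star (f 2) * hzy
    · simp only [star_mul', star_inv₀, star_sq, hz', hg1]
  refine ⟨g 1, hg1, by linear_combination e1, by rw [haa', hg0, one_smul], ?_⟩
  simp [hac, hf0, hf1, hf2, hf3, hf4, hf5, sub_eq_add_neg]

/-- The compatibility of `ψ(· ⊗ c)` with the relation `a d - q² c b = 1` determines `ψ(b ⊗ c)`. -/
theorem IsSolution.psi_bc_eq (hq : q ≠ 0) {H : HopfData q} (h : IsSolution q H)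
    {g z y f₁ f₂ : ℂ} (hzy : z * y = 1) (haa : H.ψ (𝐚 ⊗ₜ 𝐚) = 𝐚 ⊗ₜ 𝐚 + g • (𝐛 ⊗ₜ 𝐜))
    (hac : H.ψ (𝐚 ⊗ₜ 𝐜) = 𝐜 ⊗ₜ 𝐚 + f₁ • (𝐚 ⊗ₜ 𝐜) + f₂ • (𝐩 ⊗ₜ 𝐜))
    (hca : H.ψ (𝐜 ⊗ₜ 𝐚) = 𝐚 ⊗ₜ 𝐜) (hcb : H.ψ (𝐜 ⊗ₜ 𝐛) = y • (𝐛 ⊗ₜ 𝐜))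
    (hcc : H.ψ (𝐜 ⊗ₜ 𝐜) = z • (𝐜 ⊗ₜ 𝐜)) :
    H.ψ (𝐛 ⊗ₜ 𝐜) = (-(𝐬⁻¹ * (1 + 𝐬⁻¹) * f₁)) • (𝐚 ⊗ₜ 𝐚) + (-(𝐬⁻¹ ^ 2 * f₁ * g * z)) • (𝐛 ⊗ₜ 𝐜)
      + y • (𝐜 ⊗ₜ 𝐛) + (-(𝐬⁻¹ * (1 + 𝐬⁻¹) * f₂)) • (𝐩 ⊗ₜ 𝐚) + (𝐬⁻¹ * f₁) • (𝐚 ⊗ₜ 𝐩)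
      + (𝐬⁻¹ * f₂) • (𝐩 ⊗ₜ 𝐩) := by
  obtain ⟨h, hA⟩ := h
  obtain ⟨k, hbc⟩ := hA.psi_bc
  have hs := sq_ne_zero hq
  have hi := inv_ne_zero hs
  have hz : z ≠ 0 := left_ne_zero_of_mul_eq_one hzy
  have hy : y ≠ 0 := right_ne_zero_of_mul_eq_one hzy
  have E := fun i j => congrArg (coef₂ hq i j) (h.leftAct_cb hq 𝐜)
  simp only [hac, hca, hbc, hcb, hcc, haa, hA.psi_p_left, hA.psi_p_right, h.psi_one_right,
    quadratic, map_add, map_sub, map_smul, leftAct_tmul, BorelAlg.rmul_tmul, mul_one, BR.c_mul_a hq,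
    BR.c_mul_b hq, coef₂_tmul, coef_one, coef_a, coef_b, coef_c, coef_p, coef_aa, coef_ac, coef_ap,
    coef_cc, coef_cp, smul_eq_mul] at E
  have e0 := E .a .ac
  have e1 := E .b .cc
  have e2 := E .c .ap
  have e3 := E .p .ac
  have e4 := E .a .cp
  have e5 := E .one .ac
  have e6 := E .a .c
  have e7 := E .one .c
  have e8 := E .p .cp
  have e9 := E .one .cp
  have e10 := E .p .c
  simp only [reduceCtorEq, if_true, if_false, mul_zero, mul_one, zero_mul, add_zero, zero_add,
    sub_zero, zero_sub, sub_self] at e0 e1 e2 e3 e4 e5 e6 e7 e8 e9 e10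
  clear E
  have h0 : k 0 = -(𝐬⁻¹ * (1 + 𝐬⁻¹) * f₁) :=
    mul_left_cancel₀ hi (by linear_combination e0)
  have h1 : k 1 = -(𝐬⁻¹ ^ 2 * f₁ * g * z) := by linear_combination z * e1 - k 1 * hzy
  have h2 : k 2 = y := mul_left_cancel₀ (mul_ne_zero hi hz) (by
    linear_combination e2 - 𝐬⁻¹ * hzy)
  have h3 : k 3 = -(𝐬⁻¹ * (1 + 𝐬⁻¹) * f₂) :=
    mul_left_cancel₀ hi (by linear_combination e3)
  have h5 : k 5 = 0 := by simpa [hs] using e5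
  simp [hbc, quadratic, h0, h1, h2, h3, e4, h5, e6, e7, e8, e9, e10]

/-- The values of the braiding on the generators, in the form to which the relations and the
`*`-structure reduce the general ansatz. -/
structure PsiForm (H : HopfData q) (g z y f₁ f₂ : ℂ) : Prop where
  zy : z * y = 1
  aa : H.ψ (𝐚 ⊗ₜ 𝐚) = 𝐚 ⊗ₜ 𝐚 + g • (𝐛 ⊗ₜ 𝐜)
  ab : H.ψ (𝐚 ⊗ₜ 𝐛) = 𝐛 ⊗ₜ 𝐚
  ac : H.ψ (𝐚 ⊗ₜ 𝐜) = 𝐜 ⊗ₜ 𝐚 + f₁ • (𝐚 ⊗ₜ 𝐜) + f₂ • (𝐩 ⊗ₜ 𝐜)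
  ba : H.ψ (𝐛 ⊗ₜ 𝐚) = 𝐚 ⊗ₜ 𝐛 + f₁ • (𝐛 ⊗ₜ 𝐚) + f₂ • (𝐛 ⊗ₜ 𝐩)
  bb : H.ψ (𝐛 ⊗ₜ 𝐛) = z • (𝐛 ⊗ₜ 𝐛)
  bc : H.ψ (𝐛 ⊗ₜ 𝐜) = (-(𝐬⁻¹ * (1 + 𝐬⁻¹) * f₁)) • (𝐚 ⊗ₜ 𝐚)
      + (-(𝐬⁻¹ ^ 2 * f₁ * g * z)) • (𝐛 ⊗ₜ 𝐜)
      + y • (𝐜 ⊗ₜ 𝐛) + (-(𝐬⁻¹ * (1 + 𝐬⁻¹) * f₂)) • (𝐩 ⊗ₜ 𝐚) + (𝐬⁻¹ * f₁) • (𝐚 ⊗ₜ 𝐩)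
      + (𝐬⁻¹ * f₂) • (𝐩 ⊗ₜ 𝐩)
  ca : H.ψ (𝐜 ⊗ₜ 𝐚) = 𝐚 ⊗ₜ 𝐜
  cb : H.ψ (𝐜 ⊗ₜ 𝐛) = y • (𝐛 ⊗ₜ 𝐜)
  cc : H.ψ (𝐜 ⊗ₜ 𝐜) = z • (𝐜 ⊗ₜ 𝐜)

/-- A braiding without diagonal term in `ψ(a ⊗ b)` is either a multiple of the flip on the
generators or the braiding of the first solution; the braid relation separates the two cases. -/
theorem IsSolution.psiForm (hq : q ≠ 0) (hq1 : q ^ 2 ≠ 1) {H : HopfData q} (h : IsSolution q H)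
    (h1 : coef₂ hq .a .b (H.ψ (𝐚 ⊗ₜ 𝐛)) = 0) :
    (∃ z y, PsiForm H 0 z y 0 0) ∨
      PsiForm H (1 - 𝐬) 𝐬 𝐬⁻¹ ((1 + 𝐬⁻¹) * (𝐬 - 1)) (1 - 𝐬) := by
  have hs := sq_ne_zero hq
  have hA := h.2
  obtain ⟨hab, z, y, hzy, hy, hbb, hcb⟩ := h.psi_tmul_b hq hq1 h1
  obtain ⟨g, hg, hgy, haa, hac⟩ := h.psi_tmul_a hq hq1 hzy hy hab hbb hcb
  have hz' : star z = z := by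
    have hy0 : y ≠ 0 := right_ne_zero_of_mul_eq_one hzy
    refine mul_right_cancel₀ hy0 ?_
    rw [hzy]
    nth_rw 1 [← hy]
    rw [← star_mul', hzy, star_one]
  have hba := h.1.psi_ba
  rw [hac] at hba
  have hca := h.1.psi_ca
  rw [hab] at hca
  have hcc := h.1.psi_cc
  rw [hbb] at hcc
  simp only [starT_add, starT_sub, starT_smul, starT_tmul, BR.star_a, BR.star_b, BR.star_c,
    BR.star_p, star_mul', star_add, star_inv₀, star_sq, star_one, hz', hg] at hba hca hcc
  rw [sub_eq_add_neg, ← neg_smul] at hac hba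
  have hbc := h.psi_bc_eq hq hzy haa hac hca hcb hcc
  have F : PsiForm H g z y (-(𝐬⁻¹ * (1 + 𝐬⁻¹) * z * g)) (𝐬⁻¹ * z * g) :=
    ⟨hzy, haa, hab, hac, hba, hbb, hbc, hca, hcb, hcc⟩
  by_cases hg0 : g = 0
  · left
    refine ⟨z, y, ?_⟩
    simpa [hg0] using F
  right
  have hyy : y = 𝐬⁻¹ := by
    have := (mul_eq_zero.1 hgy).resolve_right hg0
    field_simp
    linear_combination -this
  have hzz : z = 𝐬 := by
    rw [hyy] at hzy
    field_simp at hzy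
    exact hzy
  have E := congrArg (coef₃ hq .b .b .c) (LinearMap.congr_fun h.1.yang_baxter ((𝐚 ⊗ₜ 𝐛) ⊗ₜ 𝐚))
  simp only [LinearMap.comp_apply, on12_tmul, hab] at E
  simp only [← TensorProduct.assoc_symm_tmul, on23_symm, haa, hba, TensorProduct.tmul_add,
    TensorProduct.tmul_smul, map_add, map_smul] at E
  simp only [TensorProduct.assoc_symm_tmul, on12_tmul, hab, haa, hba, hbb, TensorProduct.add_tmul,
    ← TensorProduct.smul_tmul', map_add, map_smul] at E
  simp only [← TensorProduct.assoc_symm_tmul, on23_symm, haa, hab, hcb, coef₃_symm, hA.psi_p_right,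
    map_add, map_smul, coef₂_tmul, coef_a, coef_b, coef_c, coef_p, smul_eq_mul, reduceCtorEq,
    if_true, if_false, mul_zero, mul_one, add_zero, zero_add] at E
  have hgs : g = 1 - 𝐬 := by
    rw [hyy, hzz] at E
    have e : (1 + 𝐬) * g * g = (1 + 𝐬) * g * (1 - 𝐬) := by
      field_simp at E
      linear_combination g * E
    exact mul_left_cancel₀ (mul_ne_zero one_add_sq_ne_zero hg0) e
  have e1 : -(𝐬⁻¹ * (1 + 𝐬⁻¹) * z * g) = (1 + 𝐬⁻¹) * (𝐬 - 1) := by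
    rw [hzz, hgs]; field_simp; ring
  have e2 : 𝐬⁻¹ * z * g = 1 - 𝐬 := by rw [hzz, hgs]; field_simp
  rw [e1, e2, hgs, hzz, hyy] at F
  exact F

end

section

/-! ### The counit of a solution -/

theorem IsBraidedHopfStar.counit_star {H : HopfData q} (h : IsBraidedHopfStar H) (x : BR q) :
    H.ε (star x) = star (H.ε x) := by
  let ε' : BR q →ₗ[ℂ] ℂ :=
    { toFun := fun x => star (H.ε (star x))
      map_add' := by simp
      map_smul' := by simp }
  have key : ∀ t : BR q ⊗[ℂ] BR q, TensorProduct.rid ℂ (BR q) (ε'.lTensor (BR q) t) =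
      star (TensorProduct.lid ℂ (BR q) (H.ε.rTensor (BR q) (starT t))) := by
    intro t
    induction t using TensorProduct.induction_on with
    | zero => simp [starT_zero]
    | add s s' h h' => simp only [map_add, starT_add, star_add, h, h']
    | tmul m y => simp [starT_tmul, ε']
  have e : H.ε = ε' := counit_unique h.counit_left fun x => by
    rw [key, ← h.comul_star, h.counit_left, star_star]
  conv_rhs => rw [e]
  simp [ε']

/-- The counit of a solution is one of two characters. -/
theorem IsSolution.counit (hq : q ≠ 0) (hq1 : q ^ 2 ≠ 1) {H : HopfData q} (h : IsSolution q H) :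
    (H.ε 𝐚 = 1 ∨ H.ε 𝐚 = -1) ∧ H.ε 𝐛 = 0 ∧ H.ε 𝐜 = 0 ∧ H.ε 𝐩 = (1 + 𝐬⁻¹) * H.ε 𝐚 := by
  obtain ⟨h, hA⟩ := h
  have hs := sq_ne_zero hq
  have hs1 := sq_ne_one hq1
  obtain ⟨e, -, hb, hc, -⟩ := hA.counit
  have hcb : H.ε 𝐜 = H.ε 𝐛 := hc.trans hb.symm
  have hreal : H.ε 𝐜 = star (H.ε 𝐛) := by rw [← h.counit_star, BR.star_b]
  have e1 := congrArg H.ε (BR.b_mul_a (q := q))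
  have e2 := congrArg H.ε (BR.c_mul_b hq)
  have e3 := congrArg H.ε (BR.b_mul_c hq)
  simp only [map_smul, map_sub, h.counit_mul, h.counit_one, smul_eq_mul, mul_one, hcb] at e1 e2 e3
  have hab : H.ε 𝐚 * H.ε 𝐛 = 0 :=
    (mul_eq_zero.1 (show (1 - 𝐬) * (H.ε 𝐚 * H.ε 𝐛) = 0 by linear_combination e1)).resolve_left
      (sub_ne_zero.2 hs1.symm)
  have ha : H.ε 𝐚 ≠ 0 := by
    intro ha
    -- `ε(b)` would be real with a negative square
    rw [hcb] at hreal
    obtain ⟨r, hr⟩ := Complex.conj_eq_iff_real.1 hreal.symm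
    rw [ha, hr] at e3
    have e4 : ((r * r * q ^ 2 + 1 : ℝ) : ℂ) = 0 := by
      push_cast
      rw [sq_def]
      have := mul_inv_cancel₀ hs
      linear_combination 𝐬 * e3 - this
    have e5 : r * r * q ^ 2 + 1 = 0 := by exact_mod_cast e4
    nlinarith [sq_nonneg (r * q)]
  have hb0 : H.ε 𝐛 = 0 := (mul_eq_zero.1 hab).resolve_left ha
  rw [hb0] at e2 e3
  have hsq : H.ε 𝐚 ^ 2 = 1 := by
    refine mul_left_cancel₀ (mul_ne_zero (sub_ne_zero.2 hs1) hs) ?_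
    field_simp at e2 e3
    linear_combination 𝐬 * e3 - 𝐬 * e2
  refine ⟨mul_self_eq_one_iff.1 (by linear_combination hsq), hb0, hcb.trans hb0, ?_⟩
  refine mul_left_cancel₀ ha ?_
  linear_combination -e3 - 𝐬⁻¹ * hsq

end

section

/-! ### The possible coproducts -/

namespace IsBraidedHopfStar
variable {H : HopfData q}

theorem comul_mul_apply (h : IsBraidedHopfStar H) (x y : BR q) :
    H.Δ (x * y) = braidedMul H.ψ (H.Δ x ⊗ₜ H.Δ y) :=
  LinearMap.congr_fun h.comul_mul (x ⊗ₜ y)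

theorem comul_ba (h : IsBraidedHopfStar H) :
    braidedMul H.ψ (H.Δ 𝐛 ⊗ₜ H.Δ 𝐚) = 𝐬 • braidedMul H.ψ (H.Δ 𝐚 ⊗ₜ H.Δ 𝐛) := by
  rw [← h.comul_mul_apply, ← h.comul_mul_apply, BR.b_mul_a, map_smul]

theorem comul_cb (h : IsBraidedHopfStar H) (hq : q ≠ 0) :
    braidedMul H.ψ (H.Δ 𝐜 ⊗ₜ H.Δ 𝐛) = 𝐬⁻¹ • braidedMul H.ψ (H.Δ 𝐚 ⊗ₜ H.Δ 𝐩) -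
      (𝐬⁻¹) ^ 2 • braidedMul H.ψ (H.Δ 𝐚 ⊗ₜ H.Δ 𝐚) - 𝐬⁻¹ • (1 ⊗ₜ 1) := by
  simp only [← h.comul_mul_apply, BR.c_mul_b hq, map_sub, map_smul, h.comul_one]

/-- The relation `b c = q² c b + (1 - q⁻²) (1 - a²)`, in which `p` does not occur. -/
theorem comul_bc (h : IsBraidedHopfStar H) (hq : q ≠ 0) :
    braidedMul H.ψ (H.Δ 𝐛 ⊗ₜ H.Δ 𝐜) = 𝐬 • braidedMul H.ψ (H.Δ 𝐜 ⊗ₜ H.Δ 𝐛) +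
      (1 - 𝐬⁻¹) • (1 ⊗ₜ 1 - braidedMul H.ψ (H.Δ 𝐚 ⊗ₜ H.Δ 𝐚)) := by
  have hs := sq_ne_zero hq
  simp only [← h.comul_mul_apply, BR.c_mul_b hq, BR.b_mul_c hq, map_sub, map_smul, h.comul_one]
  match_scalars <;> field_simp <;> ring

end IsBraidedHopfStar

/-- The linear equations for the coefficients of `Δ(a)` and `Δ(b)` given by the counit. -/
theorem IsSolution.counit_equations (hq : q ≠ 0) (hq1 : q ^ 2 ≠ 1) {H : HopfData q}
    (h : IsSolution q H) (h1 : H.ε 𝐚 = 1) {A : Fin 11 → ℂ} {B : Fin 6 → ℂ}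
    (hA : H.Δ 𝐚 = quadratic q A)
    (hB : H.Δ 𝐛 = B 0 • (𝐚 ⊗ₜ 𝐛) + B 1 • (𝐛 ⊗ₜ 𝐚) + B 2 • (𝐛 ⊗ₜ 𝐩) + B 3 • (𝐩 ⊗ₜ 𝐛)
      + B 4 • (1 ⊗ₜ 𝐛) + B 5 • (𝐛 ⊗ₜ 1)) :
    (A 0 + (1 + 𝐬⁻¹) * A 3 + A 5 = 1 ∧ A 4 + (1 + 𝐬⁻¹) * A 8 + A 9 = 0 ∧
      A 6 + A 7 + (1 + 𝐬⁻¹) * A 10 = 0) ∧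
    (A 0 + (1 + 𝐬⁻¹) * A 4 + A 6 = 1 ∧ A 3 + (1 + 𝐬⁻¹) * A 8 + A 10 = 0 ∧
      A 5 + A 7 + (1 + 𝐬⁻¹) * A 9 = 0) ∧
    B 0 + (1 + 𝐬⁻¹) * B 3 + B 4 = 1 ∧ B 1 + (1 + 𝐬⁻¹) * B 2 + B 5 = 1 := by
  obtain ⟨-, hb, hc, hp⟩ := h.counit hq hq1
  rw [h1, mul_one] at hp
  have La := h.1.counit_left 𝐚
  have Ra := h.1.counit_right 𝐚
  have Lb := h.1.counit_left 𝐛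
  have Rb := h.1.counit_right 𝐛
  simp only [hA, hB, quadratic, map_add, map_smul, LinearMap.rTensor_tmul, LinearMap.lTensor_tmul,
    TensorProduct.lid_tmul, TensorProduct.rid_tmul, h1, hb, hc, hp, h.1.counit_one] at La Ra Lb Rb
  have E1 := fun i => congrArg (coef hq i) La
  have E2 := fun i => congrArg (coef hq i) Ra
  have E3 := congrArg (coef hq .b) Lb
  have E4 := congrArg (coef hq .b) Rb
  simp only [map_add, map_smul, coef_one, coef_a, coef_b, coef_c, coef_p, smul_eq_mul]
    at E1 E2 E3 E4
  have a1 := E1 .a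
  have a2 := E1 .p
  have a3 := E1 .one
  have b1 := E2 .a
  have b2 := E2 .p
  have b3 := E2 .one
  simp only [reduceCtorEq, if_true, if_false, mul_zero, mul_one, add_zero,
    zero_add] at a1 a2 a3 b1 b2 b3 E3 E4
  refine ⟨⟨?_, ?_, ?_⟩, ⟨?_, ?_, ?_⟩, ?_, ?_⟩
  · linear_combination a1
  · linear_combination a2
  · linear_combination a3
  · linear_combination b1
  · linear_combination b2
  · linear_combination b3
  · linear_combination E3
  · linear_combination E4

/-- A multiple of the flip on the generators is not the braiding of a solution. -/
theorem IsSolution.not_psiForm_zero (hq : q ≠ 0) (hq1 : q ^ 2 ≠ 1) {H : HopfData q} {z y : ℂ}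
    (h : IsSolution q H) (h1 : H.ε 𝐚 = 1) (hψ : PsiForm H 0 z y 0 0) : False := by
  obtain ⟨A, hA⟩ := h.2.comul_a
  obtain ⟨B, hB, hC⟩ := h.2.comul_bc
  obtain ⟨C, hP⟩ := h.2.comul_p
  have hs := sq_ne_zero hq
  have hs1 := sq_ne_one hq1
  have E := fun i j => congrArg (coef₂ hq i j) (h.1.comul_bc hq)
  have ψ1 := hψ.aa
  have ψ2 := hψ.ba
  have ψ3 := hψ.bc
  have ψ4 := hψ.ac
  simp only [zero_smul, mul_zero, zero_mul, neg_zero, add_zero, zero_add] at ψ1 ψ2 ψ3 ψ4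
  simp only [hA, hB, hC, quadratic, ψ1, ψ2, ψ3, ψ4, hψ.ab, hψ.bb, hψ.ca, hψ.cb, hψ.cc,
    h.2.psi_p_left, h.2.psi_p_right, h.1.psi_one_left, h.1.psi_one_right, map_add, map_sub,
    map_smul, TensorProduct.add_tmul, TensorProduct.tmul_add, ← TensorProduct.smul_tmul',
    TensorProduct.tmul_smul, braidedMul_tmul, BorelAlg.lmul_tmul, BorelAlg.rmul_tmul, one_mul,
    mul_one, BR.b_mul_a, BR.c_mul_a hq, BR.p_mul_a, BR.p_mul_b hq, BR.p_mul_c hq, BR.c_mul_b hq,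
    BR.b_mul_c hq, coef₂_tmul, coef_one, coef_a, coef_b, coef_c, coef_p, coef_aa, coef_ab, coef_ac,
    coef_ap, coef_bb, coef_bp, coef_cc, coef_cp, coef_pp, smul_eq_mul] at E
  have e1 := E .cc .bb
  have e2 := E .bb .cc
  have e3 := E .pp .pp
  have e4 := E .ab .ac
  have e5 := E .ac .ab
  simp only [reduceCtorEq, if_true, if_false, mul_zero, mul_one, add_zero, zero_add, zero_sub,
    sub_self] at e1 e2 e3 e4 e5
  clear E
  have E := fun i j => congrArg (coef₂ hq i j) h.1.comul_ba
  simp only [hA, hB, quadratic, ψ1, ψ2, ψ3, ψ4, hψ.ab, hψ.bb, hψ.ca, hψ.cb, h.2.psi_p_left,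
    h.2.psi_p_right, h.1.psi_one_left, h.1.psi_one_right, map_add, map_sub, map_smul,
    TensorProduct.add_tmul, TensorProduct.tmul_add, ← TensorProduct.smul_tmul',
    TensorProduct.tmul_smul, braidedMul_tmul, BorelAlg.lmul_tmul, BorelAlg.rmul_tmul, one_mul,
    mul_one, BR.b_mul_a, BR.c_mul_a hq, BR.p_mul_a, BR.p_mul_b hq, BR.p_mul_c hq, BR.c_mul_b hq,
    BR.b_mul_c hq, coef₂_tmul, coef_one, coef_a, coef_b, coef_c, coef_p, coef_aa, coef_ab, coef_ac,
    coef_ap, coef_bb, coef_bp, coef_cp, coef_pp, smul_eq_mul] at E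
  have f1 := E .aa .b
  have f2 := E .a .b
  have f3 := E .one .b
  simp only [reduceCtorEq, if_true, if_false, mul_zero, mul_one, add_zero, zero_add, sub_zero,
    zero_sub, sub_self] at f1 f2 f3
  clear E
  have E := fun i j => congrArg (coef₂ hq i j) (h.1.comul_cb hq)
  simp only [hA, hB, hC, hP, quadratic, ψ1, ψ2, ψ3, ψ4, hψ.ab, hψ.bb, hψ.ca, hψ.cb, hψ.cc,
    h.2.psi_p_left, h.2.psi_p_right, h.1.psi_one_left, h.1.psi_one_right, map_add, map_sub,
    map_smul, TensorProduct.add_tmul, TensorProduct.tmul_add, ← TensorProduct.smul_tmul',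
    TensorProduct.tmul_smul, braidedMul_tmul, BorelAlg.lmul_tmul, BorelAlg.rmul_tmul, one_mul,
    mul_one, BR.b_mul_a, BR.c_mul_a hq, BR.p_mul_a, BR.p_mul_b hq, BR.p_mul_c hq, BR.c_mul_b hq,
    BR.b_mul_c hq, coef₂_tmul, coef_one, coef_a, coef_b, coef_c, coef_p, coef_aa, coef_ab, coef_ac,
    coef_ap, coef_bb, coef_bp, coef_cc, coef_cp, coef_pp, smul_eq_mul] at E
  have d1 := E .bp .cp
  have d2 := E .cp .bp
  have d3 := E .b .c
  have d4 := E .c .b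
  simp only [reduceCtorEq, if_true, if_false, mul_zero, mul_one, add_zero, zero_add, sub_zero,
    sub_self] at d1 d2 d3 d4
  clear E
  have sq0 : ∀ {x : ℂ}, x * x = 0 → x = 0 := mul_self_eq_zero.1
  have hy : y ≠ 0 := right_ne_zero_of_mul_eq_one hψ.zy
  have hv : 1 - 𝐬⁻¹ ≠ 0 := by
    rw [sub_ne_zero, ne_comm, inv_ne_one]; exact hs1
  have hu : 1 - 𝐬 ≠ 0 := sub_ne_zero.2 hs1.symm
  have A2 : A 2 = 0 := sq0 (mul_left_cancel₀ (mul_ne_zero hv hy) (by linear_combination e1))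
  have A1 : A 1 = 0 := sq0 (mul_left_cancel₀ (mul_ne_zero hv hy) (by linear_combination e2))
  have A8 : A 8 = 0 := sq0 (mul_left_cancel₀ hv (by linear_combination e3))
  simp only [A1, A2, A8, mul_zero, zero_mul, add_zero, zero_add, sub_zero, neg_zero]
    at e4 e5 f1 f2 f3 d1 d2 d3 d4
  have B2 : B 2 = 0 := sq0 (mul_left_cancel₀ hy (by linear_combination d1))
  have B3 : B 3 = 0 := sq0 d2
  obtain ⟨-, -, hB0, hB1⟩ := h.counit_equations hq hq1 h1 hA hB
  rw [B3] at hB0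
  rw [B2] at hB1
  have g1 : A 6 * B 0 = 0 := mul_left_cancel₀ hu (by linear_combination f1)
  have g2 : A 6 * B 4 + A 7 * B 0 = 0 := mul_left_cancel₀ hu (by linear_combination f2)
  have g3 : A 7 * B 4 = 0 := mul_left_cancel₀ hu (by linear_combination f3)
  have A7 : A 7 = 0 := by
    linear_combination (-A 7 - A 7 * B 0) * hB0 + B 0 * g2 - B 4 * g1 + (1 + B 0) * g3
  rw [A7] at d3 d4
  have B4 : B 4 = 0 := sq0 (by linear_combination d4)
  have B5 : B 5 = 0 := sq0 (mul_left_cancel₀ hy (by linear_combination d3))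
  have hB0 : B 0 = 1 := by linear_combination hB0 - B4
  have hB1 : B 1 = 1 := by linear_combination hB1 - B5
  rw [hB0] at e5
  rw [hB1] at e4
  field_simp at e4 e5
  refine mul_ne_zero hu (one_add_sq_ne_zero (q := q)) ?_
  linear_combination -e5 - 𝐬 * e4

/-- The braiding of the first solution determines the coproduct. -/
theorem IsSolution.comul_of_psiForm (hq : q ≠ 0) (hq1 : q ^ 2 ≠ 1) {H : HopfData q}
    (h : IsSolution q H) (h1 : H.ε 𝐚 = 1)
    (hψ : PsiForm H (1 - 𝐬) 𝐬 𝐬⁻¹ ((1 + 𝐬⁻¹) * (𝐬 - 1)) (1 - 𝐬)) :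
    H.Δ 𝐚 = comulA q ∧ H.Δ 𝐛 = comulB q ∧ H.Δ 𝐜 = comulC q ∧ H.Δ 𝐩 = comulP q := by
  obtain ⟨A, hA⟩ := h.2.comul_a
  obtain ⟨B, hB, hC⟩ := h.2.comul_bc
  obtain ⟨C, hP⟩ := h.2.comul_p
  have hs := sq_ne_zero hq
  have hs1 := sq_ne_one hq1
  have E := fun i j => congrArg (coef₂ hq i j) h.1.comul_ba
  simp only [hA, hB, quadratic, hψ.aa, hψ.bc, hψ.ba, hψ.ac, hψ.ab, hψ.bb, hψ.ca, hψ.cb,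
    h.2.psi_p_left, h.2.psi_p_right, h.1.psi_one_left, h.1.psi_one_right, map_add, map_sub,
    map_smul, TensorProduct.add_tmul, TensorProduct.tmul_add, ← TensorProduct.smul_tmul',
    TensorProduct.tmul_smul, braidedMul_tmul, BorelAlg.lmul_tmul, BorelAlg.rmul_tmul, one_mul,
    mul_one, BR.b_mul_a, BR.c_mul_a hq, BR.p_mul_a, BR.p_mul_b hq, BR.p_mul_c hq, BR.c_mul_b hq,
    BR.b_mul_c hq, coef₂_tmul, coef_one, coef_a, coef_b, coef_c, coef_p, coef_aa, coef_ab, coef_ac,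
    coef_ap, coef_bb, coef_bp, coef_cp, coef_pp, smul_eq_mul] at E
  have e1 := E .ac .bb
  have e2 := E .cp .bb
  have e3 := E .c .bb
  have e4 := E .ab .pp
  have e5 := E .ab .p
  have e6 := E .a .b
  simp only [reduceCtorEq, if_true, if_false, mul_zero, mul_one, add_zero, zero_add,
    sub_self] at e1 e2 e3 e4 e5 e6
  clear E
  have E := fun i j => congrArg (coef₂ hq i j) (h.1.comul_cb hq)
  simp only [hA, hB, hC, hP, quadratic, hψ.aa, hψ.bc, hψ.ba, hψ.ac, hψ.ab, hψ.bb, hψ.ca, hψ.cb,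
    hψ.cc, h.2.psi_p_left, h.2.psi_p_right, h.1.psi_one_left, h.1.psi_one_right, map_add, map_sub,
    map_smul, TensorProduct.add_tmul, TensorProduct.tmul_add, ← TensorProduct.smul_tmul',
    TensorProduct.tmul_smul, braidedMul_tmul, BorelAlg.lmul_tmul, BorelAlg.rmul_tmul, one_mul,
    mul_one, BR.b_mul_a, BR.c_mul_a hq, BR.p_mul_a, BR.p_mul_b hq, BR.p_mul_c hq, BR.c_mul_b hq,
    BR.b_mul_c hq, coef₂_tmul, coef_one, coef_a, coef_b, coef_c, coef_p, coef_aa, coef_ab, coef_ac,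
    coef_ap, coef_bb, coef_bp, coef_cc, coef_cp, coef_pp, smul_eq_mul] at E
  have d2 := E .cp .bp
  simp only [reduceCtorEq, if_true, if_false, mul_zero, mul_one, add_zero, zero_add, sub_zero,
    sub_self] at d2
  clear E
  have E := fun j k => congrArg (coef₃ hq .b j k) (LinearMap.congr_fun h.1.psi_comul_left (𝐚 ⊗ₜ 𝐚))
  simp only [LinearMap.comp_apply, co12_apply] at E
  simp only [hψ.aa, hA, quadratic, map_add, map_smul, co23_apply, coef₃_symm, coef_a, coef_b,
    TensorProduct.add_tmul, ← TensorProduct.smul_tmul', hC] at E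
  simp only [← TensorProduct.assoc_symm_tmul, on23_symm, hψ.aa, hψ.ba, hψ.ca, h.2.psi_p_left,
    h.1.psi_one_left, TensorProduct.tmul_add, TensorProduct.tmul_smul, map_add, map_smul] at E
  simp only [TensorProduct.assoc_symm_tmul, on12_tmul, coef₃_tmul, hψ.aa, hψ.ba, hψ.ab, hψ.ca,
    hψ.cb, h.2.psi_p_left, h.1.psi_one_left, map_add, map_smul, coef₂_tmul, coef_one, coef_a,
    coef_b, coef_c, coef_p, smul_eq_mul, reduceCtorEq, if_true, if_false, mul_zero, zero_mul,
    add_zero, zero_add] at E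
  have c0 := E .c .a
  have c1 := E .a .c
  have c2 := E .p .c
  have c3 := E .c .p
  have c4 := E .c .one
  have c5 := E .one .c
  simp only [reduceCtorEq, if_true, if_false, mul_zero, mul_one, add_zero,
    zero_add] at c0 c1 c2 c3 c4 c5
  clear E
  have m1 := congrArg (coef₃ hq .b .b .c) (LinearMap.congr_fun h.1.psi_comul_right (𝐚 ⊗ₜ 𝐛))
  simp only [LinearMap.comp_apply, co23_apply] at m1
  simp only [hψ.ab, hB, map_add, map_smul, co12_apply, coef₃_tmul, TensorProduct.tmul_add,
    TensorProduct.tmul_smul, TensorProduct.assoc_symm_tmul, on12_tmul] at m1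
  simp only [hψ.aa, hψ.ab, h.2.psi_p_right, h.1.psi_one_right, TensorProduct.add_tmul,
    ← TensorProduct.smul_tmul', ← TensorProduct.assoc_symm_tmul, map_add, map_smul, on23_symm] at m1
  simp only [hψ.cb, TensorProduct.tmul_add, TensorProduct.tmul_smul, map_add, map_smul, coef₃_symm,
    coef₂_tmul, coef_one, coef_a, coef_b, coef_c, coef_p, smul_eq_mul, reduceCtorEq, if_true,
    if_false, mul_zero, mul_one, add_zero, zero_add] at m1
  have E := fun i j k => congrArg (coef₃ hq i j k) (LinearMap.congr_fun h.1.coassoc 𝐛)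
  simp only [LinearMap.comp_apply, hB, map_add, map_smul, co12_apply, co23_apply, hA, hP,
    h.1.comul_one, quadratic, TensorProduct.add_tmul, coef₃_symm, coef₃_tmul, coef₂_tmul, coef_one,
    coef_a, coef_b, coef_c, coef_p, smul_eq_mul] at E
  have k1 := E .c .b .b
  have k2 := E .p .p .b
  simp only [reduceCtorEq, if_true, if_false, mul_zero, mul_one, zero_mul, add_zero,
    zero_add] at k1 k2
  clear E
  have hu : 1 - 𝐬 ≠ 0 := sub_ne_zero.2 hs1.symm
  have he : 1 + 𝐬⁻¹ ≠ 0 := by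
    intro h0
    refine one_add_sq_ne_zero (q := q) ?_
    have := mul_inv_cancel₀ hs
    linear_combination 𝐬 * h0 - this
  obtain ⟨⟨la1, la2, la3⟩, ⟨ra1, ra2, ra3⟩, hB0, hB1⟩ := h.counit_equations hq hq1 h1 hA hB
  have hstar : A = quadStar A := quadStar_of_starT hq (by
    rw [← hA, ← h.1.comul_star, BR.star_a])
  have hA3 : A 3 = star (A 4) := congrFun hstar 3
  have hA5 : A 5 = star (A 6) := congrFun hstar 5
  -- `A₂` annihilates `B₀`, `B₃` and `B₄`, of which a combination is `1`
  have hA2 : A 2 = 0 := by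
    have n1 : A 2 * B 0 = 0 := mul_left_cancel₀ hu (by field_simp at e1; linear_combination e1)
    have n2 : A 2 * B 3 = 0 :=
      mul_left_cancel₀ (mul_ne_zero hu (one_add_sq_ne_zero (q := q))) (by
        field_simp at e2; linear_combination e2)
    have n3 : A 2 * B 4 = 0 :=
      mul_left_cancel₀ (mul_ne_zero hu (one_add_sq_ne_zero (q := q))) (by
        field_simp at e3; linear_combination e3)
    linear_combination (-A 2) * hB0 + n1 + (1 + 𝐬⁻¹) * n2 + n3
  simp only [hA2, zero_mul, mul_zero, add_zero, zero_add, sub_zero] at c0 c3 k1 k2 d2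
  have b0 : B 0 = A 0 := mul_left_cancel₀ hu (by linear_combination c0)
  have b3 : B 3 = A 4 := mul_left_cancel₀ hu (by linear_combination c3)
  have b4 : B 4 = A 6 := mul_left_cancel₀ hu (by linear_combination c4)
  have b5 : B 5 = A 5 := mul_left_cancel₀ hu (by linear_combination c5)
  have b2 : B 2 = A 1 + A 3 := mul_left_cancel₀ hu (by linear_combination c2)
  have b1 : B 1 = A 0 - (1 + 𝐬⁻¹) * A 1 := mul_left_cancel₀ hu (by linear_combination c1)
  have b1' : B 1 = - 𝐬⁻¹ * B 0 := mul_left_cancel₀ hu (by linear_combination -m1)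
  have a1 : A 1 = A 0 := mul_left_cancel₀ he (by linear_combination b1 - b1' + 𝐬⁻¹ * b0)
  have n4 : A 4 * B 0 = 0 := mul_left_cancel₀ hu (by linear_combination e4)
  have n5 : A 6 * B 0 = 0 := mul_left_cancel₀ hu (by linear_combination e5)
  have n6 : A 6 * B 4 + A 7 * B 0 = 0 := mul_left_cancel₀ hu (by linear_combination e6)
  -- if `B₀ = 0`, then `B₃ ≠ 0`, so `C₂ = 0` and therefore `B₃² = 0`
  have hne : B 0 ≠ 0 := by
    intro h0
    rw [h0, b4, mul_zero, add_zero, mul_self_eq_zero] at n6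
    rw [h0, b4, n6, add_zero, zero_add] at hB0
    have hne3 : B 3 ≠ 0 := right_ne_zero_of_mul_eq_one hB0
    have hC2 : C 2 = 0 := by
      refine (mul_eq_zero.1 (?_ : B 3 * C 2 = 0)).resolve_left hne3
      rw [k1]
    rw [hC2, zero_mul, mul_zero] at d2
    exact hne3 (mul_self_eq_zero.1 d2)
  have a4 : A 4 = 0 := (mul_eq_zero.1 n4).resolve_right hne
  have a6 : A 6 = 0 := (mul_eq_zero.1 n5).resolve_right hne
  have a3 : A 3 = 0 := by rw [hA3, a4, star_zero]
  have a5 : A 5 = 0 := by rw [hA5, a6, star_zero]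
  rw [a4] at b3
  rw [a6] at b4
  rw [a5] at b5
  rw [b3, b4] at hB0
  rw [b3] at k2
  have b0' : B 0 = 1 := by linear_combination hB0
  have a0 : A 0 = 1 := b0.symm.trans b0'
  rw [a0] at a1
  rw [a1, a3, add_zero] at b2
  rw [b0', mul_one] at b1'
  have a8 : A 8 = 0 := by
    rw [b0'] at k2
    linear_combination -k2
  have a9 : A 9 = 0 := by linear_combination la2 - a4 - (1 + 𝐬⁻¹) * a8
  have a10 : A 10 = 0 := by linear_combination ra2 - a3 - (1 + 𝐬⁻¹) * a8
  have a7 : A 7 = 0 := by linear_combination la3 - a6 - (1 + 𝐬⁻¹) * a10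
  have ha : H.Δ 𝐚 = comulA q := by
    rw [hA, quadratic, a0, a1, hA2, a3, a4, a5, a6, a7, a8, a9, a10, comulA]
    simp only [one_smul, zero_smul, add_zero]
  have hb : H.Δ 𝐛 = comulB q := by
    rw [hB, b0', b1', b2, b3, b4, b5, comulB]
    module
  have hc : H.Δ 𝐜 = comulC q := by
    rw [hC, b0', b1', b2, b3, b4, b5, comulC]
    module
  refine ⟨ha, hb, hc, ?_⟩
  -- the component of coassociativity at `b` that starts with `b` contains `Δ(p)`
  have E := fun j k => congrArg (coef₃ hq .b j k) (LinearMap.congr_fun h.1.coassoc 𝐛)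
  simp only [LinearMap.comp_apply, ha, hb, hP, quadratic, comulA, comulB, map_add, map_sub,
    map_smul, co12_apply, co23_apply, TensorProduct.add_tmul, TensorProduct.sub_tmul,
    ← TensorProduct.smul_tmul', coef₃_symm, coef₃_tmul, coef₂_tmul, coef_one, coef_a, coef_b,
    coef_c, coef_p, smul_eq_mul] at E
  have r0 := E .a .a
  have r1 := E .b .c
  have r2 := E .c .b
  have r3 := E .p .a
  have r4 := E .a .p
  have r5 := E .one .a
  have r6 := E .a .one
  have r7 := E .one .one
  have r8 := E .p .p
  have r9 := E .one .p
  have r10 := E .p .one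
  simp only [reduceCtorEq, if_true, if_false, mul_zero, mul_one, add_zero, zero_add, sub_zero,
    zero_sub, sub_self] at r0 r1 r2 r3 r4 r5 r6 r7 r8 r9 r10
  have p0 : C 0 = 𝐬⁻¹ + 𝐬⁻¹ ^ 2 := by linear_combination r0
  have p1 : C 1 = 𝐬⁻¹ := by linear_combination r1
  have p2 : C 2 = 1 := by linear_combination r2
  have p3 : C 3 = -𝐬⁻¹ := by linear_combination r3
  have p4 : C 4 = -𝐬⁻¹ := by linear_combination r4
  have p5 : C 5 = 0 := by linear_combination r5
  have p6 : C 6 = 0 := by linear_combination r6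
  have p7 : C 7 = 0 := by linear_combination r7
  have p8 : C 8 = 1 := by linear_combination r8
  have p9 : C 9 = 0 := by linear_combination r9
  have p10 : C 10 = 0 := by linear_combination r10
  rw [hP, quadratic, p0, p1, p2, p3, p4, p5, p6, p7, p8, p9, p10, comulP]
  module

end

section

/-! ### Classification of the solutions -/

theorem psi_tmul_eq_of_gen {H : HopfData q} (hq : q ≠ 0) (h : ∀ x, H.ψ (1 ⊗ₜ x) = x ⊗ₜ 1)
    (hp : ∀ x, H.ψ (𝐩 ⊗ₜ x) = x ⊗ₜ 𝐩) {x : BR q} (ha : H.ψ (𝐚 ⊗ₜ x) = psi hq (𝐚 ⊗ₜ x))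
    (hb : H.ψ (𝐛 ⊗ₜ x) = psi hq (𝐛 ⊗ₜ x)) (hc : H.ψ (𝐜 ⊗ₜ x) = psi hq (𝐜 ⊗ₜ x)) :
    ∀ v ∈ genSpan q, H.ψ (v ⊗ₜ x) = psi hq (v ⊗ₜ x) := by
  intro v hv
  refine mem_genSpan_induction (P := fun v => H.ψ (v ⊗ₜ x) = psi hq (v ⊗ₜ x)) ?_ ha hb hc ?_ ?_
    ?_ ?_ hv
  · rw [h, psi_one_tmul]
  · rw [hp, psi_p_tmul]
  · simp only [TensorProduct.zero_tmul, map_zero]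
  · intro x y hx hy
    simp only [TensorProduct.add_tmul, map_add, hx, hy]
  · intro r x hx
    simp only [← TensorProduct.smul_tmul', map_smul, hx]

/-- A solution with `ε(a) = 1` whose braiding `ψ(a ⊗ b)` has no diagonal term is the first
solution. -/
theorem IsSolution.eq_first (hq : q ≠ 0) (hq1 : q ^ 2 ≠ 1) {H : HopfData q}
    (h : IsSolution q H) (h1 : H.ε 𝐚 = 1) (h2 : coef₂ hq .a .b (H.ψ (𝐚 ⊗ₜ 𝐛)) = 0) :
    H = first hq := by
  have hs := sq_ne_zero hq
  rcases h.psiForm hq hq1 h2 with ⟨z, y, hψ⟩ | hψ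
  · exact (h.not_psiForm_zero hq hq1 h1 hψ).elim
  have F := isFirst_first hq
  have G := isBraidedHopfStar_first hq
  obtain ⟨hA, hB, hC, hP⟩ := h.comul_of_psiForm hq hq1 h1 hψ
  have hψF : (first hq).ψ = psi hq := rfl
  have K : ∀ {x : BR q}, H.ψ (𝐚 ⊗ₜ x) = (first hq).ψ (𝐚 ⊗ₜ x) →
      H.ψ (𝐛 ⊗ₜ x) = (first hq).ψ (𝐛 ⊗ₜ x) → H.ψ (𝐜 ⊗ₜ x) = (first hq).ψ (𝐜 ⊗ₜ x) →
      ∀ v ∈ genSpan q, H.ψ (v ⊗ₜ x) = psi hq (v ⊗ₜ x) := fun ha hb hc =>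
    psi_tmul_eq_of_gen hq h.1.psi_one_left h.2.psi_p_left ha hb hc
  refine BraidedSL.eq_first hq h.1 (K ?_ ?_ ?_) (K ?_ ?_ ?_) (K ?_ ?_ ?_) (K ?_ ?_ ?_)
    hA hB hC hP
  · rw [hψ.aa, F.psi_aa, sq_def]
  · rw [h.2.psi_ba, F.psi_ba, hψ.ac, F.psi_ac, zpow_neg_two, sq_def]
    congr 1
    match_scalars <;> field_simp <;> ring
  · rw [hψ.ca, F.psi_ca, F.psi_ab, starT_tmul, BR.star_a, BR.star_b]
  · rw [hψ.ab, F.psi_ab]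
  · rw [hψ.bb, F.psi_bb, sq_def]
  · rw [hψ.cb, F.psi_cb, zpow_neg_two]
  · rw [hψ.ac, F.psi_ac, zpow_neg_two, sq_def]
    match_scalars <;> field_simp <;> ring
  · rw [hψ.bc, F.psi_bc, zpow_neg_two, zpow_neg_four, zpow_neg_six, sq_def]
    match_scalars <;> field_simp <;> ring
  · rw [h.2.psi_cc, F.psi_cc, hψ.bb, F.psi_bb, sq_def]
  · rw [h.2.psi_p_right, hψF, psi_tmul_p]
  · rw [h.2.psi_p_right, hψF, psi_tmul_p]
  · rw [h.2.psi_p_right, hψF, psi_tmul_p]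

/-- The isomorphism `B_q(R) ≅ B_{q⁻¹}(R)` exchanges the two alternatives of
`IsSolution.coef_ab_or_coef_ac`. -/
theorem IsSolution.eq_first_or_eq_second (hq : q ≠ 0) (hq1 : q ^ 2 ≠ 1) {H : HopfData q}
    (h : IsSolution q H) (h1 : H.ε 𝐚 = 1) : H = first hq ∨ H = second hq := by
  rcases h.coef_ab_or_coef_ac hq with h2 | h2
  · exact Or.inl (h.eq_first hq hq1 h1 h2)
  · right
    have hqi : q * q⁻¹ = 1 := mul_inv_cancel₀ hq
    have hq0' := inv_ne_zero hq
    have hq1' : q⁻¹ ^ 2 ≠ 1 := by rwa [inv_pow, ne_eq, inv_eq_one]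
    have F := flips_flipEquiv hqi
    have T := isTransport_transport (flipEquiv hqi) H
    have e : H.transport (flipEquiv hqi) = first hq0' := by
      refine (h.transport_flip hqi).eq_first hq0' hq1' ?_ ?_
      · rw [T.counit_of_eq F.hα F.a, h1, inv_one, one_mul]
      · obtain ⟨f, hf⟩ := h.2.psi_ac
        have hf1 : f 1 = 0 := by
          simpa [hf, coef₂_tmul, coef_one, coef_a, coef_c, coef_p] using h2
        rw [T.psi_of_eq F.hα F.hβ F.a F.c, hf, hf1]
        simp [sqMap_tmul, F.a, F.c, F.p, coef₂_tmul, coef_one, coef_a, coef_b, coef_p]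
    rw [second, ← e, transport_flip_flip hqi]

theorem first_ne_second (hq : q ≠ 0) (hq1 : q ^ 2 ≠ 1) : first hq ≠ second hq := by
  intro e
  have hs := sq_ne_zero hq
  have h := (isFirst_first hq).psi_bb
  rw [e, (isSecond_second hq).psi_bb] at h
  have h' := congrArg (coef₂ hq .b .b) h
  simp only [map_smul, coef₂_tmul, coef_b, if_true, smul_eq_mul, mul_one, zpow_neg_two,
    sq_def] at h'
  refine mul_ne_zero (sub_ne_zero.2 (sq_ne_one hq1)) (one_add_sq_ne_zero (q := q)) ?_
  field_simp at h'
  linear_combination -h'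

theorem counit_signTwist (hq : q ≠ 0) (H : HopfData q) : H.signTwist.ε 𝐚 = -H.ε 𝐚 := by
  rw [(isTransport_signTwist hq H).counit_of_eq (neg_ne_zero.2 one_ne_zero)
    (scales_signEquiv hq).a]
  simp

end

end

end BraidedSL

end

theorem mainTheorem2 (q : ℝ) (hq0 : q ≠ 0) (hq1 : q ^ 2 ≠ 1) :
    ∃ H₁ H₂ : BraidedSL.HopfData q,
      BraidedSL.IsFirst q H₁ ∧ BraidedSL.IsMajid q H₁ ∧ BraidedSL.IsSecond q H₂ ∧ H₁ ≠ H₂ ∧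
      (∀ H : BraidedSL.HopfData q,
        BraidedSL.IsSolution q H ∧ H.ε (BraidedSL.BR.a q) = 1 ↔ H = H₁ ∨ H = H₂) ∧
      (∀ H : BraidedSL.HopfData q,
        BraidedSL.IsSolution q H ↔
          H = H₁ ∨ H = H₂ ∨ H = H₁.signTwist ∨ H = H₂.signTwist) := by
  have F := BraidedSL.isFirst_first hq0
  have G := BraidedSL.isSecond_second hq0
  have S₁ := BraidedSL.isSolution_first hq0
  have S₂ := BraidedSL.isSolution_second hq0
  refine ⟨BraidedSL.first hq0, BraidedSL.second hq0, F,
    F.isMajid hq0 (BraidedSL.psi_p_tmul hq0) (BraidedSL.psi_tmul_p hq0), G,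
    BraidedSL.first_ne_second hq0 hq1,
    fun H => ⟨fun h => h.1.eq_first_or_eq_second hq0 hq1 h.2, ?_⟩, fun H => ⟨fun h => ?_, ?_⟩⟩
  · rintro (rfl | rfl)
    exacts [⟨S₁, F.counit_a⟩, ⟨S₂, G.counit_a⟩]
  · rcases (h.counit hq0 hq1).1 with h1 | h1
    · rcases h.eq_first_or_eq_second hq0 hq1 h1 with e | e
      exacts [Or.inl e, Or.inr (Or.inl e)]
    · have h1' : H.signTwist.ε (BraidedSL.BR.a q) = 1 := by
        rw [BraidedSL.counit_signTwist hq0, h1, neg_neg]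
      rw [← BraidedSL.signTwist_signTwist hq0 H]
      rcases (h.signTwist hq0).eq_first_or_eq_second hq0 hq1 h1' with e | e
      · exact Or.inr (Or.inr (Or.inl (congrArg _ e)))
      · exact Or.inr (Or.inr (Or.inr (congrArg _ e)))
  · rintro (rfl | rfl | rfl | rfl)
    exacts [S₁, S₂, S₁.signTwist hq0, S₂.signTwist hq0]
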